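/- **Setting.** Let $n\ge 1$ compute nodes have weights $p_1,\dots,p_n\ge 0$ with $\sum_c p_c=1$ and local data distributions $\mathcal D_1,\dots,\mathcal D_n$, and let $\mathcal D=\sum_c p_c\mathcal D_c$. Let $f(w;\xi)$, $w\in\mathbb R^q$, be differentiable in $w$, integrable in $\xi\sim\mathcal D$, and suppose that for every $\xi$ the function $f(\cdot;\xi)$ is convex and $L$-smooth (its gradient is $L$-Lipschitz), $L>0$. Suppose that $F(w)=\mathbb E_{\xi\sim\mathcal D}f(w;\xi)$ is $\mu$-strongly convex, $\mu>0$, with minimizer $w_*$, and that $N=2\,\mathbb E_{\xi\sim\mathcal D}\|\nabla f(w_*;\xi)\|^2<\infty$. (No bound on the gradients is assumed.) **Sequences.** Let $d,m\ge 0$ be integers with $m+1>2(d+1)$, and put $$s_i=\left\lceil \frac{m+i+1}{16(d+1)^2}\,\frac1{\ln\frac{m+i+1}{2(d+1)}}\right\rceil,\quad S_i=\sum_{j<i}s_j,\quad M_0=\frac{(m+1)^2}4,\quad M_1=\max\Big\{d+2,\ \frac{72L}{\mu},\ \frac{s_0}2\Big\},$$ $$\tau(x)=M_1+\sqrt{\frac{x+M_0}{4\ln(x+M_0)}},\qquad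 \bar\eta_i=\frac{12}\mu\cdot\frac1{S_i+2M_1+\sqrt{(M_0+S_i)/\ln(M_0+S_i)}} .$$ **Algorithm.** In advance, each slot $(i,t')$, $0\le t'<s_i$, is assigned independently to a random node $a(i,t')$, with $P(a(i,t')=c)=p_c$; let $s_{i,c}$ be the number of slots of round $i$ assigned to $c$. Server and nodes start with the same model $w_0$. In its local round $i=0,1,2,\dots$, with $U=0$ at its start, node $c$ performs $s_{i,c}$ iterations numbered $h=0,\dots,s_{i,c}-1$: it draws a fresh $\xi\sim\mathcal D_c$, computes $g=\nabla f(\hat w;\xi)$ at its current local model $\hat w$, and replaces $U$ by $U+g$ and $\hat w$ by $\hat w-\bar\eta_i g$. Before each iteration it waits as long as $\tau(t_{glob})<t_{delay}$, where $t_{glob}=s_0+\dots+s_i-(s_{i,c}-h)-1$, $t_{delay}=s_k+\dots+s_i-(s_{i,c}-h)$ and $k$ is the number of the freshest global model it has received ($0$ initially). At the end of the round it sends $(i,c,U)$ to the server. The server subtracts $\bar\eta_iU$ from its global model for every message $(i,c,U)$ it takes up. Its broadcast counter $k$ starts at $0$. After taking up a message it checks whether it has the round-$k$ messages of all nodes,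 and if so, increments $k$ by one and broadcasts the global model with this number. A node that receives a fresher global model $\hat v$ replaces $\hat w$ by $\hat v-\bar\eta_iU$. Computation speeds and message latencies are arbitrary (messages may arrive out of order) and may depend on everything that has happened so far, but not on samples and coin flips not yet used; almost surely every gradient evaluation is eventually performed. Order all gradient evaluations as $t=0,1,2,\dots$ along the slots: slot $(i,t')$ has $t=S_i+t'$ and corresponds to the iteration of node $c=a(i,t')$ in round $i$ with $h=\#\{t''<t': a(i,t'')=c\}$. Let $\hat w_t,\xi_t$ be the local model and the sample of evaluation $t$, let $\eta_t=\bar\eta_i$ for $S_i\le t<S_{i+1}$, and define the iterates by $w_{t+1}=w_t-\eta_t\nabla f(\hat w_t;\xi_t)$; thus $w_t$ results from the first $t$ gradient evaluations over all compute nodes. **Theorem.** We have $s_i=\Theta(i/\ln i)$ and $\bar\eta_i=O(\ln i/i^2)$, and $$\mathbb E\|w_t-w_*\|^2\le\frac{4\cdot 36^2\,N}{\mu^2}\,\frac1t+O\Big(\frac1{t\ln t}\Big),$$ and the same bound holds for the local models, i.e. for $\mathbb E\|\hat w_t-w_*\|^2$. The constant in the $O(1/(t\ln t))$ term depends neither on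 $t\ge 2$ nor on the timing of computations and messages. -/

import Mathlib

open MeasureTheory ProbabilityTheory Filter
open scoped Gradient NNReal ENNReal

namespace AsyncSGD

/-! ### Sample sizes, permissible delay and round step sizes -/

/-- The total number `s_i` of gradient evaluations of round `i`, over all compute nodes. -/
noncomputable def sampleSize (d m : ℕ) (i : ℕ) : ℕ :=
  ⌈((m : ℝ) + i + 1) / (16 * ((d : ℝ) + 1) ^ 2) *
    (1 / Real.log (((m : ℝ) + i + 1) / (2 * ((d : ℝ) + 1))))⌉₊

/-- `roundStart s i = s_0 + … + s_{i-1}`. -/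
def roundStart (s : ℕ → ℕ) (i : ℕ) : ℕ := ∑ j ∈ Finset.range i, s j

/-- The constant `M₁`. -/
noncomputable def delayConst (d m : ℕ) (L μ : ℝ) : ℝ :=
  max (max ((d : ℝ) + 2) (72 * (L / μ))) (1 / 2 * (sampleSize d m 0 : ℝ))

/-- The permissible delay function `τ`. -/
noncomputable def delay (d m : ℕ) (L μ : ℝ) (x : ℝ) : ℝ :=
  delayConst d m L μ +
    Real.sqrt ((x + ((m : ℝ) + 1) ^ 2 / 4) / (4 * Real.log (x + ((m : ℝ) + 1) ^ 2 / 4)))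

/-- The round step size of round `i`. -/
noncomputable def roundStep (d m : ℕ) (L μ : ℝ) (i : ℕ) : ℝ :=
  12 / μ * (1 / ((roundStart (sampleSize d m) i : ℝ) + 2 * delayConst d m L μ +
    Real.sqrt ((((m : ℝ) + 1) ^ 2 / 4 + roundStart (sampleSize d m) i) /
      Real.log (((m : ℝ) + 1) ^ 2 / 4 + roundStart (sampleSize d m) i))))

/-! ### Coin flips of the setup phase, and the sequential ordering of the gradient evaluations -/

/-- The local sample size `s_{i,c}`: the number of slots of round `i` that the table `a` of coin
flips assigns to compute node `c`. -/
def localSize {n : ℕ} (s : ℕ → ℕ) (a : ℕ → ℕ → Fin n) (i : ℕ) (c : Fin n) : ℕ :=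
  ((Finset.range (s i)).filter fun t' => a i t' = c).card

/-- The round to which the global iteration count `t` belongs: the largest `i` with
`s_0 + … + s_{i-1} ≤ t` (when all `s_j` are positive). -/
def roundOf (s : ℕ → ℕ) (t : ℕ) : ℕ := Nat.findGreatest (fun i => roundStart s i ≤ t) t

/-- The compute node that performs the evaluation with global count `t`. -/
def nodeOf {n : ℕ} (s : ℕ → ℕ) (a : ℕ → ℕ → Fin n) (t : ℕ) : Fin n :=
  a (roundOf s t) (t - roundStart s (roundOf s t))

/-- The local counter `h` of the evaluation with global count `t`: the number of earlier slots of
the same round that belong to the same compute node. -/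
def localOf {n : ℕ} (s : ℕ → ℕ) (a : ℕ → ℕ → Fin n) (t : ℕ) : ℕ :=
  ((Finset.range (t - roundStart s (roundOf s t))).filter
    fun t' => a (roundOf s t) t' = nodeOf s a t).card

/-! ### The asynchronous distributed algorithm -/

/-- The data on which server and compute nodes agree: sample sizes `s_i`, permissible delay `τ`,
round step sizes, the initial model, and the stochastic gradient `(w, ξ) ↦ ∇f(w; ξ)`. -/
structure Algorithm (E Ξ : Type*) where
  size : ℕ → ℕ
  delay : ℝ → ℝ
  step : ℕ → ℝ
  init : E
  grad : E → Ξ → E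

/-- The variables of a compute node: local round `i`, local counter `h`, local sample size
`s_{i,c}` of the current round, number `k` of the freshest global model received, the sum `U` of
the gradients of the current round, and the local model `ŵ`. -/
structure NodeState (E : Type*) where
  round : ℕ
  count : ℕ
  quota : ℕ
  version : ℕ
  acc : E
  model : E

/-- A configuration of the whole system. -/
structure Config (n : ℕ) (E Ξ : Type*) where
  /-- the compute nodes -/
  node : Fin n → NodeState E
  /-- the global model `v̂` at the server -/
  model : E
  /-- the broadcast counter `k` at the server -/
  counter : ℕ
  /-- `queued i c`: the server has processed the update of round `i` of node `c`, and this update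
  has not yet been accounted for by a broadcast -/
  queued : ℕ → Fin n → Prop
  /-- `inFlight i c`: the update of round `i` of node `c` was sent and is not yet processed -/
  inFlight : ℕ → Fin n → Prop
  /-- the content `U_{i,c}` of the update messages that were sent -/
  update : ℕ → Fin n → E
  /-- the content of the broadcast messages with numbers up to `counter` -/
  broadcast : ℕ → E
  /-- the entry for `(c, i, h)` is the pair `(ŵ_{c,i,h}, ξ_{c,i,h})` as soon as the gradient
  evaluation `(c, i, h)` has been performed -/
  log : Fin n → ℕ → ℕ → Unit ⊕ (E × Ξ)

instance {E : Type*} [MeasurableSpace E] : MeasurableSpace (NodeState E) :=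
  MeasurableSpace.comap
    (fun N => ((N.round, N.count, N.quota, N.version), (N.acc, N.model))) inferInstance

instance {n : ℕ} {E Ξ : Type*} [MeasurableSpace E] [MeasurableSpace Ξ] :
    MeasurableSpace (Config n E Ξ) :=
  MeasurableSpace.comap
    (fun C => (C.node, C.model, C.counter, (C.queued, C.inFlight), (C.update, C.broadcast), C.log))
    inferInstance

/-- The elementary events of an execution. -/
inductive Event (n : ℕ)
  /-- compute node `c` is given the opportunity to make one pass of its main loop -/
  | compute (c : Fin n)
  /-- the update message of round `i` of node `c` is taken up by the server -/
  | deliver (i : ℕ) (c : Fin n)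
  /-- the broadcast message number `k` arrives at node `c` -/
  | receive (c : Fin n) (k : ℕ)

instance (n : ℕ) : MeasurableSpace (Event n) := ⊤

section Semantics

variable {n : ℕ} {E Ξ : Type*} [AddCommGroup E] [Module ℝ E]

/-- The initial configuration. -/
def initConfig (A : Algorithm E Ξ) (a : ℕ → ℕ → Fin n) : Config n E Ξ where
  node c := ⟨0, 0, localSize A.size a 0 c, 0, 0, A.init⟩
  model := A.init
  counter := 0
  queued _ _ := False
  inFlight _ _ := False
  update _ _ := 0
  broadcast _ := A.init
  log _ _ _ := Sum.inl ()

/-- `t_glob = s_0 + … + s_i - (s_{i,c} - h) - 1`. -/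
noncomputable def tGlob (A : Algorithm E Ξ) (N : NodeState E) : ℝ :=
  (∑ j ∈ Finset.range (N.round + 1), (A.size j : ℝ)) - ((N.quota : ℝ) - N.count) - 1

/-- `t_delay = s_k + … + s_i - (s_{i,c} - h)`. -/
noncomputable def tDelay (A : Algorithm E Ξ) (N : NodeState E) : ℝ :=
  (∑ j ∈ Finset.Icc N.version N.round, (A.size j : ℝ)) - ((N.quota : ℝ) - N.count)

open scoped Classical in
/-- One pass of the main loop of compute node `c`. As long as the local round is not complete, the
node performs one SGD iteration, unless `τ(t_glob) < t_delay`, in which case it waits. When the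
local round is complete, the node sends the sum `U` to the server and starts the next round. -/
noncomputable def computeStep (A : Algorithm E Ξ) (a : ℕ → ℕ → Fin n) (X : Fin n → ℕ → ℕ → Ξ)
    (C : Config n E Ξ) (c : Fin n) : Config n E Ξ :=
  let N := C.node c
  if N.count < N.quota then
    if A.delay (tGlob A N) < tDelay A N then C
    else
      let ξ := X c N.round N.count
      let g := A.grad N.model ξ
      { C with
        node := Function.update C.node c
          { N with
            count := N.count + 1
            acc := N.acc + g
            model := N.model - A.step N.round • g }
        log := Function.update C.log c (Function.update (C.log c) N.round
          (Function.update (C.log c N.round) N.count (Sum.inr (N.model, ξ)))) }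
  else
    { C with
      node := Function.update C.node c
        { N with
          round := N.round + 1
          count := 0
          quota := localSize A.size a (N.round + 1) c
          acc := 0 }
      inFlight := fun i' c' => C.inFlight i' c' ∨ (i' = N.round ∧ c' = c)
      update := Function.update C.update N.round (Function.update (C.update N.round) c N.acc) }

open scoped Classical in
/-- The server takes up the update of round `i` of node `c` (if it is in flight). It adds the
update to the global model and, once the updates of round `k` of all nodes are there, increments
`k` and broadcasts the global model. -/
noncomputable def deliverStep (A : Algorithm E Ξ) (C : Config n E Ξ) (i : ℕ) (c : Fin n) :
    Config n E Ξ :=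
  if C.inFlight i c then
    let v := C.model - A.step i • C.update i c
    let fl : ℕ → Fin n → Prop := fun i' c' => C.inFlight i' c' ∧ ¬ (i' = i ∧ c' = c)
    let q : ℕ → Fin n → Prop := fun i' c' => C.queued i' c' ∨ (i' = i ∧ c' = c)
    if ∀ c', q C.counter c' then
      { C with
        model := v
        inFlight := fl
        queued := fun i' c' => q i' c' ∧ i' ≠ C.counter
        counter := C.counter + 1
        broadcast := Function.update C.broadcast (C.counter + 1) v }
    else
      { C with
        model := v
        inFlight := fl
        queued := q }
  else C

/-- The broadcast number `k` arrives at node `c`. It is ignored unless it has been sent and is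
fresher than the last one used; otherwise `ŵ` becomes `v̂_k - η̄_i U`. -/
def receiveStep (A : Algorithm E Ξ) (C : Config n E Ξ) (c : Fin n) (k : ℕ) : Config n E Ξ :=
  let N := C.node c
  if N.version < k ∧ k ≤ C.counter then
    { C with
      node := Function.update C.node c
        { N with
          version := k
          model := C.broadcast k - A.step N.round • N.acc } }
  else C

/-- The effect of an event. -/
noncomputable def act (A : Algorithm E Ξ) (a : ℕ → ℕ → Fin n) (X : Fin n → ℕ → ℕ → Ξ)
    (C : Config n E Ξ) : Event n → Config n E Ξ
  | .compute c => computeStep A a X C c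
  | .deliver i c => deliverStep A C i c
  | .receive c k => receiveStep A C c k

variable (n E Ξ) in
/-- A scheduler models computation speeds and network latencies: it chooses the next event from
the full history of the system, but it does not see samples and coin flips that have not been
used so far. -/
abbrev Scheduler : Type _ := (r : ℕ) → (Fin (r + 1) → Config n E Ξ) → Event n

/-- The configurations at the times `0, …, r`. -/
noncomputable def history (A : Algorithm E Ξ) (σ : Scheduler n E Ξ) (a : ℕ → ℕ → Fin n)
    (X : Fin n → ℕ → ℕ → Ξ) : (r : ℕ) → (Fin (r + 1) → Config n E Ξ)
  | 0 => fun _ => initConfig A a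
  | r + 1 => Fin.snoc (α := fun _ => Config n E Ξ) (history A σ a X r)
      (act A a X (history A σ a X r (Fin.last r)) (σ r (history A σ a X r)))

/-- The configuration at time `r`. -/
noncomputable def run (A : Algorithm E Ξ) (σ : Scheduler n E Ξ) (a : ℕ → ℕ → Fin n)
    (X : Fin n → ℕ → ℕ → Ξ) (r : ℕ) : Config n E Ξ :=
  history A σ a X r (Fin.last r)

/-- The gradient evaluation with global count `t` has been performed by time `r`. -/
def PerformedBy (A : Algorithm E Ξ) (σ : Scheduler n E Ξ) (a : ℕ → ℕ → Fin n)
    (X : Fin n → ℕ → ℕ → Ξ) (t r : ℕ) : Prop :=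
  ((run A σ a X r).log (nodeOf A.size a t) (roundOf A.size t) (localOf A.size a t)).isRight

/-- Every gradient evaluation is eventually performed. -/
def Complete (A : Algorithm E Ξ) (σ : Scheduler n E Ξ) (a : ℕ → ℕ → Fin n)
    (X : Fin n → ℕ → ℕ → Ξ) : Prop :=
  ∀ t, ∃ r, PerformedBy A σ a X t r

open scoped Classical in
/-- The local model `ŵ_t` at which the gradient with global count `t` is evaluated
(the initial model if this evaluation never takes place). -/
noncomputable def localModel (A : Algorithm E Ξ) (σ : Scheduler n E Ξ) (a : ℕ → ℕ → Fin n)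
    (X : Fin n → ℕ → ℕ → Ξ) (t : ℕ) : E :=
  if h : ∃ r, PerformedBy A σ a X t r then
    Sum.elim (fun _ => A.init) Prod.fst
      ((run A σ a X (Nat.find h)).log
        (nodeOf A.size a t) (roundOf A.size t) (localOf A.size a t))
  else A.init

/-- The sample `ξ_t` used by the gradient evaluation with global count `t`. -/
def sampleAt (A : Algorithm E Ξ) (a : ℕ → ℕ → Fin n) (X : Fin n → ℕ → ℕ → Ξ) (t : ℕ) : Ξ :=
  X (nodeOf A.size a t) (roundOf A.size t) (localOf A.size a t)

/-- The iterates `w_{t+1} = w_t - η_t ∇f(ŵ_t; ξ_t)`, where `η_t` is the round step size of the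
round to which `t` belongs. -/
noncomputable def iterate (A : Algorithm E Ξ) (σ : Scheduler n E Ξ) (a : ℕ → ℕ → Fin n)
    (X : Fin n → ℕ → ℕ → Ξ) : ℕ → E
  | 0 => A.init
  | t + 1 => iterate A σ a X t -
      A.step (roundOf A.size t) • A.grad (localModel A σ a X t) (sampleAt A a X t)

end Semantics

/-- The algorithm with the concrete sample sizes, delay function and round step sizes above, for
the loss `f` and the initial model `w₀`. -/
noncomputable def algorithm {q : ℕ} {Ξ : Type*} (d m : ℕ) (L μ : ℝ)
    (f : EuclideanSpace ℝ (Fin q) → Ξ → ℝ) (w₀ : EuclideanSpace ℝ (Fin q)) :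
    Algorithm (EuclideanSpace ℝ (Fin q)) Ξ where
  size := sampleSize d m
  delay := delay d m L μ
  step := roundStep d m L μ
  init := w₀
  grad w ξ := ∇ (fun v => f v ξ) w

/-- The mixture `𝒟 = ∑ c, p_c 𝒟_c` of the local distributions. -/
noncomputable def mixture {n : ℕ} {Ξ : Type*} [MeasurableSpace Ξ] (p : Fin n → ℝ≥0)
    (D : Fin n → Measure Ξ) : Measure Ξ :=
  ∑ c, p c • D c

end AsyncSGD

/-!
The proof has a deterministic, a stochastic and an asymptotic part.

**Staleness.** At any time each model in the system equals the initial model minus the weighted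
gradients of a finite set of evaluations (`AsyncSGD.ledger_run`). Since the permissible delay is of
the order of the size of a single round, the waiting rule only admits an evaluation in round `i` if
the node has used a broadcast of number at least `i - Q`, with a constant `Q` that does not depend
on the scheduler (`AsyncSGD.exists_staleness_bound`). Hence the local model used in round `i`
contains all gradients of the rounds before `i - Q` and no gradient of a round after `i + Q`
(`AsyncSGD.boundedStaleness_of_complete`).

**Independence.** The order of the slots is not the order of time, and the scheduler may react to
all that has happened. So neither the iterate `w_t` nor the local model `ŵ_t` need be independent of
the sample `ξ_t`, and conditioning on the first `t` slots does not work. Instead, round `i` is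
compared with the reference point `B`, the iterate at the beginning of round `i - 1 - Q`, computed
from tables of flips and samples that are truncated before round `i`. As long as no node has entered
round `i`, the execution does not notice the truncation, and it reaches the first `i - 1 - Q` rounds
by then unless some node of positive weight has no work in round `i - 1`
(`AsyncSGD.iterate_truncate`). This exceptional event has probability at most `n ρ ^ s_{i-1}` with
`ρ < 1`. Hence `B` is independent of the samples of round `i`, which are pairwise independent with
law `𝒟`, and outside of the exceptional event it is the true iterate. The structure
`AsyncSGD.StaleSGD` collects these facts, and `AsyncSGD.staleSGD_of_complete` derives them from
the execution.

**One round.** Write `W_i` for the iterate at the beginning of round `i`, and split each gradient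
into the gradient at `w_*` (the noise, centred and uncorrelated along the slots) and an excess of
norm at most `L ‖ŵ_t - w_*‖`. Expanding `‖W_{i+1} - w_*‖²` around `B`
(`AsyncSGD.norm_sub_smul_sum_sq_le`), the gradients at `B` contribute the contraction, by strong
convexity and independence; the product of the noise of round `i` and the noise between `B` and
`W_i` has mean zero; the squared noise of the round is the main error; all else is of lower order.
This yields the recursion `AsyncSGD.StaleSGD.iterateError_succ_le`. The local models differ from
`W_i` by gradients of a bounded number of rounds; as these gradients were evaluated at models that
are themselves unknown, the difference is estimated by a Grönwall inequality in the order of time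
(`AsyncSGD.BoundedStaleness.norm_sub_le_of_small`).

**Rate.** The step sizes are asymptotic to `12 / (μ S_i)` and `s_i` is of the order of `S_i / i`, so
that the recursion gives bounds `a / S_i + K / i²` by induction on the round
(`AsyncSGD.StaleSGD.exists_round_bound`). The exceptional events do not matter: the a priori bound
`AsyncSGD.StaleSGD.crude` grows polynomially in `i`, their probability decays faster than any power.
As `S_{i+1} ≤ 2 S_i` eventually and `S_i ln S_i = O(i²)`, this is `1200 N₂ / (μ² t) + O(1 / (t ln t))`
with `N₂ = 𝔼 ‖∇f(w_*; ξ)‖²` (`AsyncSGD.StaleSGD.exists_rate`), which is below the announced bound,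
where `N = 2 N₂`. All constants are functions of the parameters, so they do not depend on the
scheduler.
-/

namespace AsyncSGD

set_option linter.unusedSectionVars false

section Semantics

variable {n : ℕ} {E Ξ : Type*} [AddCommGroup E] [Module ℝ E]
  {A : Algorithm E Ξ} {σ : Scheduler n E Ξ} {a : ℕ → ℕ → Fin n} {X : Fin n → ℕ → ℕ → Ξ}

/-! ### Bookkeeping of a single step -/

theorem run_zero : run A σ a X 0 = initConfig A a := rfl

theorem run_succ (r : ℕ) :
    run A σ a X (r + 1) = act A a X (run A σ a X r) (σ r (history A σ a X r)) := by
  simp [run, history, Fin.snoc_last]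

/-- The evaluation `(c, i, h)`, encoded as the triple `z`, has been performed in `C`, as seen from
the local counters. -/
def Done (s : ℕ → ℕ) (a : ℕ → ℕ → Fin n) (C : Config n E Ξ) (z : Fin n × ℕ × ℕ) : Prop :=
  z.2.2 < localSize s a z.2.1 z.1 ∧
    (z.2.1 < (C.node z.1).round ∨ (z.2.1 = (C.node z.1).round ∧ z.2.2 < (C.node z.1).count))

/-- Consistency of the local counters with the table of coin flips and with the log. -/
structure Counted (A : Algorithm E Ξ) (a : ℕ → ℕ → Fin n) (X : Fin n → ℕ → ℕ → Ξ)
    (C : Config n E Ξ) : Prop where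
  quota : ∀ c, (C.node c).quota = localSize A.size a (C.node c).round c
  count_le : ∀ c, (C.node c).count ≤ (C.node c).quota
  log_iff : ∀ c i h, (C.log c i h).isRight ↔ Done A.size a C (c, i, h)
  log_sample : ∀ c i h w ξ, C.log c i h = Sum.inr (w, ξ) → ξ = X c i h

theorem counted_init : Counted A a X (initConfig A a : Config n E Ξ) := by
  constructor <;> simp [initConfig, Done]

open scoped Classical in
/-- The effect of one SGD iteration of node `c`. -/
noncomputable def iterateConfig (A : Algorithm E Ξ) (X : Fin n → ℕ → ℕ → Ξ)
    (C : Config n E Ξ) (c : Fin n) : Config n E Ξ :=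
  let N := C.node c
  let g := A.grad N.model (X c N.round N.count)
  { C with
    node := Function.update C.node c
      { N with
        count := N.count + 1
        acc := N.acc + g
        model := N.model - A.step N.round • g }
    log := Function.update C.log c (Function.update (C.log c) N.round
      (Function.update (C.log c N.round) N.count (Sum.inr (N.model, X c N.round N.count)))) }

open scoped Classical in
/-- The effect of completing a local round at node `c`. -/
noncomputable def advanceConfig (A : Algorithm E Ξ) (a : ℕ → ℕ → Fin n)
    (C : Config n E Ξ) (c : Fin n) : Config n E Ξ :=
  let N := C.node c
  { C with
    node := Function.update C.node c
      { N with
        round := N.round + 1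
        count := 0
        quota := localSize A.size a (N.round + 1) c
        acc := 0 }
    inFlight := fun i' c' => C.inFlight i' c' ∨ (i' = N.round ∧ c' = c)
    update := Function.update C.update N.round (Function.update (C.update N.round) c N.acc) }

/-- A computing node performs an iteration, enters the next round, or waits. -/
theorem computeStep_cases (C : Config n E Ξ) (c : Fin n) :
    ((C.node c).count < (C.node c).quota ∧
      ¬ A.delay (tGlob A (C.node c)) < tDelay A (C.node c) ∧
      computeStep A a X C c = iterateConfig A X C c) ∨
    (¬ (C.node c).count < (C.node c).quota ∧ computeStep A a X C c = advanceConfig A a C c) ∨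
    computeStep A a X C c = C := by
  classical
  by_cases h : (C.node c).count < (C.node c).quota
  · by_cases h' : A.delay (tGlob A (C.node c)) < tDelay A (C.node c)
    · right; right; simp [computeStep, h, h']
    · left
      refine ⟨h, h', ?_⟩
      simp only [computeStep, h, h', if_true, if_false, iterateConfig]
  · right; left
    refine ⟨h, ?_⟩
    simp only [computeStep, h, if_false, advanceConfig]

theorem deliverStep_node (C : Config n E Ξ) (i : ℕ) (c : Fin n) :
    (deliverStep A C i c).node = C.node ∧ (deliverStep A C i c).log = C.log ∧
      (deliverStep A C i c).update = C.update := by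
  classical
  unfold deliverStep
  dsimp only
  split_ifs <;> exact ⟨rfl, rfl, rfl⟩

theorem receiveStep_node (C : Config n E Ξ) (c : Fin n) (k : ℕ) :
    (receiveStep A C c k).log = C.log ∧ ∀ c', ((receiveStep A C c k).node c').round =
      (C.node c').round ∧ ((receiveStep A C c k).node c').count = (C.node c').count ∧
      ((receiveStep A C c k).node c').quota = (C.node c').quota ∧
      ((receiveStep A C c k).node c').acc = (C.node c').acc := by
  unfold receiveStep
  dsimp only
  split_ifs
  · refine ⟨rfl, fun c' => ?_⟩
    by_cases h : c' = c
    · subst h; simp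
    · simp [Function.update_of_ne h]
  · simp

theorem Counted.congr {C C' : Config n E Ξ} (h : Counted A a X C) (hl : C'.log = C.log)
    (hn : ∀ c, (C'.node c).round = (C.node c).round ∧ (C'.node c).count = (C.node c).count ∧
      (C'.node c).quota = (C.node c).quota) : Counted A a X C' := by
  refine ⟨fun c => ?_, fun c => ?_, fun c i k => ?_, fun c i k w ξ => ?_⟩
  · rw [(hn c).2.2, (hn c).1, h.quota]
  · rw [(hn c).2.1, (hn c).2.2]; exact h.count_le c
  · rw [hl, h.log_iff]; simp only [Done, (hn c).1, (hn c).2.1]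
  · rw [hl]; exact h.log_sample c i k w ξ

theorem iterateConfig_node_ne (C : Config n E Ξ) {c c' : Fin n} (h : c' ≠ c) :
    (iterateConfig A X C c).node c' = C.node c' := by
  simp [iterateConfig, Function.update_of_ne h]

theorem iterateConfig_node_self (C : Config n E Ξ) (c : Fin n) :
    (iterateConfig A X C c).node c =
      { C.node c with
        count := (C.node c).count + 1
        acc := (C.node c).acc + A.grad (C.node c).model (X c (C.node c).round (C.node c).count)
        model := (C.node c).model - A.step (C.node c).round •
          A.grad (C.node c).model (X c (C.node c).round (C.node c).count) } := by
  simp [iterateConfig]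

open scoped Classical in
theorem iterateConfig_log (C : Config n E Ξ) (c c' : Fin n) (i h : ℕ) :
    (iterateConfig A X C c).log c' i h =
      if c' = c ∧ i = (C.node c).round ∧ h = (C.node c).count then
        Sum.inr ((C.node c).model, X c (C.node c).round (C.node c).count)
      else C.log c' i h := by
  simp only [iterateConfig, Function.update_apply]
  by_cases h1 : c' = c
  · subst h1
    by_cases h2 : i = (C.node c').round
    · subst h2
      by_cases h3 : h = (C.node c').count <;> simp [h3]
    · simp [h2]
  · simp [h1]

theorem done_iterateConfig {C : Config n E Ξ} {c : Fin n} (hC : Counted A a X C)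
    (hc : (C.node c).count < (C.node c).quota) (z : Fin n × ℕ × ℕ) :
    Done A.size a (iterateConfig A X C c) z ↔
      Done A.size a C z ∨ z = (c, (C.node c).round, (C.node c).count) := by
  obtain ⟨c', i, h⟩ := z
  have hq := hC.quota c
  by_cases h1 : c' = c
  · subst h1
    simp only [Done, iterateConfig_node_self, Prod.mk.injEq, true_and]
    constructor
    · rintro ⟨h2, h3 | ⟨h3, h4⟩⟩
      · exact Or.inl ⟨h2, Or.inl h3⟩
      · rcases Nat.lt_succ_iff_lt_or_eq.mp h4 with h5 | h5
        · exact Or.inl ⟨h2, Or.inr ⟨h3, h5⟩⟩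
        · exact Or.inr ⟨h3, h5⟩
    · rintro (⟨h2, h3 | ⟨h3, h4⟩⟩ | ⟨h3, h4⟩)
      · exact ⟨h2, Or.inl h3⟩
      · exact ⟨h2, Or.inr ⟨h3, by omega⟩⟩
      · subst h3 h4
        exact ⟨by omega, Or.inr ⟨rfl, by omega⟩⟩
  · simp [Done, iterateConfig_node_ne C h1, h1]

theorem Counted.iterate {C : Config n E Ξ} {c : Fin n} (hC : Counted A a X C)
    (hc : (C.node c).count < (C.node c).quota) : Counted A a X (iterateConfig A X C c) := by
  classical
  refine ⟨fun c' => ?_, fun c' => ?_, fun c' i k => ?_, fun c' i k w ξ => ?_⟩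
  · by_cases h1 : c' = c
    · subst h1; rw [iterateConfig_node_self]; exact hC.quota c'
    · rw [iterateConfig_node_ne C h1]; exact hC.quota c'
  · by_cases h1 : c' = c
    · subst h1; rw [iterateConfig_node_self]; exact hc
    · rw [iterateConfig_node_ne C h1]; exact hC.count_le c'
  · rw [done_iterateConfig hC hc, iterateConfig_log, ← hC.log_iff]
    split_ifs with h
    · obtain ⟨rfl, rfl, rfl⟩ := h; simp
    · have : ¬ ((c', i, k) = (c, (C.node c).round, (C.node c).count)) := by
        simpa only [Prod.mk.injEq] using h
      simp [this]
  · rw [iterateConfig_log]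
    split_ifs with h
    · obtain ⟨rfl, rfl, rfl⟩ := h
      simp only [Sum.inr.injEq, Prod.mk.injEq]
      rintro ⟨-, rfl⟩; rfl
    · exact hC.log_sample c' i k w ξ

theorem advanceConfig_node_ne (C : Config n E Ξ) {c c' : Fin n} (h : c' ≠ c) :
    (advanceConfig A a C c).node c' = C.node c' := by
  simp [advanceConfig, Function.update_of_ne h]

theorem advanceConfig_node_self (C : Config n E Ξ) (c : Fin n) :
    (advanceConfig A a C c).node c =
      { C.node c with
        round := (C.node c).round + 1
        count := 0
        quota := localSize A.size a ((C.node c).round + 1) c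
        acc := 0 } := by
  simp [advanceConfig]

theorem done_advanceConfig {C : Config n E Ξ} {c : Fin n} (hC : Counted A a X C)
    (hc : ¬ (C.node c).count < (C.node c).quota) (z : Fin n × ℕ × ℕ) :
    Done A.size a (advanceConfig A a C c) z ↔ Done A.size a C z := by
  obtain ⟨c', i, h⟩ := z
  have hq := hC.quota c
  by_cases h1 : c' = c
  · subst h1
    simp only [Done, advanceConfig_node_self]
    constructor
    · rintro ⟨h2, h3 | ⟨h3, h4⟩⟩
      · rcases Nat.lt_succ_iff_lt_or_eq.mp h3 with h5 | h5
        · exact ⟨h2, Or.inl h5⟩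
        · subst h5; exact ⟨h2, Or.inr ⟨rfl, by omega⟩⟩
      · omega
    · rintro ⟨h2, h3 | ⟨h3, h4⟩⟩
      · exact ⟨h2, Or.inl (by omega)⟩
      · exact ⟨h2, Or.inl (by omega)⟩
  · simp [Done, advanceConfig_node_ne C h1]

theorem Counted.advance {C : Config n E Ξ} {c : Fin n} (hC : Counted A a X C)
    (hc : ¬ (C.node c).count < (C.node c).quota) : Counted A a X (advanceConfig A a C c) := by
  refine ⟨fun c' => ?_, fun c' => ?_, fun c' i k => ?_, fun c' i k w ξ => ?_⟩
  · by_cases h1 : c' = c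
    · subst h1; rw [advanceConfig_node_self]
    · rw [advanceConfig_node_ne C h1]; exact hC.quota c'
  · by_cases h1 : c' = c
    · subst h1; rw [advanceConfig_node_self]; exact Nat.zero_le _
    · rw [advanceConfig_node_ne C h1]; exact hC.count_le c'
  · rw [done_advanceConfig hC hc, ← hC.log_iff]; rfl
  · exact hC.log_sample c' i k w ξ

theorem Counted.act {C : Config n E Ξ} (hC : Counted A a X C) (e : Event n) :
    Counted A a X (act A a X C e) := by
  cases e with
  | compute c =>
    rcases computeStep_cases (A := A) (a := a) (X := X) C c with ⟨h1, -, h⟩ | ⟨h1, h⟩ | h <;>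
      simp only [AsyncSGD.act, h]
    · exact hC.iterate h1
    · exact hC.advance h1
    · exact hC
  | deliver i c =>
    obtain ⟨h1, h2, -⟩ := deliverStep_node (A := A) C i c
    exact hC.congr h2 fun c => by simp [AsyncSGD.act, h1]
  | receive c k =>
    obtain ⟨h1, h2⟩ := receiveStep_node (A := A) C c k
    exact hC.congr h1 fun c' => ⟨(h2 c').1, (h2 c').2.1, (h2 c').2.2.1⟩

theorem counted_run (r : ℕ) : Counted A a X (run A σ a X r) := by
  induction r with
  | zero => exact counted_init
  | succ r ih => rw [run_succ]; exact ih.act _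

theorem act_round_le (C : Config n E Ξ) (e : Event n) (c : Fin n) :
    (C.node c).round ≤ ((act A a X C e).node c).round := by
  cases e with
  | compute c' =>
    rcases computeStep_cases (A := A) (a := a) (X := X) C c' with ⟨-, -, h⟩ | ⟨-, h⟩ | h <;>
      simp only [AsyncSGD.act, h]
    · by_cases h1 : c = c'
      · subst h1; rw [iterateConfig_node_self]
      · rw [iterateConfig_node_ne C h1]
    · by_cases h1 : c = c'
      · subst h1; rw [advanceConfig_node_self]; exact Nat.le_succ _
      · rw [advanceConfig_node_ne C h1]
    · exact le_rfl
  | deliver i c' => simp [AsyncSGD.act, (deliverStep_node (A := A) C i c').1]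
  | receive c' k => exact ((receiveStep_node (A := A) C c' k).2 c).1.ge

theorem run_round_mono (c : Fin n) : Monotone fun r => ((run A σ a X r).node c).round :=
  monotone_nat_of_le_succ fun r => by rw [run_succ]; exact act_round_le _ _ _

/-- Log entries are never overwritten. -/
theorem act_log {C : Config n E Ξ} (hC : Counted A a X C) (e : Event n) {c : Fin n} {i h : ℕ}
    (hz : (C.log c i h).isRight) : (act A a X C e).log c i h = C.log c i h := by
  classical
  cases e with
  | compute c' =>
    rcases computeStep_cases (A := A) (a := a) (X := X) C c' with ⟨-, -, h⟩ | ⟨-, h⟩ | h <;>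
      simp only [AsyncSGD.act, h]
    · rw [iterateConfig_log, if_neg]
      rintro ⟨rfl, rfl, rfl⟩
      rw [hC.log_iff] at hz
      simp [Done] at hz
    · rfl
  | deliver i' c' => simp [AsyncSGD.act, (deliverStep_node (A := A) C i' c').2.1]
  | receive c' k => simp [AsyncSGD.act, (receiveStep_node (A := A) C c' k).1]

theorem run_log {r r' : ℕ} (hr : r ≤ r') {c : Fin n} {i h : ℕ}
    (hz : ((run A σ a X r).log c i h).isRight) :
    (run A σ a X r').log c i h = (run A σ a X r).log c i h := by
  induction r', hr using Nat.le_induction with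
  | base => rfl
  | succ r' _ ih => rw [run_succ, act_log (counted_run r') _ (by rw [ih]; exact hz), ih]

theorem run_done_mono {r r' : ℕ} (hr : r ≤ r') {z : Fin n × ℕ × ℕ}
    (hz : Done A.size a (run A σ a X r) z) : Done A.size a (run A σ a X r') z := by
  obtain ⟨c, i, h⟩ := z
  rw [← (counted_run (X := X) r).log_iff] at hz
  rw [← (counted_run (X := X) r').log_iff, run_log hr hz]
  exact hz

open scoped Classical in
/-- The local model at which the evaluation `(c, i, h)` takes place (the initial model if this
evaluation never takes place). -/
noncomputable def evalModel (A : Algorithm E Ξ) (σ : Scheduler n E Ξ) (a : ℕ → ℕ → Fin n)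
    (X : Fin n → ℕ → ℕ → Ξ) (z : Fin n × ℕ × ℕ) : E :=
  if h : ∃ r, ((run A σ a X r).log z.1 z.2.1 z.2.2).isRight then
    Sum.elim (fun _ => A.init) Prod.fst ((run A σ a X (Nat.find h)).log z.1 z.2.1 z.2.2)
  else A.init

/-- The triple `(c, i, h)` of the evaluation with global count `t`. -/
def slot (s : ℕ → ℕ) (a : ℕ → ℕ → Fin n) (t : ℕ) : Fin n × ℕ × ℕ :=
  (nodeOf s a t, roundOf s t, localOf s a t)

theorem localModel_eq (t : ℕ) :
    localModel A σ a X t = evalModel A σ a X (slot A.size a t) := by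
  unfold localModel evalModel PerformedBy slot
  congr!

theorem evalModel_eq {r : ℕ} {z : Fin n × ℕ × ℕ} {w : E} {ξ : Ξ}
    (h : (run A σ a X r).log z.1 z.2.1 z.2.2 = Sum.inr (w, ξ)) : evalModel A σ a X z = w := by
  classical
  have hr : ((run A σ a X r).log z.1 z.2.1 z.2.2).isRight := by rw [h]; rfl
  have hex : ∃ r, ((run A σ a X r).log z.1 z.2.1 z.2.2).isRight := ⟨r, hr⟩
  rw [evalModel, dif_pos hex, ← run_log (Nat.find_min' hex hr) (Nat.find_spec hex), h]
  rfl

/-! ### Which gradients are contained in which model -/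

/-- The gradient of the evaluation `z`, weighted with its round step size. -/
noncomputable def weightedGrad (A : Algorithm E Ξ) (g : Fin n × ℕ × ℕ → E) (z : Fin n × ℕ × ℕ) : E :=
  A.step z.2.1 • g z

/-- The models of the server, of the nodes and of the broadcasts are the initial model minus
weighted sums of gradients over finite sets of evaluations; `g z` is the gradient of the
evaluation `z`. -/
structure Ledger (A : Algorithm E Ξ) (a : ℕ → ℕ → Fin n) (g : Fin n × ℕ × ℕ → E)
    (C : Config n E Ξ) : Prop where
  acc : ∀ c, (C.node c).acc =
    ∑ h ∈ Finset.range (C.node c).count, g (c, (C.node c).round, h)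
  update : ∀ i c, i < (C.node c).round →
    C.update i c = ∑ h ∈ Finset.range (localSize A.size a i c), g (c, i, h)
  flight : ∀ i c, C.inFlight i c → i < (C.node c).round
  queued : ∀ i c, C.queued i c → i < (C.node c).round ∧ ¬ C.inFlight i c
  counter : ∀ i c, i < C.counter → i < (C.node c).round ∧ ¬ C.inFlight i c
  version : ∀ c, (C.node c).version ≤ C.counter
  server : ∃ S : Finset (Fin n × ℕ × ℕ), (∀ z, z ∈ S ↔ z.2.1 < (C.node z.1).round ∧
      ¬ C.inFlight z.2.1 z.1 ∧ z.2.2 < localSize A.size a z.2.1 z.1) ∧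
    C.model = A.init - ∑ z ∈ S, weightedGrad A g z
  broadcast : ∀ k ≤ C.counter, ∃ S : Finset (Fin n × ℕ × ℕ),
    (∀ z ∈ S, z.2.1 < (C.node z.1).round ∧ z.2.2 < localSize A.size a z.2.1 z.1) ∧
    (∀ z, z.2.1 < k → z.2.2 < localSize A.size a z.2.1 z.1 → z ∈ S) ∧
    C.broadcast k = A.init - ∑ z ∈ S, weightedGrad A g z
  node : ∀ c, ∃ S : Finset (Fin n × ℕ × ℕ), (∀ z ∈ S, Done A.size a C z) ∧
    (∀ z, z.2.1 < (C.node c).version → z.2.2 < localSize A.size a z.2.1 z.1 → z ∈ S) ∧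
    (C.node c).model = A.init - ∑ z ∈ S, weightedGrad A g z

theorem ledger_init (g : Fin n × ℕ × ℕ → E) : Ledger A a g (initConfig A a : Config n E Ξ) := by
  constructor
  · simp [initConfig]
  · simp [initConfig]
  · simp [initConfig]
  · simp [initConfig]
  · simp [initConfig]
  · simp [initConfig]
  · exact ⟨∅, by simp [initConfig], by simp [initConfig]⟩
  · intro k hk
    have : k = 0 := by simpa [initConfig] using hk
    subst this
    exact ⟨∅, by simp, by simp, by simp [initConfig]⟩
  · intro c
    exact ⟨∅, by simp, by simp [initConfig], by simp [initConfig]⟩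

theorem Ledger.iterate {g : Fin n × ℕ × ℕ → E} {C : Config n E Ξ} {c : Fin n}
    (hC : Counted A a X C) (hL : Ledger A a g C) (hc : (C.node c).count < (C.node c).quota)
    (hg : g (c, (C.node c).round, (C.node c).count) =
      A.grad (C.node c).model (X c (C.node c).round (C.node c).count)) :
    Ledger A a g (iterateConfig A X C c) := by
  classical
  have hround : ∀ c', ((iterateConfig A X C c).node c').round = (C.node c').round := fun c' => by
    by_cases h1 : c' = c
    · subst h1; rw [iterateConfig_node_self]
    · rw [iterateConfig_node_ne C h1]
  have hver : ∀ c', ((iterateConfig A X C c).node c').version = (C.node c').version := fun c' => by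
    by_cases h1 : c' = c
    · subst h1; rw [iterateConfig_node_self]
    · rw [iterateConfig_node_ne C h1]
  constructor
  · intro c'
    by_cases h1 : c' = c
    · subst h1
      rw [iterateConfig_node_self]
      simp only [Finset.sum_range_succ]
      rw [← hL.acc, hg]
    · rw [iterateConfig_node_ne C h1]; exact hL.acc c'
  · intro i c' hi
    rw [hround] at hi
    exact hL.update i c' hi
  · intro i c' hi
    rw [hround]; exact hL.flight i c' hi
  · intro i c' hi
    rw [hround]; exact hL.queued i c' hi
  · intro i c' hi
    rw [hround]; exact hL.counter i c' hi
  · intro c'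
    rw [hver]; exact hL.version c'
  · simp only [hround]; exact hL.server
  · simp only [hround]; exact hL.broadcast
  · intro c'
    obtain ⟨S, hS1, hS2, hS3⟩ := hL.node c'
    by_cases h1 : c' = c
    · subst h1
      have hnot : (c', (C.node c').round, (C.node c').count) ∉ S := fun h => by
        have := hS1 _ h
        simp [Done] at this
      refine ⟨insert (c', (C.node c').round, (C.node c').count) S, ?_, ?_, ?_⟩
      · intro z hz
        rw [done_iterateConfig hC hc]
        rcases Finset.mem_insert.mp hz with h | h
        · exact Or.inr h
        · exact Or.inl (hS1 z h)
      · intro z h2 h3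
        rw [hver] at h2
        exact Finset.mem_insert_of_mem (hS2 z h2 h3)
      · rw [Finset.sum_insert hnot, iterateConfig_node_self]
        simp only [weightedGrad, hg]
        rw [hS3]
        simp only [weightedGrad]
        abel
    · refine ⟨S, ?_, ?_, ?_⟩
      · intro z hz
        rw [done_iterateConfig hC hc]
        exact Or.inl (hS1 z hz)
      · rw [iterateConfig_node_ne C h1]; exact hS2
      · rw [iterateConfig_node_ne C h1]; exact hS3

theorem Ledger.advance {g : Fin n × ℕ × ℕ → E} {C : Config n E Ξ} {c : Fin n}
    (hC : Counted A a X C) (hL : Ledger A a g C) (hc : ¬ (C.node c).count < (C.node c).quota) :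
    Ledger A a g (advanceConfig A a C c) := by
  classical
  have hround : ∀ c', (C.node c').round ≤ ((advanceConfig A a C c).node c').round := fun c' => by
    by_cases h1 : c' = c
    · subst h1; rw [advanceConfig_node_self]; exact Nat.le_succ _
    · rw [advanceConfig_node_ne C h1]
  have hself : ((advanceConfig A a C c).node c).round = (C.node c).round + 1 := by
    rw [advanceConfig_node_self]
  have hver : ∀ c', ((advanceConfig A a C c).node c').version = (C.node c').version := fun c' => by
    by_cases h1 : c' = c
    · subst h1; rw [advanceConfig_node_self]
    · rw [advanceConfig_node_ne C h1]
  have hmod : ∀ c', ((advanceConfig A a C c).node c').model = (C.node c').model := fun c' => by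
    by_cases h1 : c' = c
    · subst h1; rw [advanceConfig_node_self]
    · rw [advanceConfig_node_ne C h1]
  have hfl : ∀ i c', (advanceConfig A a C c).inFlight i c' ↔
      C.inFlight i c' ∨ (i = (C.node c).round ∧ c' = c) := fun i c' => Iff.rfl
  -- the messages taken up by the server are not affected
  have hproc : ∀ i c', (i < ((advanceConfig A a C c).node c').round ∧
      ¬ (advanceConfig A a C c).inFlight i c') ↔
      (i < (C.node c').round ∧ ¬ C.inFlight i c') := fun i c' => by
    rw [hfl]
    by_cases h1 : c' = c
    · subst h1
      rw [hself]
      constructor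
      · rintro ⟨h2, h3⟩
        have h3' : ¬ C.inFlight i c' ∧ i ≠ (C.node c').round := by tauto
        exact ⟨by omega, h3'.1⟩
      · rintro ⟨h2, h3⟩
        refine ⟨by omega, ?_⟩
        rintro (h | ⟨h, -⟩)
        · exact h3 h
        · omega
    · rw [advanceConfig_node_ne C h1]
      simp [h1]
  constructor
  · intro c'
    by_cases h1 : c' = c
    · subst h1; rw [advanceConfig_node_self]; simp
    · rw [advanceConfig_node_ne C h1]; exact hL.acc c'
  · intro i c' hi
    have hupd : (advanceConfig A a C c).update i c' =
        if i = (C.node c).round ∧ c' = c then (C.node c).acc else C.update i c' := by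
      simp only [advanceConfig, Function.update_apply]
      by_cases h1 : i = (C.node c).round
      · subst h1; by_cases h2 : c' = c <;> simp [h2]
      · simp [h1]
    rw [hupd]
    split_ifs with h
    · obtain ⟨rfl, rfl⟩ := h
      rw [hL.acc, ← hC.quota, le_antisymm (hC.count_le c') (not_lt.mp hc)]
    · apply hL.update
      by_cases h1 : c' = c
      · subst h1
        have h3 : i ≠ (C.node c').round := fun h' => h ⟨h', rfl⟩
        rw [hself] at hi
        omega
      · rwa [advanceConfig_node_ne C h1] at hi
  · intro i c' hi
    rcases (hfl i c').mp hi with h | ⟨rfl, rfl⟩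
    · exact (hL.flight i c' h).trans_le (hround c')
    · rw [hself]; exact Nat.lt_succ_self _
  · intro i c' hi
    exact (hproc i c').mpr (hL.queued i c' hi)
  · intro i c' hi
    exact (hproc i c').mpr (hL.counter i c' hi)
  · intro c'
    rw [hver]; exact hL.version c'
  · obtain ⟨S, hS, hS'⟩ := hL.server
    refine ⟨S, fun z => ?_, hS'⟩
    rw [hS, ← and_assoc, ← and_assoc, hproc]
  · intro k hk
    obtain ⟨S, hS1, hS2, hS3⟩ := hL.broadcast k hk
    exact ⟨S, fun z hz => ⟨(hS1 z hz).1.trans_le (hround _), (hS1 z hz).2⟩, hS2, hS3⟩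
  · intro c'
    obtain ⟨S, hS1, hS2, hS3⟩ := hL.node c'
    refine ⟨S, fun z hz => (done_advanceConfig hC hc z).mpr (hS1 z hz), ?_, ?_⟩
    · rw [hver]; exact hS2
    · rw [hmod]; exact hS3

theorem Ledger.deliver {g : Fin n × ℕ × ℕ → E} {C : Config n E Ξ} (hL : Ledger A a g C)
    (i : ℕ) (c : Fin n) : Ledger A a g (deliverStep A C i c) := by
  classical
  by_cases hf : C.inFlight i c
  swap
  · simpa [deliverStep, hf] using hL
  have hic := hL.flight i c hf
  -- the server model after taking up the message
  have hserver : ∃ S : Finset (Fin n × ℕ × ℕ), (∀ z, z ∈ S ↔ z.2.1 < (C.node z.1).round ∧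
      ¬ (C.inFlight z.2.1 z.1 ∧ ¬ (z.2.1 = i ∧ z.1 = c)) ∧
        z.2.2 < localSize A.size a z.2.1 z.1) ∧
      C.model - A.step i • C.update i c = A.init - ∑ z ∈ S, weightedGrad A g z := by
    obtain ⟨S, hS, hS'⟩ := hL.server
    have hdisj : Disjoint S ((Finset.range (localSize A.size a i c)).image fun h => (c, i, h)) := by
      rw [Finset.disjoint_right]
      intro z hz hzS
      obtain ⟨h, -, rfl⟩ := Finset.mem_image.mp hz
      exact ((hS _).mp hzS).2.1 hf
    refine ⟨S ∪ (Finset.range (localSize A.size a i c)).image fun h => (c, i, h),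
      fun z => ?_, ?_⟩
    · rw [Finset.mem_union, hS, Finset.mem_image]
      obtain ⟨c', i', h'⟩ := z
      constructor
      · rintro (⟨h1, h2, h3⟩ | ⟨h, h1, h2⟩)
        · exact ⟨h1, fun h => h2 h.1, h3⟩
        · simp only [Prod.mk.injEq] at h2
          obtain ⟨rfl, rfl, rfl⟩ := h2
          exact ⟨hic, by simp, Finset.mem_range.mp h1⟩
      · rintro ⟨h1, h2, h3⟩
        by_cases h4 : i' = i ∧ c' = c
        · obtain ⟨rfl, rfl⟩ := h4
          exact Or.inr ⟨h', Finset.mem_range.mpr h3, rfl⟩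
        · exact Or.inl ⟨h1, fun h => h2 ⟨h, h4⟩, h3⟩
    · rw [Finset.sum_union hdisj, Finset.sum_image (by intro x _ y _ h; simpa using h), hS',
        hL.update i c hic, Finset.smul_sum]
      simp only [weightedGrad]
      abel
  have hq : ∀ i' c', C.queued i' c' ∨ (i' = i ∧ c' = c) → i' < (C.node c').round ∧
      ¬ (C.inFlight i' c' ∧ ¬ (i' = i ∧ c' = c)) := by
    rintro i' c' (h | ⟨rfl, rfl⟩)
    · exact ⟨(hL.queued i' c' h).1, fun h' => (hL.queued i' c' h).2 h'.1⟩
    · exact ⟨hic, by simp⟩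
  by_cases hall : ∀ c', C.queued C.counter c' ∨ (C.counter = i ∧ c' = c)
  · have hcount : ∀ i' c', i' < C.counter + 1 → i' < (C.node c').round ∧
        ¬ (C.inFlight i' c' ∧ ¬ (i' = i ∧ c' = c)) := by
      intro i' c' h
      rcases Nat.lt_succ_iff_lt_or_eq.mp h with h | rfl
      · exact ⟨(hL.counter i' c' h).1, fun h' => (hL.counter i' c' h).2 h'.1⟩
      · exact hq _ c' (hall c')
    have e : deliverStep A C i c = { C with
        model := C.model - A.step i • C.update i c
        inFlight := fun i' c' => C.inFlight i' c' ∧ ¬ (i' = i ∧ c' = c)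
        queued := fun i' c' => (C.queued i' c' ∨ (i' = i ∧ c' = c)) ∧ i' ≠ C.counter
        counter := C.counter + 1
        broadcast := Function.update C.broadcast (C.counter + 1)
          (C.model - A.step i • C.update i c) } := by
      unfold deliverStep
      rw [if_pos hf]
      exact if_pos hall
    rw [e]
    refine ⟨hL.acc, hL.update, fun i' c' h => hL.flight i' c' h.1, fun i' c' h => hq i' c' h.1,
      hcount, fun c' => (hL.version c').trans (Nat.le_succ _), hserver, ?_, hL.node⟩
    intro k hk
    rcases Nat.le_succ_iff.mp hk with h | h
    · obtain ⟨S, hS1, hS2, hS3⟩ := hL.broadcast k h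
      refine ⟨S, hS1, hS2, ?_⟩
      simp only
      rw [Function.update_of_ne (by omega)]
      exact hS3
    · subst h
      obtain ⟨S, hS, hS'⟩ := hserver
      refine ⟨S, fun z hz => ⟨((hS z).mp hz).1, ((hS z).mp hz).2.2⟩, fun z h1 h2 => ?_, ?_⟩
      · rw [hS]
        exact ⟨(hcount _ _ h1).1, (hcount _ _ h1).2, h2⟩
      · simp only [Nat.succ_eq_add_one, Function.update_self]
        exact hS'
  · have e : deliverStep A C i c = { C with
        model := C.model - A.step i • C.update i c
        inFlight := fun i' c' => C.inFlight i' c' ∧ ¬ (i' = i ∧ c' = c)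
        queued := fun i' c' => C.queued i' c' ∨ (i' = i ∧ c' = c) } := by
      unfold deliverStep
      rw [if_pos hf]
      exact if_neg hall
    rw [e]
    exact ⟨hL.acc, hL.update, fun i' c' h => hL.flight i' c' h.1, hq,
      fun i' c' h => ⟨(hL.counter i' c' h).1, fun h' => (hL.counter i' c' h).2 h'.1⟩,
      hL.version, hserver, hL.broadcast, hL.node⟩

theorem Ledger.receive {g : Fin n × ℕ × ℕ → E} {C : Config n E Ξ} (hC : Counted A a X C)
    (hL : Ledger A a g C) (c : Fin n) (k : ℕ) : Ledger A a g (receiveStep A C c k) := by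
  classical
  by_cases hk : (C.node c).version < k ∧ k ≤ C.counter
  swap
  · simpa [receiveStep, hk] using hL
  obtain ⟨hlog, hsame⟩ := receiveStep_node (A := A) C c k
  have e : receiveStep A C c k = { C with
      node := Function.update C.node c { C.node c with
        version := k
        model := C.broadcast k - A.step (C.node c).round • (C.node c).acc } } := by
    simp [receiveStep, hk]
  have hround : ∀ c', ((receiveStep A C c k).node c').round = (C.node c').round :=
    fun c' => (hsame c').1
  have hdone : ∀ z, Done A.size a (receiveStep A C c k) z ↔ Done A.size a C z := fun z => by
    simp only [Done, hround, (hsame z.1).2.1]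
  have hfl : (receiveStep A C c k).inFlight = C.inFlight := by rw [e]
  have hqu : (receiveStep A C c k).queued = C.queued := by rw [e]
  have hct : (receiveStep A C c k).counter = C.counter := by rw [e]
  have hup : (receiveStep A C c k).update = C.update := by rw [e]
  have hmo : (receiveStep A C c k).model = C.model := by rw [e]
  have hbr : (receiveStep A C c k).broadcast = C.broadcast := by rw [e]
  refine ⟨?_, ?_, ?_, ?_, ?_, ?_, ?_, ?_, ?_⟩
  · intro c'
    rw [(hsame c').2.2.2, (hsame c').1, (hsame c').2.1]
    exact hL.acc c'
  · simp only [hround, hup]; exact hL.update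
  · simp only [hround, hfl]; exact hL.flight
  · simp only [hround, hfl, hqu]; exact hL.queued
  · simp only [hround, hfl, hct]; exact hL.counter
  · intro c'
    rw [hct]
    by_cases h1 : c' = c
    · subst h1; rw [e]; simp only [Function.update_self]; exact hk.2
    · rw [e]; simp only [Function.update_of_ne h1]; exact hL.version c'
  · simp only [hround, hfl, hmo]; exact hL.server
  · simp only [hround, hct, hbr]; exact hL.broadcast
  · intro c'
    simp only [hdone]
    by_cases h1 : c' = c
    · subst h1
      obtain ⟨S, hS1, hS2, hS3⟩ := hL.broadcast k hk.2
      have hdisj : Disjoint S ((Finset.range (C.node c').count).image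
          fun h => (c', (C.node c').round, h)) := by
        rw [Finset.disjoint_right]
        intro z hz hzS
        obtain ⟨h, -, rfl⟩ := Finset.mem_image.mp hz
        exact lt_irrefl _ (hS1 _ hzS).1
      refine ⟨S ∪ (Finset.range (C.node c').count).image
          fun h => (c', (C.node c').round, h), ?_, ?_, ?_⟩
      · intro z hz
        rcases Finset.mem_union.mp hz with h | h
        · exact ⟨(hS1 z h).2, Or.inl (hS1 z h).1⟩
        · obtain ⟨h, h2, rfl⟩ := Finset.mem_image.mp h
          have h3 := hC.count_le c'
          rw [hC.quota] at h3
          exact ⟨(Finset.mem_range.mp h2).trans_le h3, Or.inr ⟨rfl, Finset.mem_range.mp h2⟩⟩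
      · intro z h2 h3
        rw [e] at h2
        simp only [Function.update_self] at h2
        exact Finset.mem_union_left _ (hS2 z h2 h3)
      · rw [Finset.sum_union hdisj, Finset.sum_image (by intro x _ y _ h; simpa using h), e]
        simp only [Function.update_self, hS3, hL.acc c', Finset.smul_sum, weightedGrad]
        abel
    · obtain ⟨S, hS1, hS2, hS3⟩ := hL.node c'
      refine ⟨S, hS1, ?_, ?_⟩
      · rw [e]; simp only [Function.update_of_ne h1]; exact hS2
      · rw [e]; simp only [Function.update_of_ne h1]; exact hS3

/-- The gradient of the evaluation `z` in a given execution. -/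
noncomputable def evalGrad (A : Algorithm E Ξ) (σ : Scheduler n E Ξ) (a : ℕ → ℕ → Fin n)
    (X : Fin n → ℕ → ℕ → Ξ) (z : Fin n × ℕ × ℕ) : E :=
  A.grad (evalModel A σ a X z) (X z.1 z.2.1 z.2.2)

theorem run_iterate_model {r : ℕ} {c : Fin n}
    (h : run A σ a X (r + 1) = iterateConfig A X (run A σ a X r) c) :
    evalModel A σ a X (c, ((run A σ a X r).node c).round, ((run A σ a X r).node c).count) =
      ((run A σ a X r).node c).model := by
  classical
  apply evalModel_eq (r := r + 1)
    (ξ := X c ((run A σ a X r).node c).round ((run A σ a X r).node c).count)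
  rw [h, iterateConfig_log]
  simp

/-- The ledger invariant holds at all times: the models of the server and of the nodes and all
models broadcast so far differ from the initial model by the weighted gradients of a finite set of
evaluations. -/
theorem ledger_run (r : ℕ) : Ledger A a (evalGrad A σ a X) (run A σ a X r) := by
  induction r with
  | zero => exact ledger_init _
  | succ r ih =>
    have hC : Counted A a X (run A σ a X r) := counted_run r
    have hs := run_succ (A := A) (σ := σ) (a := a) (X := X) r
    cases he : σ r (history A σ a X r) with
    | compute c =>
      rw [he] at hs
      rcases computeStep_cases (A := A) (a := a) (X := X) (run A σ a X r) c with
        ⟨h1, -, h⟩ | ⟨h1, h⟩ | h <;> simp only [AsyncSGD.act, h] at hs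
      · have hm := run_iterate_model hs
        rw [hs]
        refine ih.iterate hC h1 ?_
        rw [evalGrad, hm]
      · rw [hs]; exact ih.advance hC h1
      · rw [hs]; exact ih
    | deliver i c => rw [hs, he]; exact ih.deliver i c
    | receive c k => rw [hs, he]; exact ih.receive hC c k

end Semantics

/-! ### Rounds and slots -/

theorem roundStart_succ (s : ℕ → ℕ) (i : ℕ) : roundStart s (i + 1) = roundStart s i + s i := by
  simp [roundStart, Finset.sum_range_succ]

theorem roundStart_zero (s : ℕ → ℕ) : roundStart s 0 = 0 := by simp [roundStart]

theorem roundStart_mono (s : ℕ → ℕ) : Monotone (roundStart s) :=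
  monotone_nat_of_le_succ fun i => by rw [roundStart_succ]; exact Nat.le_add_right _ _

theorem roundStart_strictMono {s : ℕ → ℕ} (hs : ∀ i, 0 < s i) : StrictMono (roundStart s) :=
  strictMono_nat_of_lt_succ fun i => by rw [roundStart_succ]; exact Nat.lt_add_of_pos_right (hs i)

theorem le_roundStart {s : ℕ → ℕ} (hs : ∀ i, 0 < s i) (i : ℕ) : i ≤ roundStart s i :=
  (roundStart_strictMono hs).le_apply

theorem roundStart_roundOf_le (s : ℕ → ℕ) (t : ℕ) : roundStart s (roundOf s t) ≤ t :=
  Nat.findGreatest_spec (P := fun i => roundStart s i ≤ t) (Nat.zero_le t)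
    (by simp [roundStart_zero])

theorem lt_roundStart_roundOf_succ {s : ℕ → ℕ} (hs : ∀ i, 0 < s i) (t : ℕ) :
    t < roundStart s (roundOf s t + 1) := by
  by_contra h
  push Not at h
  have h1 : roundOf s t + 1 ≤ t := (le_roundStart hs _).trans h
  have h2 := Nat.le_findGreatest (P := fun i => roundStart s i ≤ t) h1 h
  have h3 : roundOf s t = Nat.findGreatest (fun i => roundStart s i ≤ t) t := rfl
  omega

theorem roundOf_eq_iff {s : ℕ → ℕ} (hs : ∀ i, 0 < s i) {t i : ℕ} :
    roundOf s t = i ↔ roundStart s i ≤ t ∧ t < roundStart s (i + 1) := by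
  constructor
  · rintro rfl
    exact ⟨roundStart_roundOf_le s t, lt_roundStart_roundOf_succ hs t⟩
  · rintro ⟨h1, h2⟩
    have h3 := roundStart_roundOf_le s t
    have h4 := lt_roundStart_roundOf_succ hs t
    have h5 := (roundStart_strictMono hs).lt_iff_lt.mp (h1.trans_lt h4)
    have h6 := (roundStart_strictMono hs).lt_iff_lt.mp (h3.trans_lt h2)
    omega

theorem roundOf_lt_iff {s : ℕ → ℕ} (hs : ∀ i, 0 < s i) {t i : ℕ} :
    roundOf s t < i ↔ t < roundStart s i := by
  constructor
  · intro h
    exact (lt_roundStart_roundOf_succ hs t).trans_le (roundStart_mono s h)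
  · intro h
    by_contra h'
    push Not at h'
    exact absurd ((roundStart_mono s h').trans (roundStart_roundOf_le s t)) (by omega)

theorem le_roundOf_iff {s : ℕ → ℕ} (hs : ∀ i, 0 < s i) {t i : ℕ} :
    i ≤ roundOf s t ↔ roundStart s i ≤ t := by
  rw [← not_lt, roundOf_lt_iff hs, not_lt]

theorem localSize_eq_count {n : ℕ} (s : ℕ → ℕ) (a : ℕ → ℕ → Fin n) (i : ℕ) (c : Fin n) :
    localSize s a i c = Nat.count (fun t' => a i t' = c) (s i) := by
  rw [localSize, Nat.count_eq_card_filter_range]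

theorem localSize_le {n : ℕ} (s : ℕ → ℕ) (a : ℕ → ℕ → Fin n) (i : ℕ) (c : Fin n) :
    localSize s a i c ≤ s i := by
  simpa [localSize] using Finset.card_filter_le (Finset.range (s i)) fun t' => a i t' = c

theorem localOf_eq_count {n : ℕ} (s : ℕ → ℕ) (a : ℕ → ℕ → Fin n) (t : ℕ) :
    localOf s a t = Nat.count (fun t' => a (roundOf s t) t' = nodeOf s a t)
      (t - roundStart s (roundOf s t)) := by
  rw [localOf, Nat.count_eq_card_filter_range]

theorem slot_valid {n : ℕ} {s : ℕ → ℕ} (hs : ∀ i, 0 < s i) (a : ℕ → ℕ → Fin n) (t : ℕ) :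
    (slot s a t).2.2 < localSize s a (slot s a t).2.1 (slot s a t).1 := by
  simp only [slot]
  rw [localSize_eq_count, localOf_eq_count]
  have h1 := roundStart_roundOf_le s t
  have h2 := lt_roundStart_roundOf_succ hs t
  rw [roundStart_succ] at h2
  apply Nat.count_strict_mono (p := fun t' => a (roundOf s t) t' = nodeOf s a t) rfl
  omega

theorem slot_injective {n : ℕ} (s : ℕ → ℕ) (a : ℕ → ℕ → Fin n) :
    Function.Injective (slot s a) := by
  intro t u h
  simp only [slot, Prod.mk.injEq] at h
  obtain ⟨h1, h2, h3⟩ := h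
  rw [localOf_eq_count, localOf_eq_count, ← h2, ← h1] at h3
  have h4 := roundStart_roundOf_le s t
  have h5 := roundStart_roundOf_le s u
  rw [← h2] at h5
  have := Nat.count_injective (p := fun t' => a (roundOf s t) t' = nodeOf s a t) rfl
    (by simp only [nodeOf] at h1 ⊢; rw [h1, h2]) h3
  omega

theorem exists_slot {n : ℕ} {s : ℕ → ℕ} (hs : ∀ i, 0 < s i) (a : ℕ → ℕ → Fin n)
    (z : Fin n × ℕ × ℕ) (hz : z.2.2 < localSize s a z.2.1 z.1) : ∃ t, slot s a t = z := by
  obtain ⟨c, i, h⟩ := z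
  simp only at hz
  rw [localSize_eq_count] at hz
  have hp : ∀ hf : {t' | a i t' = c}.Finite, h < hf.toFinset.card := fun hf =>
    hz.trans_le (Nat.count_le_card hf _)
  have hlt := Nat.nth_lt_of_lt_count hz
  have hmem := Nat.nth_mem h hp
  have hcount := Nat.count_nth hp
  have hr : roundOf s (roundStart s i + Nat.nth (fun t' => a i t' = c) h) = i := by
    rw [roundOf_eq_iff hs, roundStart_succ]; omega
  have hn : nodeOf s a (roundStart s i + Nat.nth (fun t' => a i t' = c) h) = c := by
    rw [nodeOf, hr, Nat.add_sub_cancel_left]; exact hmem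
  refine ⟨roundStart s i + Nat.nth (fun t' => a i t' = c) h, ?_⟩
  rw [slot, localOf_eq_count, hr, hn, Nat.add_sub_cancel_left, hcount]

/-! ### Staleness of the local models -/

section Staleness

variable {n : ℕ} {E Ξ : Type*} [AddCommGroup E] [Module ℝ E]
  {A : Algorithm E Ξ} {σ : Scheduler n E Ξ} {a : ℕ → ℕ → Fin n} {X : Fin n → ℕ → ℕ → Ξ} {Q : ℕ}

/-- Waiting keeps every local iteration within `Q` rounds of the last broadcast that was used. -/
def RoundGate (A : Algorithm E Ξ) (Q : ℕ) : Prop :=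
  ∀ N : NodeState E, N.count < N.quota → N.quota ≤ A.size N.round →
    ¬ A.delay (tGlob A N) < tDelay A N → N.round ≤ N.version + Q

theorem not_done_zero (z : Fin n × ℕ × ℕ) : ¬ Done A.size a (run A σ a X 0) z := by
  simp [run_zero, initConfig, Done]

/-- An evaluation is performed by one iteration of the node it belongs to. -/
theorem exists_performing_step (z : Fin n × ℕ × ℕ) (hz : ∃ r, Done A.size a (run A σ a X r) z) :
    ∃ r c, (∀ r', Done A.size a (run A σ a X r') z ↔ r < r') ∧
      run A σ a X (r + 1) = iterateConfig A X (run A σ a X r) c ∧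
      z = (c, ((run A σ a X r).node c).round, ((run A σ a X r).node c).count) ∧
      ((run A σ a X r).node c).count < ((run A σ a X r).node c).quota ∧
      ¬ A.delay (tGlob A ((run A σ a X r).node c)) < tDelay A ((run A σ a X r).node c) := by
  classical
  have hspec := Nat.find_spec hz
  have hmin : ∀ r', Done A.size a (run A σ a X r') z → Nat.find hz ≤ r' :=
    fun r' h => Nat.find_min' hz h
  obtain ⟨r, hr⟩ : ∃ r, Nat.find hz = r + 1 := by
    cases h : Nat.find hz with
    | zero => rw [h] at hspec; exact absurd hspec (not_done_zero z)
    | succ r => exact ⟨r, rfl⟩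
  rw [hr] at hspec hmin
  have hnot : ¬ Done A.size a (run A σ a X r) z := fun h => by have := hmin r h; omega
  have hC : Counted A a X (run A σ a X r) := counted_run r
  have hs := run_succ (A := A) (σ := σ) (a := a) (X := X) r
  have hiff : ∀ r', Done A.size a (run A σ a X r') z ↔ r < r' :=
    fun r' => ⟨fun h => hmin r' h, fun h => run_done_mono (Nat.succ_le_of_lt h) hspec⟩
  cases he : σ r (history A σ a X r) with
  | compute c =>
    rw [he] at hs
    rcases computeStep_cases (A := A) (a := a) (X := X) (run A σ a X r) c with
      ⟨h1, h2, h⟩ | ⟨h1, h⟩ | h <;> simp only [AsyncSGD.act, h] at hs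
    · rw [hs, done_iterateConfig hC h1] at hspec
      exact ⟨r, c, hiff, hs, hspec.resolve_left hnot, h1, h2⟩
    · rw [hs, done_advanceConfig hC h1] at hspec
      exact absurd hspec hnot
    · rw [hs] at hspec; exact absurd hspec hnot
  | deliver i c =>
    rw [hs, he] at hspec
    simp only [AsyncSGD.act, Done, (deliverStep_node (A := A) (run A σ a X r) i c).1] at hspec
    exact absurd hspec hnot
  | receive c k =>
    rw [hs, he] at hspec
    obtain ⟨-, h2⟩ := receiveStep_node (A := A) (run A σ a X r) c k
    simp only [AsyncSGD.act, Done, (h2 _).1, (h2 _).2.1] at hspec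
    exact absurd hspec hnot

/-- At the time of an evaluation of round `i`, all nodes have completed their rounds `< i - Q`. -/
theorem round_lt_of_performing (hA : RoundGate A Q) {r : ℕ} {c : Fin n}
    (h1 : ((run A σ a X r).node c).count < ((run A σ a X r).node c).quota)
    (h2 : ¬ A.delay (tGlob A ((run A σ a X r).node c)) < tDelay A ((run A σ a X r).node c))
    {j : ℕ} (hj : j + Q < ((run A σ a X r).node c).round) (c' : Fin n) :
    j < ((run A σ a X r).node c').round := by
  have hC : Counted A a X (run A σ a X r) := counted_run r
  have hL : Ledger A a (evalGrad A σ a X) (run A σ a X r) := ledger_run r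
  have h3 := hA _ h1 (by rw [hC.quota]; exact localSize_le _ _ _ _) h2
  have h4 := hL.version c
  exact (hL.counter j c' (by omega)).1

theorem iterate_eq (t : ℕ) : iterate A σ a X t = A.init - ∑ u ∈ Finset.range t,
    A.step (roundOf A.size u) • evalGrad A σ a X (slot A.size a u) := by
  induction t with
  | zero => simp [iterate]
  | succ t ih =>
    rw [iterate, ih, Finset.sum_range_succ, localModel_eq]
    simp only [evalGrad, sampleAt, slot]
    abel

theorem Complete.done (h : Complete A σ a X) (t : ℕ) :
    ∃ r, Done A.size a (run A σ a X r) (slot A.size a t) := by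
  obtain ⟨r, hr⟩ := h t
  exact ⟨r, ((counted_run (X := X) r).log_iff _ _ _).mp hr⟩

/-- A sequence of SGD steps in which the point `x t` of evaluation misses gradients, or contains
further gradients, of at most `Q` rounds: `T u` is the time at which the gradient `g u` is
evaluated, and `R t` is the set of the gradients that are contained in `x t`. -/
def BoundedStaleness (s : ℕ → ℕ) (Q : ℕ) (step : ℕ → ℝ) (w₀ : E) (x g : ℕ → E) : Prop :=
  ∃ (T : ℕ → ℕ) (R : ℕ → Finset ℕ), ∀ t,
    x t = w₀ - ∑ u ∈ R t, step (roundOf s u) • g u ∧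
    (∀ u ∈ R t, T u < T t) ∧
    (∀ u, roundOf s u + Q < roundOf s t → u ∈ R t) ∧
    (∀ u, T u < T t → roundOf s u ≤ roundOf s t + Q)

/-- The local models of the asynchronous algorithm have bounded staleness, with respect to the time
at which the evaluations are performed: the ledger invariant says which gradients a local model
contains, and the waiting rule makes sure that no gradient of an early round is missing. -/
theorem boundedStaleness_of_complete (hs : ∀ i, 0 < A.size i) (hA : RoundGate A Q)
    (h : Complete A σ a X) :
    BoundedStaleness A.size Q A.step A.init (localModel A σ a X)
      (fun t => A.grad (localModel A σ a X t) (sampleAt A a X t)) := by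
  classical
  choose T c hT hstep hz hlt hgate using fun t => exists_performing_step _ (h.done t)
  choose S hS1 hS2 hS3 using fun t =>
    (ledger_run (A := A) (σ := σ) (a := a) (X := X) (T t)).node (c t)
  have hround : ∀ t, roundOf A.size t = ((run A σ a X (T t)).node (c t)).round := fun t =>
    congrArg (fun z => z.2.1) (hz t)
  refine ⟨T, fun t => (S t).preimage (slot A.size a) (slot_injective _ _).injOn, fun t => ?_⟩
  refine ⟨?_, ?_, ?_, ?_⟩
  · rw [localModel_eq, hz, run_iterate_model (hstep t), hS3]
    congr 1
    rw [← Finset.sum_preimage (slot A.size a) (S t) (slot_injective _ _).injOn]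
    · refine Finset.sum_congr rfl fun u _ => ?_
      simp only [localModel_eq]
      rfl
    · intro z hz hz'
      exact absurd (exists_slot hs a z (hS1 t z hz).1) hz'
  · intro u hu
    exact (hT u _).mp (hS1 t _ (Finset.mem_preimage.mp hu))
  · intro u hu
    refine Finset.mem_preimage.mpr (hS2 t _ ?_ (slot_valid hs a u))
    have h1 := hA _ (hlt t) (by
      rw [(counted_run (X := X) (T t)).quota]; exact localSize_le _ _ _ _) (hgate t)
    simp only [slot]
    rw [hround t] at hu
    omega
  · intro u hu
    by_contra hcon
    push Not at hcon
    rw [hround u] at hcon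
    have h1 := round_lt_of_performing hA (hlt u) (hgate u) hcon (c t)
    have h2 := run_round_mono (A := A) (σ := σ) (a := a) (X := X) (c t) hu.le
    rw [hround t] at h1
    simp only at h2
    omega

end Staleness

/-! ### Truncated tables -/

section Truncation

variable {n : ℕ} {E Ξ : Type*}

/-- The table of coin flips with the rounds from `i` on replaced by the constant `c₀`. -/
def truncFlips (i : ℕ) (c₀ : Fin n) (a : ℕ → ℕ → Fin n) : ℕ → ℕ → Fin n :=
  fun j t => if j < i then a j t else c₀

/-- The table of samples with the rounds from `i` on replaced by the constant `ξ₀`. -/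
def truncSamples (i : ℕ) (ξ₀ : Ξ) (X : Fin n → ℕ → ℕ → Ξ) : Fin n → ℕ → ℕ → Ξ :=
  fun c j h => if j < i then X c j h else ξ₀

theorem localSize_truncFlips {s : ℕ → ℕ} {i j : ℕ} (hj : j < i) (c₀ : Fin n)
    (a : ℕ → ℕ → Fin n) (c : Fin n) :
    localSize s (truncFlips i c₀ a) j c = localSize s a j c := by
  simp [localSize, truncFlips, hj]

theorem localSize_eq_zero {s : ℕ → ℕ} {p : Fin n → Prop} {a : ℕ → ℕ → Fin n}
    (ha : ∀ j t, p (a j t)) {c : Fin n} (hc : ¬ p c) (j : ℕ) : localSize s a j c = 0 := by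
  rw [localSize, Finset.card_eq_zero, Finset.filter_eq_empty_iff]
  rintro t - rfl
  exact hc (ha j t)

theorem slot_truncFlips {s : ℕ → ℕ} {i t : ℕ} (ht : roundOf s t < i) (c₀ : Fin n)
    (a : ℕ → ℕ → Fin n) : slot s (truncFlips i c₀ a) t = slot s a t := by
  simp [slot, localOf, nodeOf, truncFlips, ht]
  congr!

variable [AddCommGroup E] [Module ℝ E]
  {A : Algorithm E Ξ} {σ : Scheduler n E Ξ} {a : ℕ → ℕ → Fin n} {X : Fin n → ℕ → ℕ → Ξ} {Q : ℕ}
  {p : Fin n → Prop} {i : ℕ} {c₀ : Fin n} {ξ₀ : Ξ}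

/-- As long as no node has entered round `i`, an execution does not depend on the tables from
round `i` on. Only the nodes satisfying `p` occur in the table of coin flips; the others have no
work to do and may run ahead. -/
theorem history_truncate (ha : ∀ j t, p (a j t)) (hc₀ : p c₀) (hi : 0 < i) (r : ℕ)
    (hr : ∀ c, p c → ((run A σ a X r).node c).round < i) :
    history A σ (truncFlips i c₀ a) (truncSamples i ξ₀ X) r = history A σ a X r := by
  have ha' : ∀ j t, p (truncFlips i c₀ a j t) := fun j t => by
    unfold truncFlips; split_ifs <;> simp [ha, hc₀]
  have hloc : ∀ j c, (p c → j < i) →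
      localSize A.size (truncFlips i c₀ a) j c = localSize A.size a j c := fun j c h => by
    by_cases hc : p c
    · exact localSize_truncFlips (h hc) c₀ a c
    · rw [localSize_eq_zero ha hc, localSize_eq_zero ha' hc]
  induction r with
  | zero =>
    funext k
    simp only [history, initConfig, localSize_truncFlips hi]
  | succ r ih =>
    have hr' : ∀ c, p c → ((run A σ a X r).node c).round < i := fun c hc =>
      (run_round_mono (A := A) (σ := σ) (a := a) (X := X) c (Nat.le_succ r)).trans_lt (hr c hc)
    have ih := ih hr'
    simp only [history, ih]
    congr 1
    change AsyncSGD.act A _ _ (run A σ a X r) _ = AsyncSGD.act A _ _ (run A σ a X r) _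
    have hC : Counted A a X (run A σ a X r) := counted_run r
    have hs := run_succ (A := A) (σ := σ) (a := a) (X := X) r
    cases he : σ r (history A σ a X r) with
    | deliver i c => rfl
    | receive c k => rfl
    | compute c =>
      rw [he] at hs
      simp only [AsyncSGD.act] at hs ⊢
      by_cases h1 : ((run A σ a X r).node c).count < ((run A σ a X r).node c).quota
      · have hc : p c := by
          by_contra hc
          rw [hC.quota, localSize_eq_zero ha hc] at h1
          omega
        have hX : truncSamples i ξ₀ X c ((run A σ a X r).node c).round
            ((run A σ a X r).node c).count =
            X c ((run A σ a X r).node c).round ((run A σ a X r).node c).count := by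
          simp [truncSamples, hr' c hc]
        simp only [computeStep, h1, if_true, hX]
      · have hq : localSize A.size (truncFlips i c₀ a) (((run A σ a X r).node c).round + 1) c =
            localSize A.size a (((run A σ a X r).node c).round + 1) c := by
          apply hloc
          intro hc
          have h2 := hr c hc
          rcases computeStep_cases (A := A) (a := a) (X := X) (run A σ a X r) c with
            ⟨h3, -⟩ | ⟨-, h3⟩ | h3
          · exact absurd h3 h1
          · rw [hs, h3, advanceConfig_node_self] at h2
            exact h2
          · exfalso
            have h4 : computeStep A a X (run A σ a X r) c = advanceConfig A a (run A σ a X r) c := by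
              simp only [computeStep, h1, if_false, advanceConfig]
            have h5 := congrArg (fun C => (C.node c).round) (h4.symm.trans h3)
            simp only [advanceConfig_node_self] at h5
            omega
        simp only [computeStep, h1, if_false, hq]

theorem act_round_eq_or {C : Config n E Ξ} {e : Event n} {c : Fin n}
    (h : (C.node c).round < ((act A a X C e).node c).round) :
    ((act A a X C e).node c).round = (C.node c).round + 1 ∧
      ¬ (C.node c).count < (C.node c).quota := by
  cases e with
  | compute c' =>
    rcases computeStep_cases (A := A) (a := a) (X := X) C c' with ⟨-, -, h'⟩ | ⟨h2, h'⟩ | h' <;>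
      simp only [AsyncSGD.act, h'] at h ⊢
    · by_cases h1 : c = c'
      · subst h1; rw [iterateConfig_node_self] at h; simp at h
      · rw [iterateConfig_node_ne C h1] at h; simp at h
    · by_cases h1 : c = c'
      · subst h1; rw [advanceConfig_node_self]; exact ⟨rfl, h2⟩
      · rw [advanceConfig_node_ne C h1] at h; simp at h
    · simp at h
  | deliver i c' => simp [AsyncSGD.act, (deliverStep_node (A := A) C i c').1] at h
  | receive c' k =>
    simp only [AsyncSGD.act] at h
    rw [((receiveStep_node (A := A) C c' k).2 c).1] at h
    simp at h

/-- If every relevant node has work to do in round `i`, then all evaluations of the rounds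
`< i - Q` are performed before any such node enters round `i + 1`. -/
theorem exists_done_before_round (hs : ∀ i, 0 < A.size i) (hA : RoundGate A Q)
    (h : Complete A σ a X) (ha : ∀ j t, p (a j t)) (hpos : ∀ c, p c → 0 < localSize A.size a i c) :
    ∃ r, (∀ c, p c → ((run A σ a X r).node c).round < i + 1) ∧
      ∀ z : Fin n × ℕ × ℕ, z.2.2 < localSize A.size a z.2.1 z.1 → z.2.1 + Q < i →
        Done A.size a (run A σ a X r) z := by
  classical
  have hex : ∃ r, ∃ c, p c ∧ i + 1 ≤ ((run A σ a X r).node c).round := by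
    obtain ⟨r, hr⟩ := h.done (roundStart A.size (i + 1))
    have hround : roundOf A.size (roundStart A.size (i + 1)) = i + 1 := by
      rw [roundOf_eq_iff hs]
      exact ⟨le_rfl, roundStart_strictMono hs (Nat.lt_succ_self _)⟩
    refine ⟨r, nodeOf A.size a (roundStart A.size (i + 1)), ha _ _, ?_⟩
    have h2 := hr.2
    simp only [slot, hround] at h2
    omega
  obtain ⟨c, hc, hspec⟩ := Nat.find_spec hex
  obtain ⟨r, hr⟩ : ∃ r, Nat.find hex = r + 1 := by
    cases h' : Nat.find hex with
    | zero => rw [h'] at hspec; simp [run_zero, initConfig] at hspec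
    | succ r => exact ⟨r, rfl⟩
  have hlt : ∀ c, p c → ((run A σ a X r).node c).round < i + 1 := by
    intro c hc
    by_contra hcon
    exact Nat.find_min hex (m := r) (by omega) ⟨c, hc, not_lt.mp hcon⟩
  refine ⟨r, hlt, fun z hz hzi => ?_⟩
  rw [hr, run_succ] at hspec
  obtain ⟨h1, h2⟩ := act_round_eq_or ((hlt c hc).trans_le hspec)
  have h3 : ((run A σ a X r).node c).round = i := by
    have := hlt c hc
    omega
  have hC : Counted A a X (run A σ a X r) := counted_run r
  have hq := hC.quota c
  rw [h3] at hq
  have hdone : Done A.size a (run A σ a X r) (c, i, 0) :=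
    ⟨hpos c hc, Or.inr ⟨h3.symm, by have := hpos c hc; simp only; omega⟩⟩
  obtain ⟨r', c', hr', -, hz', hlt', hgate⟩ := exists_performing_step (c, i, 0) ⟨r, hdone⟩
  simp only [Prod.mk.injEq] at hz'
  obtain ⟨rfl, h4, h5⟩ := hz'
  have h6 := round_lt_of_performing hA hlt' hgate (by rw [← h4]; exact hzi) z.1
  exact ⟨hz, Or.inl (h6.trans_le
    (run_round_mono (A := A) (σ := σ) (a := a) (X := X) z.1 ((hr' r).mp hdone).le))⟩

/-- The iterates up to the beginning of round `i - Q` do not depend on the tables from round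
`i + 1` on, provided that every relevant node has work to do in round `i`. -/
theorem iterate_truncate (hs : ∀ i, 0 < A.size i) (hA : RoundGate A Q)
    (h : Complete A σ a X) (ha : ∀ j t, p (a j t)) (hc₀ : p c₀)
    (hpos : ∀ c, p c → 0 < localSize A.size a i c) {t : ℕ} (ht : t ≤ roundStart A.size (i - Q)) :
    iterate A σ (truncFlips (i + 1) c₀ a) (truncSamples (i + 1) ξ₀ X) t = iterate A σ a X t := by
  obtain ⟨r, hr, hdone⟩ := exists_done_before_round hs hA h ha hpos
  have hrun : run A σ (truncFlips (i + 1) c₀ a) (truncSamples (i + 1) ξ₀ X) r = run A σ a X r := by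
    rw [run, run, history_truncate ha hc₀ (Nat.succ_pos i) r hr]
  rw [iterate_eq, iterate_eq]
  congr 1
  refine Finset.sum_congr rfl fun u hu => ?_
  have hu' : roundOf A.size u < i - Q :=
    (roundOf_lt_iff hs).mpr ((Finset.mem_range.mp hu).trans_le ht)
  rw [slot_truncFlips (by omega)]
  have hd := hdone (slot A.size a u) (slot_valid hs a u) (by simp only [slot]; omega)
  have hright := ((counted_run (X := X) r).log_iff _ _ _).mpr hd
  obtain ⟨⟨w, ξ⟩, hw⟩ := Sum.isRight_iff.mp hright
  have h1 := evalModel_eq (A := A) (σ := σ) (a := a) (X := X) (z := slot A.size a u) hw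
  have h2 : evalModel A σ (truncFlips (i + 1) c₀ a) (truncSamples (i + 1) ξ₀ X)
      (slot A.size a u) = w := by
    apply evalModel_eq (r := r) (ξ := ξ)
    rw [hrun]; exact hw
  have h3 : truncSamples (i + 1) ξ₀ X (slot A.size a u).1 (slot A.size a u).2.1
      (slot A.size a u).2.2 = X (slot A.size a u).1 (slot A.size a u).2.1
      (slot A.size a u).2.2 := if_pos (by simp only [slot]; omega)
  simp only [evalGrad, h1, h2, h3]

end Truncation

/-! ### Measurability of the execution -/

section Measurability

variable {Θ : Type*} [MeasurableSpace Θ]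

/-- A function is measurable if it agrees with a measurable function on each fibre of a measurable
map to a countable space. -/
theorem measurable_of_fibers {β γ : Type*} [MeasurableSpace β] [Countable β]
    [MeasurableSingletonClass β] [MeasurableSpace γ] {d : Θ → β} (hd : Measurable d) {f : Θ → γ}
    (g : β → Θ → γ) (hg : ∀ b, Measurable (g b)) (h : ∀ θ, f θ = g (d θ) θ) : Measurable f := by
  intro s hs
  have : f ⁻¹' s = ⋃ b, d ⁻¹' {b} ∩ g b ⁻¹' s := by
    ext θ
    simp [h]
  rw [this]
  exact MeasurableSet.iUnion fun b => (hd (measurableSet_singleton b)).inter (hg b hs)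

theorem measurable_update_of {ι γ : Type*} [DecidableEq ι] [MeasurableSpace γ] {f : Θ → ι → γ}
    (hf : Measurable f) {g : Θ → γ} (hg : Measurable g) (i : ι) :
    Measurable fun θ => Function.update (f θ) i (g θ) := by
  rw [measurable_pi_iff]
  intro j
  by_cases h : j = i
  · subst h; simpa using hg
  · simpa [Function.update_of_ne h] using measurable_pi_iff.mp hf j

variable {n : ℕ} {E Ξ : Type*} [MeasurableSpace Ξ]

instance : Countable (Event n) := by
  refine Function.Injective.countable (f := fun e : Event n => match e with
    | .compute c => ((0, c, 0) : ℕ × Fin n × ℕ)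
    | .deliver i c => (1, c, i)
    | .receive c k => (2, c, k)) ?_
  intro e e' h
  cases e <;> cases e' <;> simp_all

instance : MeasurableSingletonClass (Event n) := ⟨fun _ => trivial⟩

section NodeState

variable [MeasurableSpace E] {f : Θ → NodeState E}

theorem measurable_nodeState_iff : Measurable f ↔ (Measurable fun θ => (f θ).round) ∧
    (Measurable fun θ => (f θ).count) ∧ (Measurable fun θ => (f θ).quota) ∧
    (Measurable fun θ => (f θ).version) ∧ (Measurable fun θ => (f θ).acc) ∧
    (Measurable fun θ => (f θ).model) := by
  rw [show Measurable f ↔ Measurable fun θ =>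
    (((f θ).round, (f θ).count, (f θ).quota, (f θ).version), ((f θ).acc, (f θ).model)) from
    measurable_comap_iff]
  constructor
  · intro h
    exact ⟨h.fst.fst, h.fst.snd.fst, h.fst.snd.snd.fst, h.fst.snd.snd.snd, h.snd.fst, h.snd.snd⟩
  · rintro ⟨h1, h2, h3, h4, h5, h6⟩
    exact (h1.prodMk (h2.prodMk (h3.prodMk h4))).prodMk (h5.prodMk h6)

end NodeState

section Config

variable [MeasurableSpace E] {f : Θ → Config n E Ξ}

theorem measurable_config_iff : Measurable f ↔ (Measurable fun θ => (f θ).node) ∧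
    (Measurable fun θ => (f θ).model) ∧ (Measurable fun θ => (f θ).counter) ∧
    (Measurable fun θ => (f θ).queued) ∧ (Measurable fun θ => (f θ).inFlight) ∧
    (Measurable fun θ => (f θ).update) ∧ (Measurable fun θ => (f θ).broadcast) ∧
    (Measurable fun θ => (f θ).log) := by
  rw [show Measurable f ↔ Measurable fun θ => ((f θ).node, (f θ).model, (f θ).counter,
    ((f θ).queued, (f θ).inFlight), ((f θ).update, (f θ).broadcast), (f θ).log) from
    measurable_comap_iff]
  constructor
  · intro h
    exact ⟨h.fst, h.snd.fst, h.snd.snd.fst, h.snd.snd.snd.fst.fst, h.snd.snd.snd.fst.snd,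
      h.snd.snd.snd.snd.fst.fst, h.snd.snd.snd.snd.fst.snd, h.snd.snd.snd.snd.snd⟩
  · rintro ⟨h1, h2, h3, h4, h5, h6, h7, h8⟩
    exact h1.prodMk (h2.prodMk (h3.prodMk ((h4.prodMk h5).prodMk ((h6.prodMk h7).prodMk h8))))

end Config

variable [NormedAddCommGroup E] [NormedSpace ℝ E] [MeasurableSpace E] [BorelSpace E]
  [SecondCountableTopology E] {A : Algorithm E Ξ} {σ : Scheduler n E Ξ}
  {a : Θ → ℕ → ℕ → Fin n} {X : Θ → Fin n → ℕ → ℕ → Ξ} {C : Θ → Config n E Ξ}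

theorem measurable_flip (ha : Measurable a) (i t : ℕ) : Measurable fun θ => a θ i t :=
  measurable_pi_iff.mp (measurable_pi_iff.mp ha i) t

theorem measurable_sample (hX : Measurable X) (c : Fin n) (i h : ℕ) :
    Measurable fun θ => X θ c i h :=
  measurable_pi_iff.mp (measurable_pi_iff.mp (measurable_pi_iff.mp hX c) i) h

theorem measurable_localSize (s : ℕ → ℕ) (ha : Measurable a) (i : ℕ) (c : Fin n) :
    Measurable fun θ => localSize s (a θ) i c := by
  simp only [localSize, Finset.card_filter]
  refine Finset.measurable_fun_sum _ fun t _ => Measurable.ite ?_ measurable_const measurable_const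
  exact (measurable_flip ha i t) (measurableSet_singleton c)

theorem measurable_slot (s : ℕ → ℕ) (ha : Measurable a) (t : ℕ) :
    Measurable fun θ => slot s (a θ) t := by
  refine (measurable_flip ha _ _).prodMk (measurable_const.prodMk ?_)
  simp only [localOf, Finset.card_filter]
  refine Finset.measurable_fun_sum _ fun t' _ =>
    Measurable.ite ?_ measurable_const measurable_const
  exact measurableSet_eq_fun (measurable_flip ha _ _) (measurable_flip ha _ _)

theorem measurable_iterateConfig (hA : Measurable (Function.uncurry A.grad)) (hX : Measurable X)
    (hC : Measurable C) (c : Fin n) : Measurable fun θ => iterateConfig A (X θ) (C θ) c := by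
  obtain ⟨h1, h2, h3, h4, h5, h6, h7, h8⟩ := measurable_config_iff.mp hC
  have hn := measurable_pi_iff.mp h1 c
  obtain ⟨n1, n2, n3, n4, n5, n6⟩ := measurable_nodeState_iff.mp hn
  have hg : ∀ i h, Measurable fun θ => A.grad ((C θ).node c).model (X θ c i h) := fun i h =>
    hA.comp (n6.prodMk (measurable_sample hX c i h))
  refine measurable_of_fibers (n1.prodMk n2) (fun b θ => { C θ with
    node := Function.update (C θ).node c { (C θ).node c with
      count := b.2 + 1
      acc := ((C θ).node c).acc + A.grad ((C θ).node c).model (X θ c b.1 b.2)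
      model := ((C θ).node c).model - A.step b.1 •
        A.grad ((C θ).node c).model (X θ c b.1 b.2) }
    log := Function.update (C θ).log c (Function.update ((C θ).log c) b.1
      (Function.update ((C θ).log c b.1) b.2
        (Sum.inr (((C θ).node c).model, X θ c b.1 b.2)))) }) ?_ ?_
  · rintro ⟨i, h⟩
    refine measurable_config_iff.mpr ⟨?_, h2, h3, h4, h5, h6, h7, ?_⟩
    · refine measurable_update_of h1 (measurable_nodeState_iff.mpr ?_) c
      exact ⟨n1, measurable_const, n3, n4, n5.add (hg i h), n6.sub ((hg i h).const_smul _)⟩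
    · have l1 := measurable_pi_iff.mp h8 c
      have l2 := measurable_pi_iff.mp l1 i
      refine measurable_update_of h8 (measurable_update_of l1 (measurable_update_of l2 ?_ h) i) c
      exact measurable_inr.comp (n6.prodMk (measurable_sample hX c i h))
  · intro θ
    simp only [iterateConfig]

theorem measurable_advanceConfig (ha : Measurable a) (hC : Measurable C) (c : Fin n) :
    Measurable fun θ => advanceConfig A (a θ) (C θ) c := by
  obtain ⟨h1, h2, h3, h4, h5, h6, h7, h8⟩ := measurable_config_iff.mp hC
  have hn := measurable_pi_iff.mp h1 c
  obtain ⟨n1, n2, n3, n4, n5, n6⟩ := measurable_nodeState_iff.mp hn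
  refine measurable_of_fibers n1 (fun i θ => { C θ with
    node := Function.update (C θ).node c { (C θ).node c with
      round := i + 1
      count := 0
      quota := localSize A.size (a θ) (i + 1) c
      acc := 0 }
    inFlight := fun i' c' => (C θ).inFlight i' c' ∨ (i' = i ∧ c' = c)
    update := Function.update (C θ).update i
      (Function.update ((C θ).update i) c ((C θ).node c).acc) }) ?_ ?_
  · intro i
    refine measurable_config_iff.mpr ⟨?_, h2, h3, h4, ?_, ?_, h7, h8⟩
    · refine measurable_update_of h1 (measurable_nodeState_iff.mpr ?_) c
      exact ⟨measurable_const, measurable_const, measurable_localSize _ ha _ _, n4,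
        measurable_const, n6⟩
    · refine measurable_pi_iff.mpr fun i' => measurable_pi_iff.mpr fun c' => ?_
      exact (measurable_pi_iff.mp (measurable_pi_iff.mp h5 i') c').or measurable_const
    · exact measurable_update_of h6 (measurable_update_of (measurable_pi_iff.mp h6 i) n5 c) i
  · intro θ
    simp only [advanceConfig]

open scoped Classical in
theorem measurable_computeStep (hA : Measurable (Function.uncurry A.grad)) (ha : Measurable a)
    (hX : Measurable X) (hC : Measurable C) (c : Fin n) :
    Measurable fun θ => computeStep A (a θ) (X θ) (C θ) c := by
  obtain ⟨h1, -⟩ := measurable_config_iff.mp hC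
  have hn := measurable_pi_iff.mp h1 c
  obtain ⟨n1, n2, n3, n4, -, -⟩ := measurable_nodeState_iff.mp hn
  have hgate : ∀ θ, (A.delay (tGlob A ((C θ).node c)) < tDelay A ((C θ).node c)) ↔
      A.delay (tGlob A ⟨((C θ).node c).round, ((C θ).node c).count, ((C θ).node c).quota,
        ((C θ).node c).version, (0 : E), (0 : E)⟩) <
      tDelay A ⟨((C θ).node c).round, ((C θ).node c).count, ((C θ).node c).quota,
        ((C θ).node c).version, (0 : E), (0 : E)⟩ := fun θ => Iff.rfl
  refine measurable_of_fibers (n1.prodMk (n2.prodMk (n3.prodMk n4))) (fun b θ =>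
    if b.2.1 < b.2.2.1 then
      if A.delay (tGlob A ⟨b.1, b.2.1, b.2.2.1, b.2.2.2, (0 : E), (0 : E)⟩) <
        tDelay A ⟨b.1, b.2.1, b.2.2.1, b.2.2.2, (0 : E), (0 : E)⟩ then C θ
      else iterateConfig A (X θ) (C θ) c
    else advanceConfig A (a θ) (C θ) c) ?_ ?_
  · rintro ⟨i, h, q, k⟩
    dsimp only
    split_ifs
    · exact hC
    · exact measurable_iterateConfig hA hX hC c
    · exact measurable_advanceConfig ha hC c
  · intro θ
    simp only [computeStep, iterateConfig, advanceConfig, ← hgate]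

open scoped Classical in
theorem measurable_deliverStep (hC : Measurable C) (i : ℕ) (c : Fin n) :
    Measurable fun θ => deliverStep A (C θ) i c := by
  obtain ⟨h1, h2, h3, h4, h5, h6, h7, h8⟩ := measurable_config_iff.mp hC
  have hfl : ∀ i' c', Measurable fun θ => (C θ).inFlight i' c' := fun i' c' =>
    measurable_pi_iff.mp (measurable_pi_iff.mp h5 i') c'
  have hqu : ∀ i' c', Measurable fun θ => (C θ).queued i' c' := fun i' c' =>
    measurable_pi_iff.mp (measurable_pi_iff.mp h4 i') c'
  have hv : Measurable fun θ => (C θ).model - A.step i • (C θ).update i c :=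
    h2.sub ((measurable_pi_iff.mp (measurable_pi_iff.mp h6 i) c).const_smul _)
  have hfl' : Measurable fun θ => fun (i' : ℕ) (c' : Fin n) =>
      (C θ).inFlight i' c' ∧ ¬ (i' = i ∧ c' = c) :=
    measurable_pi_iff.mpr fun i' => measurable_pi_iff.mpr fun c' =>
      (hfl i' c').and measurable_const
  have hqu' : ∀ i' c', Measurable fun θ => (C θ).queued i' c' ∨ (i' = i ∧ c' = c) := fun i' c' =>
    (hqu i' c').or measurable_const
  refine measurable_of_fibers h3 (fun k θ =>
    if (C θ).inFlight i c then
      if ∀ c', (C θ).queued k c' ∨ (k = i ∧ c' = c) then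
        { C θ with
          model := (C θ).model - A.step i • (C θ).update i c
          inFlight := fun i' c' => (C θ).inFlight i' c' ∧ ¬ (i' = i ∧ c' = c)
          queued := fun i' c' => ((C θ).queued i' c' ∨ (i' = i ∧ c' = c)) ∧ i' ≠ k
          counter := k + 1
          broadcast := Function.update (C θ).broadcast (k + 1)
            ((C θ).model - A.step i • (C θ).update i c) }
      else
        { C θ with
          model := (C θ).model - A.step i • (C θ).update i c
          inFlight := fun i' c' => (C θ).inFlight i' c' ∧ ¬ (i' = i ∧ c' = c)
          queued := fun i' c' => (C θ).queued i' c' ∨ (i' = i ∧ c' = c) }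
    else C θ) ?_ ?_
  · intro k
    refine Measurable.ite (measurableSet_setOfPred.mpr (hfl i c)) (Measurable.ite ?_ ?_ ?_) hC
    · exact measurableSet_setOfPred.mpr (Measurable.forall fun c' => hqu' k c')
    · refine measurable_config_iff.mpr ⟨h1, hv, measurable_const, ?_, hfl', h6, ?_, h8⟩
      · exact measurable_pi_iff.mpr fun i' => measurable_pi_iff.mpr fun c' =>
          (hqu' i' c').and measurable_const
      · exact measurable_update_of h7 hv _
    · refine measurable_config_iff.mpr ⟨h1, hv, h3, ?_, hfl', h6, h7, h8⟩
      exact measurable_pi_iff.mpr fun i' => measurable_pi_iff.mpr fun c' => hqu' i' c'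
  · intro θ
    rfl

theorem measurable_receiveStep (hC : Measurable C) (c : Fin n) (k : ℕ) :
    Measurable fun θ => receiveStep A (C θ) c k := by
  obtain ⟨h1, h2, h3, h4, h5, h6, h7, h8⟩ := measurable_config_iff.mp hC
  have hn := measurable_pi_iff.mp h1 c
  obtain ⟨n1, n2, n3, n4, n5, n6⟩ := measurable_nodeState_iff.mp hn
  refine measurable_of_fibers (n1.prodMk (n4.prodMk h3)) (fun b θ =>
    if b.2.1 < k ∧ k ≤ b.2.2 then
      { C θ with
        node := Function.update (C θ).node c
          { (C θ).node c with
            version := k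
            model := (C θ).broadcast k - A.step b.1 • ((C θ).node c).acc } }
    else C θ) ?_ ?_
  · rintro ⟨i, v, k'⟩
    dsimp only
    split_ifs
    · refine measurable_config_iff.mpr ⟨?_, h2, h3, h4, h5, h6, h7, h8⟩
      refine measurable_update_of h1 (measurable_nodeState_iff.mpr ?_) c
      exact ⟨n1, n2, n3, measurable_const, n5,
        (measurable_pi_iff.mp h7 k).sub (n5.const_smul _)⟩
    · exact hC
  · intro θ
    rfl

theorem measurable_act (hA : Measurable (Function.uncurry A.grad)) (ha : Measurable a)
    (hX : Measurable X) (hC : Measurable C) {e : Θ → Event n} (he : Measurable e) :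
    Measurable fun θ => act A (a θ) (X θ) (C θ) (e θ) := by
  refine measurable_of_fibers he (fun e θ => act A (a θ) (X θ) (C θ) e) ?_ fun θ => rfl
  rintro (c | ⟨i, c⟩ | ⟨c, k⟩)
  · exact measurable_computeStep hA ha hX hC c
  · exact measurable_deliverStep hC i c
  · exact measurable_receiveStep hC c k

theorem measurable_history (hA : Measurable (Function.uncurry A.grad)) (hσ : ∀ r, Measurable (σ r))
    (ha : Measurable a) (hX : Measurable X) (r : ℕ) :
    Measurable fun θ => history A σ (a θ) (X θ) r := by
  induction r with
  | zero =>
    refine measurable_pi_iff.mpr fun k => measurable_config_iff.mpr ?_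
    refine ⟨measurable_pi_iff.mpr fun c => measurable_nodeState_iff.mpr ?_, measurable_const,
      measurable_const, measurable_const, measurable_const, measurable_const, measurable_const,
      measurable_const⟩
    exact ⟨measurable_const, measurable_const, measurable_localSize _ ha _ _, measurable_const,
      measurable_const, measurable_const⟩
  | succ r ih =>
    refine measurable_pi_iff.mpr fun k => ?_
    induction k using Fin.lastCases with
    | last =>
      simp only [history, Fin.snoc_last]
      exact measurable_act hA ha hX (measurable_pi_iff.mp ih _) ((hσ r).comp ih)
    | cast k =>
      simp only [history, Fin.snoc_castSucc]
      exact measurable_pi_iff.mp ih k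

theorem measurable_run (hA : Measurable (Function.uncurry A.grad)) (hσ : ∀ r, Measurable (σ r))
    (ha : Measurable a) (hX : Measurable X) (r : ℕ) :
    Measurable fun θ => run A σ (a θ) (X θ) r :=
  measurable_pi_iff.mp (measurable_history hA hσ ha hX r) _

theorem measurable_evalModel (hA : Measurable (Function.uncurry A.grad))
    (hσ : ∀ r, Measurable (σ r)) (ha : Measurable a) (hX : Measurable X) (z : Fin n × ℕ × ℕ) :
    Measurable fun θ => evalModel A σ (a θ) (X θ) z := by
  -- the logged value is the limit of the current log entries
  have hlog : ∀ r, Measurable fun θ => (run A σ (a θ) (X θ) r).log z.1 z.2.1 z.2.2 := fun r => by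
    obtain ⟨-, -, -, -, -, -, -, h⟩ :=
      measurable_config_iff.mp (measurable_run (σ := σ) hA hσ ha hX r)
    exact measurable_pi_iff.mp (measurable_pi_iff.mp (measurable_pi_iff.mp h z.1) z.2.1) z.2.2
  have hv : ∀ r, Measurable fun θ => Sum.elim (fun _ => A.init) Prod.fst
      ((run A σ (a θ) (X θ) r).log z.1 z.2.1 z.2.2) := fun r =>
    (measurable_const.sumElim measurable_fst).comp (hlog r)
  refine measurable_of_tendsto_metrizable hv (tendsto_pi_nhds.mpr fun θ => ?_)
  by_cases h : ∃ r, ((run A σ (a θ) (X θ) r).log z.1 z.2.1 z.2.2).isRight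
  · obtain ⟨r₀, h₀⟩ := h
    obtain ⟨⟨w, ξ⟩, hw⟩ := Sum.isRight_iff.mp h₀
    rw [evalModel_eq hw]
    refine tendsto_const_nhds.congr' ?_
    filter_upwards [eventually_ge_atTop r₀] with r hr
    rw [run_log hr h₀, hw]
    rfl
  · have : evalModel A σ (a θ) (X θ) z = A.init := by rw [evalModel, dif_neg h]
    rw [this]
    refine tendsto_const_nhds.congr fun r => ?_
    have hr : ¬ ((run A σ (a θ) (X θ) r).log z.1 z.2.1 z.2.2).isRight := fun h' => h ⟨r, h'⟩
    cases hl : (run A σ (a θ) (X θ) r).log z.1 z.2.1 z.2.2 with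
    | inl u => rfl
    | inr w => rw [hl] at hr; simp at hr

theorem measurable_localModel (hA : Measurable (Function.uncurry A.grad))
    (hσ : ∀ r, Measurable (σ r)) (ha : Measurable a) (hX : Measurable X) (t : ℕ) :
    Measurable fun θ => localModel A σ (a θ) (X θ) t := by
  simp only [localModel_eq]
  exact measurable_of_fibers (measurable_slot A.size ha t)
    (fun z θ => evalModel A σ (a θ) (X θ) z) (measurable_evalModel hA hσ ha hX) fun θ => rfl

theorem measurable_sampleAt (A : Algorithm E Ξ) (ha : Measurable a) (hX : Measurable X) (t : ℕ) :
    Measurable fun θ => sampleAt A (a θ) (X θ) t :=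
  measurable_of_fibers (measurable_slot A.size ha t)
    (fun z θ => X θ z.1 z.2.1 z.2.2) (fun _ => measurable_sample hX _ _ _) fun _ => rfl

theorem measurable_iterate (hA : Measurable (Function.uncurry A.grad))
    (hσ : ∀ r, Measurable (σ r)) (ha : Measurable a) (hX : Measurable X) (t : ℕ) :
    Measurable fun θ => iterate A σ (a θ) (X θ) t := by
  induction t with
  | zero => exact measurable_const
  | succ t ih =>
    simp only [iterate]
    refine ih.sub (Measurable.const_smul ?_ _)
    exact hA.comp ((measurable_localModel hA hσ ha hX t).prodMk (measurable_sampleAt A ha hX t))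

end Measurability

/-! ### The law of the samples along the slots -/

section Law

variable {n : ℕ} {Ξ Ω : Type*} [MeasurableSpace Ξ] [mΩ : MeasurableSpace Ω]
  {a : ℕ → ℕ → Ω → Fin n} {X : Fin n → ℕ → ℕ → Ω → Ξ} {s : ℕ → ℕ}
  {P : Measure Ω} {p : Fin n → ℝ≥0} {D : Fin n → Measure Ξ}

/-- The σ-algebras of the single coin flips and of the single samples. -/
@[reducible] def tableSigma (a : ℕ → ℕ → Ω → Fin n) (X : Fin n → ℕ → ℕ → Ω → Ξ) :
    (ℕ × ℕ) ⊕ (Fin n × ℕ × ℕ) → MeasurableSpace Ω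
  | .inl z => MeasurableSpace.comap (a z.1 z.2) inferInstance
  | .inr z => MeasurableSpace.comap (X z.1 z.2.1 z.2.2) inferInstance

/-- The σ-algebra generated by the coin flips and the samples with indices in `T`. -/
@[reducible] def sigmaOf (a : ℕ → ℕ → Ω → Fin n) (X : Fin n → ℕ → ℕ → Ω → Ξ)
    (T : Set ((ℕ × ℕ) ⊕ (Fin n × ℕ × ℕ))) : MeasurableSpace Ω :=
  ⨆ j ∈ T, tableSigma a X j

theorem sigmaOf_mono {T T' : Set ((ℕ × ℕ) ⊕ (Fin n × ℕ × ℕ))} (h : T ⊆ T') :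
    sigmaOf a X T ≤ sigmaOf a X T' := biSup_mono fun _ hj => h hj

theorem measurable_flip_sigmaOf {T : Set ((ℕ × ℕ) ⊕ (Fin n × ℕ × ℕ))} {i t : ℕ}
    (h : Sum.inl (i, t) ∈ T) : Measurable[sigmaOf a X T] (a i t) :=
  Measurable.mono (comap_measurable (a i t))
    (le_biSup (tableSigma a X) h) le_rfl

theorem measurable_sample_sigmaOf {T : Set ((ℕ × ℕ) ⊕ (Fin n × ℕ × ℕ))} {c : Fin n} {i h : ℕ}
    (hz : Sum.inr (c, i, h) ∈ T) : Measurable[sigmaOf a X T] (X c i h) :=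
  Measurable.mono (comap_measurable (X c i h))
    (le_biSup (tableSigma a X) hz) le_rfl

theorem tableSigma_le (ha : ∀ i t, Measurable (a i t)) (hX : ∀ c i h, Measurable (X c i h))
    (j : (ℕ × ℕ) ⊕ (Fin n × ℕ × ℕ)) : tableSigma a X j ≤ mΩ := by
  rcases j with z | z
  · exact (ha _ _).comap_le
  · exact (hX _ _ _).comap_le

theorem sigmaOf_le (ha : ∀ i t, Measurable (a i t)) (hX : ∀ c i h, Measurable (X c i h))
    (T : Set ((ℕ × ℕ) ⊕ (Fin n × ℕ × ℕ))) : sigmaOf a X T ≤ mΩ :=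
  iSup₂_le fun j _ => tableSigma_le ha hX j

theorem indep_measure_inter {m m' : MeasurableSpace Ω} (h : Indep m m' P) {A B : Set Ω}
    (hA : MeasurableSet[m] A) (hB : MeasurableSet[m'] B) : P (A ∩ B) = P A * P B :=
  (Indep_iff _ _ _).mp h A B hA hB

/-- All coin flips and all samples are jointly independent. -/
theorem iIndep_tableSigma [IsProbabilityMeasure P]
    (ha_indep : iIndepFun (fun (z : ℕ × ℕ) ω => a z.1 z.2 ω) P)
    (hX_indep : iIndepFun (fun (z : Fin n × ℕ × ℕ) ω => X z.1 z.2.1 z.2.2 ω) P)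
    (haX_indep : IndepFun (fun ω (z : ℕ × ℕ) => a z.1 z.2 ω)
      (fun ω (z : Fin n × ℕ × ℕ) => X z.1 z.2.1 z.2.2 ω) P) :
    iIndep (tableSigma a X) P := by
  classical
  rw [iIndep_iff]
  intro S f hf
  have hsplit : (⋂ j ∈ S, f j) =
      (⋂ z ∈ S.toLeft, f (Sum.inl z)) ∩ ⋂ z ∈ S.toRight, f (Sum.inr z) := by
    ext ω
    simp only [Set.mem_iInter, Set.mem_inter_iff, Finset.mem_toLeft, Finset.mem_toRight]
    exact ⟨fun h => ⟨fun z hz => h _ hz, fun z hz => h _ hz⟩,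
      fun h j hj => by rcases j with z | z; exacts [h.1 z hj, h.2 z hj]⟩
  have hL : MeasurableSet[MeasurableSpace.comap (fun ω (z : ℕ × ℕ) => a z.1 z.2 ω) inferInstance]
      (⋂ z ∈ S.toLeft, f (Sum.inl z)) := by
    refine MeasurableSet.biInter S.toLeft.countable_toSet fun z hz => ?_
    obtain ⟨B, hB, hBf⟩ := hf (Sum.inl z) (Finset.mem_toLeft.mp hz)
    exact ⟨(fun x => x z) ⁻¹' B, measurable_pi_apply z hB, hBf⟩
  have hR : MeasurableSet[MeasurableSpace.comap
      (fun ω (z : Fin n × ℕ × ℕ) => X z.1 z.2.1 z.2.2 ω) inferInstance]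
      (⋂ z ∈ S.toRight, f (Sum.inr z)) := by
    refine MeasurableSet.biInter S.toRight.countable_toSet fun z hz => ?_
    obtain ⟨B, hB, hBf⟩ := hf (Sum.inr z) (Finset.mem_toRight.mp hz)
    exact ⟨(fun x => x z) ⁻¹' B, measurable_pi_apply z hB, hBf⟩
  rw [hsplit, indep_measure_inter ((IndepFun_iff_Indep _ _ _).mp haX_indep) hL hR,
    (iIndepFun_iff_iIndep _ _ _).mp ha_indep |>.meas_biInter
      (fun z hz => hf _ (Finset.mem_toLeft.mp hz)),
    (iIndepFun_iff_iIndep _ _ _).mp hX_indep |>.meas_biInter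
      (fun z hz => hf _ (Finset.mem_toRight.mp hz)),
    ← Finset.prod_disjSum _ _ (fun j => P (f j)), Finset.toLeft_disjSum_toRight]

theorem indep_sigmaOf (ha : ∀ i t, Measurable (a i t)) (hX : ∀ c i h, Measurable (X c i h))
    (hind : iIndep (tableSigma a X) P) {T T' : Set ((ℕ × ℕ) ⊕ (Fin n × ℕ × ℕ))}
    (h : Disjoint T T') : Indep (sigmaOf a X T) (sigmaOf a X T') P :=
  indep_iSup_of_disjoint (tableSigma_le ha hX) hind h

/-- The sample that is used by the evaluation with global count `t`. -/
def slotSample (s : ℕ → ℕ) (a : ℕ → ℕ → Ω → Fin n) (X : Fin n → ℕ → ℕ → Ω → Ξ) (t : ℕ) (ω : Ω) :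
    Ξ :=
  X (slot s (fun i t => a i t ω) t).1 (slot s (fun i t => a i t ω) t).2.1
    (slot s (fun i t => a i t ω) t).2.2 ω

theorem measurable_slot_sigmaOf (s : ℕ → ℕ) (t : ℕ) {T : Set ((ℕ × ℕ) ⊕ (Fin n × ℕ × ℕ))}
    (hT : Set.range Sum.inl ⊆ T) :
    Measurable[sigmaOf a X T] fun ω => slot s (fun i t => a i t ω) t := by
  refine @measurable_slot Ω (sigmaOf a X T) n (fun ω i t => a i t ω) s ?_ t
  refine @measurable_pi_iff _ _ _ (sigmaOf a X T) _ _ |>.mpr fun i =>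
    @measurable_pi_iff _ _ _ (sigmaOf a X T) _ _ |>.mpr fun t => ?_
  exact measurable_flip_sigmaOf (hT ⟨_, rfl⟩)

theorem measurable_slotSample (ha : ∀ i t, Measurable (a i t))
    (hX : ∀ c i h, Measurable (X c i h)) (s : ℕ → ℕ) (t : ℕ) :
    Measurable (slotSample s a X t) := by
  refine measurable_of_fibers (d := fun ω => slot s (fun i t => a i t ω) t) ?_
    (fun z ω => X z.1 z.2.1 z.2.2 ω) (fun z => hX _ _ _) fun ω => rfl
  exact measurable_slot s (measurable_pi_iff.mpr fun i => measurable_pi_iff.mpr fun t => ha i t) t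

/-- The event `H` may depend on everything but the sample of slot `t`; then this sample has the
law of its node. -/
theorem measure_inter_slotSample (ha : ∀ i t, Measurable (a i t))
    (hX : ∀ c i h, Measurable (X c i h)) (hind : iIndep (tableSigma a X) P)
    (hX_law : ∀ c i h, P.map (X c i h) = D c) {t : ℕ} {H : Set Ω} (hHm : MeasurableSet H)
    (hH : ∀ z, MeasurableSet[sigmaOf a X {j | j ≠ Sum.inr z}]
      (H ∩ {ω | slot s (fun i t => a i t ω) t = z}))
    {S : Set Ξ} (hS : MeasurableSet S) :
    P (H ∩ slotSample s a X t ⁻¹' S) =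
      ∑ c, P (H ∩ {ω | nodeOf s (fun i t => a i t ω) t = c}) * D c S := by
  have hslot : Measurable fun ω => slot s (fun i t => a i t ω) t :=
    measurable_slot s (measurable_pi_iff.mpr fun i => measurable_pi_iff.mpr fun t => ha i t) t
  have hsing : ∀ z, MeasurableSet {ω | slot s (fun i t => a i t ω) t = z} := fun z =>
    hslot (measurableSet_singleton z)
  have hsing' : ∀ c, MeasurableSet {ω | nodeOf s (fun i t => a i t ω) t = c} := fun c =>
    hslot.fst (measurableSet_singleton c)
  have hξ := measurable_slotSample ha hX s t
  -- decompose according to the local counter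
  have hdec : ∀ (c : Fin n) (B : Set Ω), MeasurableSet B →
      P (B ∩ {ω | nodeOf s (fun i t => a i t ω) t = c}) =
        ∑' h, P (B ∩ {ω | slot s (fun i t => a i t ω) t = (c, roundOf s t, h)}) := by
    intro c B hB
    rw [← measure_iUnion]
    · congr 1
      ext ω
      simp [slot]
    · intro h h' hne
      rw [Function.onFun, Set.disjoint_left]
      rintro ω ⟨-, h1⟩ ⟨-, h2⟩
      have h3 := h1.symm.trans h2
      simp only [Prod.mk.injEq, true_and] at h3
      exact hne h3
    · exact fun h => hB.inter (hsing _)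
  have hsum : P (H ∩ slotSample s a X t ⁻¹' S) = ∑ c, P ((H ∩ slotSample s a X t ⁻¹' S) ∩
      {ω | nodeOf s (fun i t => a i t ω) t = c}) := by
    rw [← measure_biUnion_finset]
    · congr 1
      ext ω
      simp
    · intro c _ c' _ hne
      rw [Function.onFun, Set.disjoint_left]
      rintro ω ⟨-, h1⟩ ⟨-, h2⟩
      exact hne (h1.symm.trans h2)
    · exact fun c _ => (hHm.inter (hξ hS)).inter (hsing' c)
  rw [hsum]
  refine Finset.sum_congr rfl fun c _ => ?_
  rw [hdec c _ (hHm.inter (hξ hS)), hdec c H hHm, ← ENNReal.tsum_mul_right]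
  refine tsum_congr fun h => ?_
  have hset : (H ∩ slotSample s a X t ⁻¹' S) ∩
      {ω | slot s (fun i t => a i t ω) t = (c, roundOf s t, h)} =
      (H ∩ {ω | slot s (fun i t => a i t ω) t = (c, roundOf s t, h)}) ∩
        X c (roundOf s t) h ⁻¹' S := by
    ext ω
    simp only [Set.mem_inter_iff, Set.mem_preimage, Set.mem_ofPred_eq, slotSample]
    constructor
    · rintro ⟨⟨h1, h2⟩, h3⟩
      rw [h3] at h2
      exact ⟨⟨h1, h3⟩, h2⟩
    · rintro ⟨⟨h1, h3⟩, h2⟩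
      rw [h3]
      exact ⟨⟨h1, h2⟩, rfl⟩
  have hdisj : Disjoint {j : (ℕ × ℕ) ⊕ (Fin n × ℕ × ℕ) | j ≠ Sum.inr (c, roundOf s t, h)}
      {Sum.inr (c, roundOf s t, h)} := by
    rw [Set.disjoint_singleton_right]; simp
  rw [hset, indep_measure_inter (indep_sigmaOf ha hX hind hdisj) (hH _)
    (measurable_sample_sigmaOf (Set.mem_singleton _) hS), ← hX_law c (roundOf s t) h,
    Measure.map_apply (hX _ _ _) hS]

theorem mixture_apply (S : Set Ξ) : mixture p D S = ∑ c, (p c : ℝ≥0∞) * D c S := by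
  simp only [mixture, Measure.coe_finsetSum, Finset.sum_apply, Measure.smul_apply]
  rfl

/-- If the event `H` does not depend on the coin flip and on the samples of slot `t`, then it is
independent of the sample of slot `t`, which has the law `∑ c, p c • D c`. -/
theorem measure_inter_slotSample_of_indep (ha : ∀ i t, Measurable (a i t))
    (hX : ∀ c i h, Measurable (X c i h)) (hind : iIndep (tableSigma a X) P)
    (ha_law : ∀ i t c, P {ω | a i t ω = c} = p c)
    (hX_law : ∀ c i h, P.map (X c i h) = D c) {t : ℕ} {T : Set ((ℕ × ℕ) ⊕ (Fin n × ℕ × ℕ))}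
    (hT : ∀ t', Sum.inl (roundOf s t, t') ∉ T) (hT' : ∀ c h, Sum.inr (c, roundOf s t, h) ∉ T)
    {H : Set Ω} (hH : MeasurableSet[sigmaOf a X T] H)
    {S : Set Ξ} (hS : MeasurableSet S) :
    P (H ∩ slotSample s a X t ⁻¹' S) = P H * mixture p D S := by
  rw [measure_inter_slotSample ha hX hind hX_law (sigmaOf_le ha hX T H hH) _ hS, mixture_apply,
    Finset.mul_sum]
  · refine Finset.sum_congr rfl fun c _ => ?_
    have hdisj : Disjoint T {Sum.inl (roundOf s t, t - roundStart s (roundOf s t))} := by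
      rw [Set.disjoint_singleton_right]; exact hT _
    have hset : {ω | nodeOf s (fun i t => a i t ω) t = c} =
        a (roundOf s t) (t - roundStart s (roundOf s t)) ⁻¹' {c} := rfl
    rw [hset, indep_measure_inter (indep_sigmaOf ha hX hind hdisj) hH
      (measurable_flip_sigmaOf (Set.mem_singleton _) (measurableSet_singleton c)), mul_assoc]
    congr 2
    exact ha_law _ _ c
  · intro z
    by_cases hz : z.2.1 = roundOf s t
    · refine @MeasurableSet.inter _ _ _ _ ?_ ?_
      · refine sigmaOf_mono ?_ H hH
        rintro j hj rfl
        exact hT' z.1 z.2.2 (by rw [← hz]; exact hj)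
      · exact measurable_slot_sigmaOf s t (by rintro _ ⟨x, rfl⟩; simp) (measurableSet_singleton z)
    · have : H ∩ {ω | slot s (fun i t => a i t ω) t = z} = ∅ := by
        rw [Set.eq_empty_iff_forall_notMem]
        rintro ω ⟨-, h⟩
        exact hz (congrArg (fun z => z.2.1) h.symm)
      rw [this]
      exact @MeasurableSet.empty Ω (sigmaOf a X {j | j ≠ Sum.inr z})

/-- Choosing a node at random and sampling from its local distribution is sampling from the mixture. -/
theorem map_slotSample [IsProbabilityMeasure P] (ha : ∀ i t, Measurable (a i t))
    (hX : ∀ c i h, Measurable (X c i h)) (hind : iIndep (tableSigma a X) P)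
    (ha_law : ∀ i t c, P {ω | a i t ω = c} = p c)
    (hX_law : ∀ c i h, P.map (X c i h) = D c) (t : ℕ) :
    P.map (slotSample s a X t) = mixture p D := by
  ext S hS
  rw [Measure.map_apply (measurable_slotSample ha hX s t) hS]
  have := measure_inter_slotSample_of_indep (s := s) (t := t) (T := ∅) ha hX hind ha_law hX_law
    (by simp) (by simp) (H := Set.univ) MeasurableSet.univ hS
  simpa using this

/-- A quantity that uses neither flips nor samples of the round of slot `t` is independent of the
sample drawn for this slot. -/
theorem indepFun_slotSample_of_measurable [IsProbabilityMeasure P] (ha : ∀ i t, Measurable (a i t))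
    (hX : ∀ c i h, Measurable (X c i h)) (hind : iIndep (tableSigma a X) P)
    (ha_law : ∀ i t c, P {ω | a i t ω = c} = p c)
    (hX_law : ∀ c i h, P.map (X c i h) = D c) {t : ℕ} {T : Set ((ℕ × ℕ) ⊕ (Fin n × ℕ × ℕ))}
    (hT : ∀ t', Sum.inl (roundOf s t, t') ∉ T) (hT' : ∀ c h, Sum.inr (c, roundOf s t, h) ∉ T)
    {β : Type*} [MeasurableSpace β] {B : Ω → β} (hB : Measurable[sigmaOf a X T] B) :
    IndepFun B (slotSample s a X t) P := by
  rw [indepFun_iff_measure_inter_preimage_eq_mul]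
  intro S' S hS' hS
  rw [measure_inter_slotSample_of_indep ha hX hind ha_law hX_law hT hT' (hB hS') hS,
    ← map_slotSample ha hX hind ha_law hX_law t,
    Measure.map_apply (measurable_slotSample ha hX s t) hS]

/-- The samples are independent along the slots. Two slots of one round may belong to the same node;
then they use different samples of this node. -/
theorem indepFun_slotSample [IsProbabilityMeasure P] (ha : ∀ i t, Measurable (a i t))
    (hX : ∀ c i h, Measurable (X c i h)) (hind : iIndep (tableSigma a X) P)
    (ha_law : ∀ i t c, P {ω | a i t ω = c} = p c)
    (hX_law : ∀ c i h, P.map (X c i h) = D c) {t u : ℕ} (htu : t ≠ u) :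
    IndepFun (slotSample s a X u) (slotSample s a X t) P := by
  rw [indepFun_iff_measure_inter_preimage_eq_mul]
  intro S' S hS' hS
  have hlaw : ∀ t S, MeasurableSet S → P (slotSample s a X t ⁻¹' S) = mixture p D S :=
    fun t S hS => by
      rw [← map_slotSample ha hX hind ha_law hX_law t,
        Measure.map_apply (measurable_slotSample ha hX s t) hS]
  have hsl : ∀ z t z', MeasurableSet[sigmaOf a X {j | j ≠ Sum.inr z}]
      {ω | slot s (fun i t => a i t ω) t = z'} := fun z t z' =>
    measurable_slot_sigmaOf s t (by rintro _ ⟨x, rfl⟩; simp) (measurableSet_singleton z')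
  have hpos : (roundOf s t, t - roundStart s (roundOf s t)) ≠
      (roundOf s u, u - roundStart s (roundOf s u)) := by
    intro h
    simp only [Prod.mk.injEq] at h
    have h1 := roundStart_roundOf_le s t
    have h2 := roundStart_roundOf_le s u
    rw [← h.1] at h2 h
    omega
  rw [hlaw t S hS, hlaw u S' hS',
    measure_inter_slotSample ha hX hind hX_law (measurable_slotSample ha hX s u hS') _ hS]
  · -- the coin flip of slot `t` is independent of the sample of slot `u`
    rw [mixture_apply (p := p) (D := D) S, Finset.mul_sum]
    refine Finset.sum_congr rfl fun c _ => ?_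
    have hset : ∀ v (c : Fin n), {ω | nodeOf s (fun i t => a i t ω) v = c} =
        a (roundOf s v) (v - roundStart s (roundOf s v)) ⁻¹' {c} := fun v c => rfl
    rw [Set.inter_comm, measure_inter_slotSample ha hX hind hX_law _ _ hS', mixture_apply,
      ← mul_assoc, Finset.sum_mul, Finset.sum_mul, Finset.sum_mul]
    · refine Finset.sum_congr rfl fun c' _ => ?_
      have hdisj : Disjoint
          ({Sum.inl (roundOf s t, t - roundStart s (roundOf s t))} :
            Set ((ℕ × ℕ) ⊕ (Fin n × ℕ × ℕ)))
          {Sum.inl (roundOf s u, u - roundStart s (roundOf s u))} := by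
        rw [Set.disjoint_singleton]
        exact fun h => hpos (Sum.inl_injective h)
      rw [hset, hset, indep_measure_inter (indep_sigmaOf ha hX hind hdisj)
        (measurable_flip_sigmaOf (Set.mem_singleton _) (measurableSet_singleton c))
        (measurable_flip_sigmaOf (Set.mem_singleton _) (measurableSet_singleton c')),
        show P (a (roundOf s t) (t - roundStart s (roundOf s t)) ⁻¹' {c}) = p c from
          ha_law _ _ c,
        show P (a (roundOf s u) (u - roundStart s (roundOf s u)) ⁻¹' {c'}) = p c' from
          ha_law _ _ c']
      ring
    · exact ha _ _ (measurableSet_singleton c)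
    · intro z
      refine @MeasurableSet.inter _ _ _ _ ?_ (hsl z u z)
      rw [hset]
      exact measurable_flip_sigmaOf (by simp) (measurableSet_singleton c)
  · intro z
    have hU : slotSample s a X u ⁻¹' S' ∩ {ω | slot s (fun i t => a i t ω) t = z} =
        ⋃ z' ∈ {z' | z' ≠ z}, ({ω | slot s (fun i t => a i t ω) u = z'} ∩
          {ω | slot s (fun i t => a i t ω) t = z}) ∩ X z'.1 z'.2.1 z'.2.2 ⁻¹' S' := by
      ext ω
      simp only [Set.mem_inter_iff, Set.mem_preimage, Set.mem_ofPred_eq, Set.mem_iUnion,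
        exists_prop, slotSample]
      constructor
      · rintro ⟨h1, h2⟩
        refine ⟨_, fun h => htu ?_, ⟨rfl, h2⟩, h1⟩
        exact slot_injective s _ (h2.trans h.symm)
      · rintro ⟨z', -, ⟨rfl, h2⟩, h3⟩
        exact ⟨h3, h2⟩
    rw [hU]
    refine @MeasurableSet.biUnion _ _ _ _ _ (Set.to_countable _) fun z' hz' => ?_
    refine @MeasurableSet.inter _ _ _ _ (@MeasurableSet.inter _ _ _ _ (hsl z u z') (hsl z t z))
      (measurable_sample_sigmaOf ?_ hS')
    simpa using hz'

/-- An event that only depends on the coin flips changes the law of a sample by at most the factor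
`(∑ c, (p c)⁻¹) P(H)` (with `0⁻¹ = 0`). -/
theorem setLIntegral_slotSample_le (ha : ∀ i t, Measurable (a i t))
    (hX : ∀ c i h, Measurable (X c i h)) (hind : iIndep (tableSigma a X) P)
    (ha_law : ∀ i t c, P {ω | a i t ω = c} = p c)
    (hX_law : ∀ c i h, P.map (X c i h) = D c) (t : ℕ) {H : Set Ω}
    (hH : MeasurableSet[sigmaOf a X (Set.range Sum.inl)] H) {φ : Ξ → ℝ≥0∞} (hφ : Measurable φ) :
    ∫⁻ ω in H, φ (slotSample s a X t ω) ∂P ≤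
      ((∑ c, (p c)⁻¹ : ℝ≥0) : ℝ≥0∞) * P H * ∫⁻ ξ, φ ξ ∂(mixture p D) := by
  have hHm := sigmaOf_le ha hX _ H hH
  have hξ := measurable_slotSample ha hX s t
  have hle : (P.restrict H).map (slotSample s a X t) ≤
      (((∑ c, (p c)⁻¹ : ℝ≥0) : ℝ≥0∞) * P H) • mixture p D := by
    refine Measure.le_iff.mpr fun S hS => ?_
    rw [Measure.map_apply hξ hS, Measure.restrict_apply (hξ hS), Set.inter_comm,
      measure_inter_slotSample ha hX hind hX_law hHm _ hS, Measure.smul_apply, smul_eq_mul]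
    · have hsum : P H = ∑ c, P (H ∩ {ω | nodeOf s (fun i t => a i t ω) t = c}) := by
        rw [← measure_biUnion_finset]
        · congr 1
          ext ω
          simp
        · intro c _ c' _ hne
          rw [Function.onFun, Set.disjoint_left]
          rintro ω ⟨-, h1⟩ ⟨-, h2⟩
          exact hne (h1.symm.trans h2)
        · exact fun c _ => hHm.inter (ha _ _ (measurableSet_singleton c))
      rw [mul_comm ((∑ c, (p c)⁻¹ : ℝ≥0) : ℝ≥0∞), mul_assoc, hsum, Finset.sum_mul]
      refine Finset.sum_le_sum fun c _ => ?_
      by_cases hc : p c = 0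
      · have : P (H ∩ {ω | nodeOf s (fun i t => a i t ω) t = c}) = 0 := by
          refine measure_mono_null Set.inter_subset_right ?_
          rw [show P {ω | nodeOf s (fun i t => a i t ω) t = c} = p c from ha_law _ _ c, hc]
          rfl
        simp [this]
      · refine mul_le_mul_right ?_ _
        have h1 : ((p c)⁻¹ : ℝ≥0) ≤ ∑ c, (p c)⁻¹ :=
          Finset.single_le_sum (f := fun c => (p c)⁻¹) (fun _ _ => zero_le) (Finset.mem_univ c)
        have h2 : (p c : ℝ≥0∞) * D c S ≤ mixture p D S := by
          rw [mixture_apply]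
          exact Finset.single_le_sum (f := fun c => (p c : ℝ≥0∞) * D c S)
            (fun _ _ => zero_le) (Finset.mem_univ c)
        calc D c S = (((p c)⁻¹ : ℝ≥0) : ℝ≥0∞) * ((p c : ℝ≥0∞) * D c S) := by
              rw [← mul_assoc, ← ENNReal.coe_mul, inv_mul_cancel₀ hc, ENNReal.coe_one, one_mul]
          _ ≤ _ := mul_le_mul' (ENNReal.coe_le_coe.mpr h1) h2
    · intro z
      have h : Set.range Sum.inl ⊆ {j : (ℕ × ℕ) ⊕ (Fin n × ℕ × ℕ) | j ≠ Sum.inr z} := by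
        rintro _ ⟨x, rfl⟩; simp
      exact @MeasurableSet.inter _ _ _ _ (sigmaOf_mono h H hH)
        (measurable_slot_sigmaOf s t h (measurableSet_singleton z))
  calc ∫⁻ ω in H, φ (slotSample s a X t ω) ∂P
      = ∫⁻ ξ, φ ξ ∂((P.restrict H).map (slotSample s a X t)) := (lintegral_map hφ hξ).symm
    _ ≤ ∫⁻ ξ, φ ξ ∂((((∑ c, (p c)⁻¹ : ℝ≥0) : ℝ≥0∞) * P H) • mixture p D) :=
        lintegral_mono' hle le_rfl
    _ = _ := by rw [lintegral_smul_measure, smul_eq_mul]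

end Law

/-! ### Asymptotics of the sample sizes, the delays and the step sizes -/

section Growth

open Asymptotics

theorem eventually_natCast_ge (K : ℝ) : ∀ᶠ i : ℕ in atTop, K ≤ (i : ℝ) :=
  tendsto_natCast_atTop_atTop.eventually_ge_atTop K

theorem eventually_log_natCast_ge (K : ℝ) : ∀ᶠ i : ℕ in atTop, K ≤ Real.log i :=
  (Real.tendsto_log_atTop.comp tendsto_natCast_atTop_atTop).eventually_ge_atTop K

variable {d m : ℕ}

theorem one_lt_scaled (hm : 2 * (d + 1) < m + 1) (i : ℕ) :
    1 < ((m : ℝ) + i + 1) / (2 * ((d : ℝ) + 1)) := by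
  rw [one_lt_div (by positivity)]
  have : (2 * ((d : ℝ) + 1)) < m + 1 := by exact_mod_cast hm
  have hi : (0 : ℝ) ≤ i := Nat.cast_nonneg i
  linarith

theorem sampleSize_pos (hm : 2 * (d + 1) < m + 1) (i : ℕ) : 0 < sampleSize d m i := by
  rw [sampleSize, Nat.ceil_pos]
  have := Real.log_pos (one_lt_scaled hm i)
  positivity

/-- `c₁ i / ln i ≤ s i ≤ c₂ i / ln i` for all large `i`. -/
def GrowsLikeDivLog (s : ℕ → ℕ) (c₁ c₂ : ℝ) : Prop :=
  ∀ᶠ i : ℕ in atTop, c₁ * (i / Real.log i) ≤ s i ∧ (s i : ℝ) ≤ c₂ * (i / Real.log i)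

theorem growsLikeDivLog_sampleSize (hm : 2 * (d + 1) < m + 1) :
    GrowsLikeDivLog (sampleSize d m) (1 / (32 * ((d : ℝ) + 1) ^ 2)) 2 := by
  have hD : (1 : ℝ) ≤ (d : ℝ) + 1 := by linarith [(Nat.cast_nonneg d : (0 : ℝ) ≤ d)]
  have hm0 : (0 : ℝ) ≤ m := Nat.cast_nonneg m
  filter_upwards [eventually_natCast_ge (m + 2), eventually_natCast_ge ((2 * ((d : ℝ) + 1)) ^ 2),
    eventually_log_natCast_ge 1] with i h1 h2 h3
  have hi : (2 : ℝ) ≤ i := by linarith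
  have hx := one_lt_scaled hm i
  set x : ℝ := ((m : ℝ) + i + 1) / (2 * ((d : ℝ) + 1)) with hxdef
  have hlog : 0 < Real.log x := Real.log_pos hx
  have hsq : 2 * ((d : ℝ) + 1) ≤ √i := Real.le_sqrt_of_sq_le h2
  have hsqi : √(i : ℝ) * √i = i := Real.mul_self_sqrt (by linarith)
  have hxlow : √(i : ℝ) ≤ x := by
    rw [hxdef, le_div_iff₀ (by positivity)]
    nlinarith [Real.sqrt_nonneg (i : ℝ)]
  have hxup : x ≤ (i : ℝ) ^ 2 := by
    rw [hxdef, div_le_iff₀ (by positivity)]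
    nlinarith [mul_nonneg (sub_nonneg.mpr hD) (sq_nonneg (i : ℝ))]
  have hl1 : Real.log i / 2 ≤ Real.log x := by
    rw [← Real.log_sqrt (by linarith)]
    exact Real.log_le_log (Real.sqrt_pos.mpr (by linarith)) hxlow
  have hl2 : Real.log x ≤ 2 * Real.log i := by
    have := Real.log_le_log (by linarith) hxup
    rwa [Real.log_pow, Nat.cast_ofNat] at this
  set y : ℝ := ((m : ℝ) + i + 1) / (16 * ((d : ℝ) + 1) ^ 2) * (1 / Real.log x) with hy
  have hy0 : 0 ≤ y := by positivity
  have hs1 : y ≤ sampleSize d m i := Nat.le_ceil _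
  have hs2 : (sampleSize d m i : ℝ) < y + 1 := Nat.ceil_lt_add_one hy0
  constructor
  · refine le_trans ?_ hs1
    rw [hy, mul_one_div, div_div, one_div_mul_eq_div, div_div, div_le_div_iff₀ (by positivity)
      (by positivity)]
    have : 16 * ((d : ℝ) + 1) ^ 2 * Real.log x ≤ 32 * ((d : ℝ) + 1) ^ 2 * Real.log i := by
      nlinarith [sq_nonneg ((d : ℝ) + 1)]
    have h4 : 0 ≤ 16 * ((d : ℝ) + 1) ^ 2 * Real.log x := by positivity
    nlinarith
  · have h4 : y ≤ i / Real.log i := by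
      rw [hy, mul_one_div, div_div, div_le_div_iff₀ (by positivity) (by positivity)]
      have h5 : Real.log i ≤ 2 * (((d : ℝ) + 1) ^ 2 * Real.log x) := by
        nlinarith [mul_nonneg (by nlinarith : (0 : ℝ) ≤ ((d : ℝ) + 1) ^ 2 - 1) hlog.le]
      nlinarith
    have h6 : 1 ≤ i / Real.log i := by
      rw [one_le_div (by linarith)]
      exact (Real.log_le_sub_one_of_pos (by linarith)).trans (by linarith)
    linarith

theorem sampleSize_mono_of_ge (hm : 2 * (d + 1) < m + 1) :
    ∃ j₀, ∀ i j, j₀ ≤ j → j ≤ i → sampleSize d m j ≤ sampleSize d m i := by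
  have hD : (1 : ℝ) ≤ (d : ℝ) + 1 := by linarith [(Nat.cast_nonneg d : (0 : ℝ) ≤ d)]
  refine ⟨⌈Real.exp 1 * (2 * ((d : ℝ) + 1))⌉₊, fun i j hj hij => Nat.ceil_mono ?_⟩
  have hj' : Real.exp 1 * (2 * ((d : ℝ) + 1)) ≤ j := (Nat.le_ceil _).trans (by exact_mod_cast hj)
  have hij' : (j : ℝ) ≤ i := by exact_mod_cast hij
  have hm0 : (0 : ℝ) ≤ m := Nat.cast_nonneg m
  have hxj : Real.exp 1 ≤ ((m : ℝ) + j + 1) / (2 * ((d : ℝ) + 1)) := by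
    rw [le_div_iff₀ (by positivity)]; linarith
  have hxij : ((m : ℝ) + j + 1) / (2 * ((d : ℝ) + 1)) ≤ ((m : ℝ) + i + 1) / (2 * ((d : ℝ) + 1)) := by
    gcongr
  have hanti := Real.log_div_self_antitoneOn hxj (hxj.trans hxij : Real.exp 1 ≤ _) hxij
  have key : ∀ k : ℕ, ((m : ℝ) + k + 1) / (16 * ((d : ℝ) + 1) ^ 2) *
      (1 / Real.log (((m : ℝ) + k + 1) / (2 * ((d : ℝ) + 1)))) =
      1 / (8 * ((d : ℝ) + 1)) * (Real.log (((m : ℝ) + k + 1) / (2 * ((d : ℝ) + 1))) /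
        (((m : ℝ) + k + 1) / (2 * ((d : ℝ) + 1))))⁻¹ := by
    intro k
    rw [inv_div]
    field_simp
    norm_num
  rw [key, key]
  have hpos : 0 < Real.log (((m : ℝ) + i + 1) / (2 * ((d : ℝ) + 1))) /
      (((m : ℝ) + i + 1) / (2 * ((d : ℝ) + 1))) :=
    div_pos (Real.log_pos (one_lt_scaled hm i)) (by positivity)
  gcongr

section Abstract

variable {s : ℕ → ℕ} {c₁ c₂ : ℝ}

theorem GrowsLikeDivLog.isTheta (h : GrowsLikeDivLog s c₁ c₂) (hc₁ : 0 < c₁) :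
    (fun i : ℕ => (s i : ℝ)) =Θ[atTop] fun i : ℕ => (i : ℝ) / Real.log i := by
  constructor
  · refine IsBigO.of_bound c₂ ?_
    filter_upwards [h, eventually_log_natCast_ge 1] with i h1 h2
    rw [Real.norm_of_nonneg (Nat.cast_nonneg _), Real.norm_of_nonneg (by positivity)]
    exact h1.2
  · refine IsBigO.of_bound c₁⁻¹ ?_
    filter_upwards [h, eventually_log_natCast_ge 1] with i h1 h2
    rw [Real.norm_of_nonneg (Nat.cast_nonneg _), Real.norm_of_nonneg (by positivity),
      inv_mul_eq_div, le_div_iff₀ hc₁, mul_comm]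
    exact h1.1

/-- Sample sizes of rounds in `[i / 2, i]` are comparable. -/
theorem GrowsLikeDivLog.half (h : GrowsLikeDivLog s c₁ c₂) (hc₁ : 0 < c₁) :
    ∃ c > 0, ∀ᶠ i : ℕ in atTop, ∀ j, i ≤ 2 * j → j ≤ i → c * (s i : ℝ) ≤ s j := by
  obtain ⟨i₀, hi₀⟩ := eventually_atTop.mp h
  refine ⟨c₁ / (2 * max c₂ 1), by positivity, ?_⟩
  filter_upwards [h, eventually_log_natCast_ge 1, eventually_ge_atTop (2 * i₀ + 4)]
    with i h1 h2 h3 j h4 h5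
  have hj := (hi₀ j (by omega)).1
  refine le_trans ?_ hj
  have hlogj : 0 < Real.log j := Real.log_pos (by exact_mod_cast (by omega : 1 < j))
  have hlog : Real.log j ≤ Real.log i :=
    Real.log_le_log (by exact_mod_cast (by omega : 0 < j)) (by exact_mod_cast h5)
  have hij : (i : ℝ) ≤ 2 * j := by exact_mod_cast h4
  have h6 : (i : ℝ) / Real.log i ≤ 2 * (j / Real.log j) := by
    rw [← mul_div_assoc, div_le_div_iff₀ (by linarith) hlogj]
    nlinarith
  have h7 : (s i : ℝ) ≤ max c₂ 1 * (2 * (j / Real.log j)) :=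
    h1.2.trans (mul_le_mul (le_max_left _ _) h6 (by positivity) (by positivity))
  have hM : (0 : ℝ) < max c₂ 1 := by positivity
  calc c₁ / (2 * max c₂ 1) * (s i : ℝ)
      ≤ c₁ / (2 * max c₂ 1) * (max c₂ 1 * (2 * (j / Real.log j))) := by gcongr
    _ = _ := by field_simp

theorem roundStart_add_sum (s : ℕ → ℕ) {k i : ℕ} (h : k ≤ i) :
    roundStart s k + ∑ j ∈ Finset.Ico k i, s j = roundStart s i :=
  Finset.sum_range_add_sum_Ico s h

theorem GrowsLikeDivLog.mul_le_roundStart (h : GrowsLikeDivLog s c₁ c₂) (hc₁ : 0 < c₁) :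
    ∃ C > 0, ∀ᶠ i : ℕ in atTop, (i : ℝ) * s i ≤ C * roundStart s i := by
  obtain ⟨c, hc, hev⟩ := h.half hc₁
  refine ⟨4 / c, by positivity, ?_⟩
  filter_upwards [hev, eventually_ge_atTop 2] with i h1 h2
  have h3 : ∀ j ∈ Finset.Ico (i - i / 2) i, c * (s i : ℝ) ≤ s j := fun j hj => by
    rw [Finset.mem_Ico] at hj
    exact h1 j (by omega) (by omega)
  have h4 := Finset.card_nsmul_le_sum _ _ _ h3
  have h5 := roundStart_add_sum s (k := i - i / 2) (i := i) (by omega)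
  have h6 : (∑ j ∈ Finset.Ico (i - i / 2) i, (s j : ℝ)) ≤ roundStart s i := by
    rw [← h5]; push_cast
    linarith [(Nat.cast_nonneg (roundStart s (i - i / 2)) : (0 : ℝ) ≤ _)]
  rw [Nat.card_Ico, nsmul_eq_mul, show i - (i - i / 2) = i / 2 by omega] at h4
  have h7 : (i : ℝ) / 4 ≤ ((i / 2 : ℕ) : ℝ) := by
    rw [div_le_iff₀ (by norm_num)]
    exact_mod_cast (by omega : i ≤ i / 2 * 4)
  rw [div_mul_eq_mul_div, le_div_iff₀ hc]
  have h8 : 0 ≤ c * (s i : ℝ) := by positivity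
  nlinarith

theorem GrowsLikeDivLog.le_roundStart (h : GrowsLikeDivLog s c₁ c₂) (hc₁ : 0 < c₁) :
    ∃ c > 0, ∀ᶠ i : ℕ in atTop, c * ((i : ℝ) ^ 2 / Real.log i) ≤ roundStart s i := by
  obtain ⟨C, hC, hev⟩ := h.mul_le_roundStart hc₁
  refine ⟨c₁ / C, by positivity, ?_⟩
  filter_upwards [hev, h] with i h1 h2
  rw [div_mul_eq_mul_div, div_le_iff₀ hC]
  calc c₁ * ((i : ℝ) ^ 2 / Real.log i) = i * (c₁ * (i / Real.log i)) := by ring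
    _ ≤ i * s i := by gcongr; exact h2.1
    _ ≤ _ := by linarith

theorem roundStart_le_two_mul (hs : ∀ i, 0 < s i)
    (hmono : ∃ j₀, ∀ i j, j₀ ≤ j → j ≤ i → s j ≤ s i) :
    ∀ᶠ i : ℕ in atTop, roundStart s i ≤ 2 * (i * s i) := by
  obtain ⟨j₀, hj₀⟩ := hmono
  filter_upwards [eventually_ge_atTop j₀, eventually_ge_atTop (roundStart s j₀)] with i h1 h2
  have h3 := roundStart_add_sum s h1
  have h4 : ∑ j ∈ Finset.Ico j₀ i, s j ≤ ∑ j ∈ Finset.Ico j₀ i, s i :=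
    Finset.sum_le_sum fun j hj => by
      rw [Finset.mem_Ico] at hj
      exact hj₀ i j hj.1 hj.2.le
  rw [Finset.sum_const, Nat.card_Ico, smul_eq_mul] at h4
  have h5 : (i - j₀) * s i ≤ i * s i := Nat.mul_le_mul_right _ (Nat.sub_le _ _)
  have h6 : i ≤ i * s i := Nat.le_mul_of_pos_right _ (hs i)
  omega

theorem GrowsLikeDivLog.roundStart_le (h : GrowsLikeDivLog s c₁ c₂) (hs : ∀ i, 0 < s i)
    (hmono : ∃ j₀, ∀ i j, j₀ ≤ j → j ≤ i → s j ≤ s i) :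
    ∀ᶠ i : ℕ in atTop, (roundStart s i : ℝ) ≤ 2 * c₂ * ((i : ℝ) ^ 2 / Real.log i) := by
  filter_upwards [h, roundStart_le_two_mul hs hmono] with i h1 h2
  have h2' : (roundStart s i : ℝ) ≤ 2 * (i * s i) := by exact_mod_cast h2
  calc (roundStart s i : ℝ) ≤ 2 * (i * s i) := h2'
    _ ≤ 2 * (i * (c₂ * (i / Real.log i))) := by gcongr; exact h1.2
    _ = _ := by ring

theorem GrowsLikeDivLog.roundStart_succ_le (h : GrowsLikeDivLog s c₁ c₂) (hc₁ : 0 < c₁) :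
    ∀ᶠ i : ℕ in atTop, (roundStart s (i + 1) : ℝ) ≤ 2 * roundStart s i := by
  obtain ⟨C, hC, hev⟩ := h.mul_le_roundStart hc₁
  filter_upwards [hev, eventually_natCast_ge C] with i h1 h2
  rw [roundStart_succ]
  push_cast
  have : C * (s i : ℝ) ≤ C * roundStart s i :=
    (mul_le_mul_of_nonneg_right h2 (Nat.cast_nonneg _)).trans h1
  linarith [le_of_mul_le_mul_left this hC]

theorem GrowsLikeDivLog.roundStart_mul_log_le (h : GrowsLikeDivLog s c₁ c₂) (hc₁ : 0 < c₁)
    (hs : ∀ i, 0 < s i) (hmono : ∃ j₀, ∀ i j, j₀ ≤ j → j ≤ i → s j ≤ s i) :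
    ∃ C, ∀ᶠ i : ℕ in atTop,
      (roundStart s (i + 1) : ℝ) * Real.log (roundStart s (i + 1)) ≤ C * (i : ℝ) ^ 2 := by
  refine ⟨4 * c₂ * 3, ?_⟩
  filter_upwards [h.roundStart_succ_le hc₁, h.roundStart_le hs hmono,
    eventually_log_natCast_ge 1, eventually_natCast_ge (4 * c₂), eventually_natCast_ge 1]
    with i h1 h2 h3 h4 h5
  have h6 : (roundStart s (i + 1) : ℝ) ≤ 4 * c₂ * ((i : ℝ) ^ 2 / Real.log i) := by linarith
  have h7 : (0 : ℝ) < roundStart s (i + 1) := by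
    have := AsyncSGD.le_roundStart hs (i + 1)
    exact_mod_cast (by omega : 0 < roundStart s (i + 1))
  have h8 : (roundStart s (i + 1) : ℝ) ≤ (i : ℝ) ^ 3 := by
    refine h6.trans ?_
    calc 4 * c₂ * ((i : ℝ) ^ 2 / Real.log i) ≤ i * ((i : ℝ) ^ 2 / 1) := by gcongr
      _ = _ := by ring
  have h9 : Real.log (roundStart s (i + 1)) ≤ 3 * Real.log i := by
    have := Real.log_le_log h7 h8
    rwa [Real.log_pow, Nat.cast_ofNat] at this
  calc (roundStart s (i + 1) : ℝ) * Real.log (roundStart s (i + 1))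
      ≤ roundStart s (i + 1) * (3 * Real.log i) := by gcongr
    _ ≤ 4 * c₂ * ((i : ℝ) ^ 2 / Real.log i) * (3 * Real.log i) := by
        gcongr
    _ = _ := by field_simp

/-- Geometric decay in the sample size beats every power of the round number. -/
theorem GrowsLikeDivLog.tendsto_rpow_mul_pow (h : GrowsLikeDivLog s c₁ c₂) (hc₁ : 0 < c₁)
    {ρ : ℝ} (hρ0 : 0 ≤ ρ) (hρ : ρ < 1) (b : ℝ) :
    Tendsto (fun i : ℕ => (i : ℝ) ^ b * ρ ^ (s i)) atTop (nhds 0) := by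
  rcases hρ0.eq_or_lt with rfl | hρ0
  · refine tendsto_const_nhds.congr' ?_
    filter_upwards [h, eventually_log_natCast_ge 1, eventually_natCast_ge 1] with i h1 h2 h3
    have : 0 < (s i : ℝ) := lt_of_lt_of_le (by positivity) h1.1
    rw [zero_pow (by exact_mod_cast this.ne'), mul_zero]
  have hκ : 0 < -Real.log ρ := neg_pos.mpr (Real.log_neg hρ0 hρ)
  have hlim : Tendsto (fun i : ℕ => Real.exp (-Real.log i)) atTop (nhds 0) :=
    Real.tendsto_exp_neg_atTop_nhds_zero.comp
      (Real.tendsto_log_atTop.comp tendsto_natCast_atTop_atTop)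
  have hsmall : ∀ᶠ i : ℕ in atTop,
      (|b| + 1) * Real.log i ^ 2 ≤ -Real.log ρ * c₁ * i := by
    have h1 := (Real.isLittleO_pow_log_id_atTop (n := 2)).comp_tendsto
      (tendsto_natCast_atTop_atTop (R := ℝ))
    have h2 := h1.bound (c := -Real.log ρ * c₁ / (|b| + 1)) (by positivity)
    filter_upwards [h2] with i hi
    simp only [Function.comp, id, Real.norm_eq_abs, abs_pow, sq_abs, Nat.abs_cast] at hi
    rw [div_mul_eq_mul_div, le_div_iff₀ (by positivity)] at hi
    linarith
  refine squeeze_zero' (Eventually.of_forall fun i => by positivity) ?_ hlim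
  filter_upwards [h, hsmall, eventually_log_natCast_ge 1, eventually_natCast_ge 1]
    with i h1 h2 h3 h4
  rw [Real.rpow_def_of_pos (by linarith), ← Real.rpow_natCast ρ, Real.rpow_def_of_pos hρ0,
    ← Real.exp_add]
  refine Real.exp_le_exp.mpr ?_
  have h5 : (|b| + 1) * Real.log i ≤ -Real.log ρ * (c₁ * (i / Real.log i)) := by
    rw [show -Real.log ρ * (c₁ * (i / Real.log i)) = -Real.log ρ * c₁ * i / Real.log i by ring,
      le_div_iff₀ (by linarith)]
    linarith
  have h6 : -Real.log ρ * (c₁ * (i / Real.log i)) ≤ -Real.log ρ * s i :=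
    mul_le_mul_of_nonneg_left h1.1 hκ.le
  have h7 : Real.log i * b ≤ |b| * Real.log i := by
    rw [mul_comm]; exact mul_le_mul_of_nonneg_right (le_abs_self b) (by linarith)
  linarith

end Abstract

/-! #### Delays -/

variable {L μ : ℝ}

theorem two_le_delayConst : 2 ≤ delayConst d m L μ := by
  have : (d : ℝ) + 2 ≤ delayConst d m L μ := (le_max_left _ _).trans (le_max_left _ _)
  linarith [(Nat.cast_nonneg d : (0 : ℝ) ≤ d)]

theorem two_le_offset (hm : 2 * (d + 1) < m + 1) : 2 ≤ ((m : ℝ) + 1) ^ 2 / 4 := by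
  have : (2 : ℝ) ≤ m := by exact_mod_cast (by omega : 2 ≤ m)
  nlinarith

/-- The waiting rule bounds the staleness by a constant number of rounds, since the permissible
delay is of the order of the size of a single round. -/
theorem exists_staleness_bound (hm : 2 * (d + 1) < m + 1) (L μ : ℝ) :
    ∃ Q : ℕ, ∀ k i r : ℕ, 0 < r → r ≤ sampleSize d m i →
      (∑ j ∈ Finset.Icc k i, (sampleSize d m j : ℝ)) - r ≤
        delay d m L μ ((∑ j ∈ Finset.range (i + 1), (sampleSize d m j : ℝ)) - r - 1) →
      i ≤ k + Q := by
  have hs := sampleSize_pos hm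
  have hg := growsLikeDivLog_sampleSize hm
  have hc₁ : (0 : ℝ) < 1 / (32 * ((d : ℝ) + 1) ^ 2) := by positivity
  set s := sampleSize d m with hsdef
  set c₁ : ℝ := 1 / (32 * ((d : ℝ) + 1) ^ 2) with hc₁def
  set M₀ : ℝ := ((m : ℝ) + 1) ^ 2 / 4 with hM₀def
  have hM₀ : 2 ≤ M₀ := two_le_offset hm
  set M₁ : ℝ := delayConst d m L μ with hM₁def
  have hM₁ : 2 ≤ M₁ := two_le_delayConst
  obtain ⟨c, hc, hhalf⟩ := hg.half hc₁
  -- the permissible delay is at most a multiple of the current sample size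
  set K : ℝ := M₁ + √(9 / c₁ ^ 2) with hKdef
  have hK : 0 < K := by positivity
  have hdelay : ∀ᶠ i : ℕ in atTop, ∀ x : ℝ, (roundStart s i : ℝ) - 1 ≤ x →
      x ≤ roundStart s (i + 1) → delay d m L μ x ≤ K * s i := by
    filter_upwards [hg, hg.roundStart_succ_le hc₁,
      hg.roundStart_le hs (sampleSize_mono_of_ge hm),
      eventually_log_natCast_ge 1, eventually_natCast_ge M₀] with i h1 h2 h3 h4 h5 x hx1 hx2
    have hsi : (1 : ℝ) ≤ s i := by exact_mod_cast hs i
    have hi : (i : ℝ) ≤ roundStart s i := by exact_mod_cast le_roundStart hs i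
    have hi1 : (2 : ℝ) ≤ i := by linarith
    have hx3 : (i : ℝ) ≤ x + M₀ := by linarith
    have hlog : Real.log i ≤ Real.log (x + M₀) := Real.log_le_log (by linarith) hx3
    have hii : (i : ℝ) ≤ (i : ℝ) ^ 2 / Real.log i := by
      rw [le_div_iff₀ (by linarith), sq]
      exact mul_le_mul_of_nonneg_left
        ((Real.log_le_sub_one_of_pos (by linarith)).trans (by linarith)) (by linarith)
    have hup : x + M₀ ≤ 9 * ((i : ℝ) ^ 2 / Real.log i) := by linarith
    have hquot : (x + M₀) / (4 * Real.log (x + M₀)) ≤ 9 / c₁ ^ 2 * (s i : ℝ) ^ 2 := by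
      have h6 : (c₁ * (i / Real.log i)) ^ 2 ≤ (s i : ℝ) ^ 2 :=
        pow_le_pow_left₀ (by positivity) h1.1 2
      calc (x + M₀) / (4 * Real.log (x + M₀))
          ≤ 9 * ((i : ℝ) ^ 2 / Real.log i) / (1 * Real.log i) := by gcongr; norm_num
        _ = 9 / c₁ ^ 2 * (c₁ * (i / Real.log i)) ^ 2 := by field_simp
        _ ≤ _ := by gcongr
    have hsqrt : √((x + M₀) / (4 * Real.log (x + M₀))) ≤ √(9 / c₁ ^ 2) * s i := by
      refine (Real.sqrt_le_sqrt hquot).trans ?_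
      rw [Real.sqrt_mul (by positivity), Real.sqrt_sq (by positivity)]
    rw [delay, hKdef, add_mul]
    have : M₁ ≤ M₁ * s i := le_mul_of_one_le_right (by linarith) hsi
    exact add_le_add this hsqrt
  set Q' : ℕ := ⌈K / c⌉₊ + 1 with hQ'
  have hQ'c : K < Q' * c := by
    have h1 : K / c ≤ ⌈K / c⌉₊ := Nat.le_ceil _
    rw [div_le_iff₀ hc] at h1
    rw [hQ']; push_cast; linarith
  obtain ⟨i₁, hi₁⟩ := eventually_atTop.mp
    ((hhalf.and hdelay).and (eventually_ge_atTop (2 * Q' + 2)))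
  refine ⟨max Q' i₁, fun k i r hr hr' hgate => ?_⟩
  by_contra hcon
  push Not at hcon
  have hiQ : k + Q' < i := lt_of_le_of_lt (by gcongr; exact le_max_left _ _) hcon
  have hii : i₁ ≤ i := le_of_lt (lt_of_le_of_lt ((le_max_right Q' i₁).trans (Nat.le_add_left _ _)) hcon)
  obtain ⟨⟨h1, h2⟩, h3⟩ := hi₁ i hii
  have hrs : (r : ℝ) ≤ s i := by exact_mod_cast hr'
  have hr1 : (1 : ℝ) ≤ r := by exact_mod_cast hr
  have hsum : (∑ j ∈ Finset.range (i + 1), (s j : ℝ)) = roundStart s i + s i := by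
    rw [Finset.sum_range_succ, roundStart]; push_cast; rfl
  have hsum' : (roundStart s (i + 1) : ℝ) = roundStart s i + s i := by
    rw [roundStart_succ]; push_cast; rfl
  have h4 := h2 ((∑ j ∈ Finset.range (i + 1), (s j : ℝ)) - r - 1)
    (by rw [hsum]; linarith) (by rw [hsum, hsum']; linarith)
  have h5 : ∑ j ∈ Finset.Ico (i - Q') i, (s j : ℝ) + s i ≤ ∑ j ∈ Finset.Icc k i, (s j : ℝ) := by
    rw [← Finset.sum_Ico_succ_top (by omega : i - Q' ≤ i)]
    refine Finset.sum_le_sum_of_subset_of_nonneg ?_ fun _ _ _ => Nat.cast_nonneg _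
    intro j hj
    rw [Finset.mem_Ico] at hj
    rw [Finset.mem_Icc]
    omega
  have h6 : ∀ j ∈ Finset.Ico (i - Q') i, c * (s i : ℝ) ≤ s j := fun j hj => by
    rw [Finset.mem_Ico] at hj
    exact h1 j (by omega) (by omega)
  have h7 := Finset.card_nsmul_le_sum _ _ _ h6
  rw [Nat.card_Ico, nsmul_eq_mul, show i - (i - Q') = Q' by omega] at h7
  have h8 : (0 : ℝ) < s i := by exact_mod_cast hs i
  nlinarith

/-! #### Step sizes -/

theorem roundStep_pos (hμ : 0 < μ) (i : ℕ) : 0 < roundStep d m L μ i := by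
  have h := two_le_delayConst (d := d) (m := m) (L := L) (μ := μ)
  rw [roundStep]
  have : (0 : ℝ) ≤ roundStart (sampleSize d m) i := Nat.cast_nonneg _
  positivity

theorem roundStep_mul_le (hμ : 0 < μ) (i : ℕ) :
    roundStep d m L μ i * roundStart (sampleSize d m) i ≤ 12 / μ := by
  have h := two_le_delayConst (d := d) (m := m) (L := L) (μ := μ)
  have h0 : (0 : ℝ) ≤ roundStart (sampleSize d m) i := Nat.cast_nonneg _
  rw [roundStep, mul_assoc, one_div_mul_eq_div]
  refine mul_le_of_le_one_right (by positivity) (div_le_one_of_le₀ ?_ (by positivity))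
  have := Real.sqrt_nonneg ((((m : ℝ) + 1) ^ 2 / 4 + roundStart (sampleSize d m) i) /
      Real.log (((m : ℝ) + 1) ^ 2 / 4 + roundStart (sampleSize d m) i))
  linarith

theorem tendsto_roundStart {s : ℕ → ℕ} (hs : ∀ i, 0 < s i) :
    Tendsto (fun i => (roundStart s i : ℝ)) atTop atTop :=
  tendsto_natCast_atTop_atTop.comp (roundStart_strictMono hs).tendsto_atTop

/-- The step sizes are asymptotic to `12 / (μ S_i)`: the other terms in the denominator are of lower
order than the number `S_i` of preceding evaluations. -/
theorem eventually_le_roundStep_mul (hm : 2 * (d + 1) < m + 1) (hμ : 0 < μ) :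
    ∀ᶠ i : ℕ in atTop, 11 / μ ≤ roundStep d m L μ i * roundStart (sampleSize d m) i := by
  have hM₁ := two_le_delayConst (d := d) (m := m) (L := L) (μ := μ)
  have hM₀ := two_le_offset hm
  set M₁ := delayConst d m L μ with hM₁def
  set M₀ := ((m : ℝ) + 1) ^ 2 / 4 with hM₀def
  have hexp := tendsto_roundStart (sampleSize_pos hm)
  filter_upwards [hexp.eventually_ge_atTop (48 * M₁), hexp.eventually_ge_atTop M₀,
    hexp.eventually_ge_atTop (Real.exp 1), hexp.eventually_ge_atTop (48 ^ 2 * 2)] with i h1 h2 h3 h4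
  set x : ℝ := (roundStart (sampleSize d m) i : ℝ) with hx
  have hlog : 1 ≤ Real.log (M₀ + x) := by
    rw [Real.le_log_iff_exp_le (by linarith)]; linarith
  have hsqrt : √((M₀ + x) / Real.log (M₀ + x)) ≤ x / 48 := by
    rw [Real.sqrt_le_left (by linarith)]
    calc (M₀ + x) / Real.log (M₀ + x) ≤ (M₀ + x) / 1 := by gcongr
      _ ≤ (x / 48) ^ 2 := by nlinarith
  have hroot := Real.sqrt_nonneg ((M₀ + x) / Real.log (M₀ + x))
  rw [roundStep, ← hM₁def, ← hM₀def, ← hx, mul_assoc, one_div_mul_eq_div, div_mul_div_comm,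
    div_le_div_iff₀ hμ (by nlinarith)]
  have : 11 * (x + 2 * M₁ + √((M₀ + x) / Real.log (M₀ + x))) ≤ 12 * x := by linarith
  nlinarith

theorem isBigO_roundStep (hm : 2 * (d + 1) < m + 1) (hμ : 0 < μ) :
    roundStep d m L μ =O[atTop] fun i : ℕ => Real.log i / (i : ℝ) ^ 2 := by
  obtain ⟨c, hc, hev⟩ := (growsLikeDivLog_sampleSize hm).le_roundStart (by positivity)
  refine IsBigO.of_bound (12 / μ / c) ?_
  filter_upwards [hev, eventually_log_natCast_ge 1, eventually_natCast_ge 1] with i h1 h2 h3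
  rw [Real.norm_of_nonneg (roundStep_pos hμ i).le, Real.norm_of_nonneg (by positivity)]
  have h4 := roundStep_mul_le (d := d) (m := m) (L := L) hμ i
  have h5 : roundStep d m L μ i * (c * ((i : ℝ) ^ 2 / Real.log i)) ≤ 12 / μ :=
    (mul_le_mul_of_nonneg_left h1 (roundStep_pos hμ i).le).trans h4
  rw [div_mul_eq_mul_div, le_div_iff₀ hc, ← div_le_iff₀ (by positivity)]
  rw [← mul_assoc, ← le_div_iff₀ (by positivity)] at h5
  rw [div_le_iff₀ (by positivity)]
  calc roundStep d m L μ i * c ≤ _ := h5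
    _ = _ := by field_simp

end Growth

/-- The staleness bound for the concrete algorithm. One constant serves all losses and all
initial models. -/
theorem roundGate_algorithm {d m : ℕ} (hm : 2 * (d + 1) < m + 1) (L μ : ℝ) :
    ∃ Q, ∀ {q : ℕ} {Ξ : Type*} (f : EuclideanSpace ℝ (Fin q) → Ξ → ℝ)
      (w₀ : EuclideanSpace ℝ (Fin q)), RoundGate (algorithm d m L μ f w₀) Q := by
  obtain ⟨Q, hQ⟩ := exists_staleness_bound hm L μ
  refine ⟨Q, fun f w₀ N h1 h2 h3 => ?_⟩
  have h4 : ((N.quota - N.count : ℕ) : ℝ) = (N.quota : ℝ) - N.count := Nat.cast_sub h1.le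
  refine hQ N.version N.round (N.quota - N.count) (by omega) ((Nat.sub_le _ _).trans h2) ?_
  rw [h4]
  exact not_lt.mp h3

/-! ### Pathwise estimates -/

section Pathwise

/-- A discrete Grönwall inequality along the order given by `T`. -/
theorem add_sum_le_mul_prod (S : Finset ℕ) (T : ℕ → ℕ) (b x : ℕ → ℝ) (a : ℝ)
    (hb : ∀ u ∈ S, 0 ≤ b u) (hx0 : ∀ u ∈ S, 0 ≤ x u)
    (hx : ∀ u ∈ S, x u ≤ a + ∑ v ∈ S with T v < T u, b v * x v) :
    a + ∑ u ∈ S, b u * x u ≤ a * ∏ u ∈ S, (1 + b u) := by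
  classical
  induction S using Finset.induction_on_max_value T with
  | empty => simp
  | insert u S hu hmax ih =>
    have hfilter : ∀ w ∈ S, (insert u S).filter (fun v => T v < T w) = S.filter fun v => T v < T w :=
      fun w hw => by rw [Finset.filter_insert, if_neg (not_lt.mpr (hmax w hw))]
    have ih' := ih (fun w hw => hb w (Finset.mem_insert_of_mem hw))
      (fun w hw => hx0 w (Finset.mem_insert_of_mem hw))
      (fun w hw => by rw [← hfilter w hw]; exact hx w (Finset.mem_insert_of_mem hw))
    have hbu := hb u (Finset.mem_insert_self u S)
    have hxu : x u ≤ a + ∑ v ∈ S, b v * x v := by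
      refine (hx u (Finset.mem_insert_self u S)).trans (add_le_add le_rfl ?_)
      rw [Finset.filter_insert, if_neg (lt_irrefl _)]
      exact Finset.sum_le_sum_of_subset_of_nonneg
        (Finset.filter_subset (fun v => T v < T u) S) fun v hv _ =>
        mul_nonneg (hb v (Finset.mem_insert_of_mem hv)) (hx0 v (Finset.mem_insert_of_mem hv))
    rw [Finset.sum_insert hu, Finset.prod_insert hu]
    calc a + (b u * x u + ∑ v ∈ S, b v * x v)
        ≤ (1 + b u) * (a + ∑ v ∈ S, b v * x v) := by nlinarith
      _ ≤ (1 + b u) * (a * ∏ v ∈ S, (1 + b v)) := by gcongr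
      _ = _ := by ring

theorem prod_one_add_le_exp (S : Finset ℕ) (b : ℕ → ℝ) (hb : ∀ u ∈ S, 0 ≤ b u) :
    ∏ u ∈ S, (1 + b u) ≤ Real.exp (∑ u ∈ S, b u) := by
  rw [Real.exp_sum]
  exact Finset.prod_le_prod (fun u hu => by linarith [hb u hu])
    fun u _ => by linarith [Real.add_one_le_exp (b u)]

variable {E : Type*} [NormedAddCommGroup E] [NormedSpace ℝ E]

/-- The iterates `w₀ - ∑_{u < t} η_u g_u`. -/
def partialIterate (s : ℕ → ℕ) (step : ℕ → ℝ) (w₀ : E) (g : ℕ → E) (t : ℕ) : E :=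
  w₀ - ∑ u ∈ Finset.range t, step (roundOf s u) • g u

variable {s : ℕ → ℕ} {Q : ℕ} {step : ℕ → ℝ} {w₀ wstar : E} {x g : ℕ → E} {ν : ℕ → ℝ} {L : ℝ}

theorem partialIterate_sub {t t' : ℕ} (h : t ≤ t') :
    partialIterate s step w₀ g t' = partialIterate s step w₀ g t -
      ∑ u ∈ Finset.Ico t t', step (roundOf s u) • g u := by
  rw [partialIterate, partialIterate, sub_sub, Finset.sum_range_add_sum_Ico _ h]

theorem norm_sum_smul_le (hstep : ∀ i, 0 ≤ step i) (hg : ∀ u, ‖g u‖ ≤ ν u + L * ‖x u - wstar‖)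
    (S : Finset ℕ) : ‖∑ u ∈ S, step (roundOf s u) • g u‖ ≤
      ∑ u ∈ S, step (roundOf s u) * (ν u + L * ‖x u - wstar‖) := by
  refine (norm_sum_le _ _).trans (Finset.sum_le_sum fun u _ => ?_)
  rw [norm_smul, Real.norm_of_nonneg (hstep _)]
  exact mul_le_mul_of_nonneg_left (hg u) (hstep _)

/-- The distance of a local model of round `k ≥ i` to the iterate at the beginning of round `i`. -/
theorem BoundedStaleness.norm_sub_le (h : BoundedStaleness s Q step w₀ x g) (hs : ∀ i, 0 < s i)
    (hstep : ∀ i, 0 ≤ step i) (hL : 0 ≤ L) (hν : ∀ u, 0 ≤ ν u)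
    (hg : ∀ u, ‖g u‖ ≤ ν u + L * ‖x u - wstar‖) {i k t : ℕ} (hik : i ≤ k) (ht : roundOf s t = k)
    {q : ℝ} (hq : q = ∑ u ∈ Finset.Ico (roundStart s (i - Q)) (roundStart s i),
        step (roundOf s u) * (ν u + L * ‖x u - wstar‖) +
      ∑ u ∈ Finset.Ico (roundStart s i) (roundStart s (k + Q + 1)), step (roundOf s u) * ν u) :
    ‖x t - partialIterate s step w₀ g (roundStart s i)‖ ≤ q +
      (‖partialIterate s step w₀ g (roundStart s i) - wstar‖ + q) *
        (Real.exp (L * ∑ u ∈ Finset.Ico (roundStart s i) (roundStart s (k + Q + 1)),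
          step (roundOf s u)) - 1) := by
  classical
  obtain ⟨T, R, hTR⟩ := h
  set η : ℕ → ℝ := fun u => step (roundOf s u) with hη
  have hη0 : ∀ u, 0 ≤ η u := fun u => hstep _
  set W := partialIterate s step w₀ g (roundStart s i) with hW
  set I := Finset.Ico (roundStart s i) (roundStart s (k + Q + 1)) with hI
  have hnn : ∀ u, 0 ≤ η u * (ν u + L * ‖x u - wstar‖) := fun u =>
    mul_nonneg (hη0 u) (add_nonneg (hν u) (by positivity))
  -- every local model is close to `W`, up to gradients of the window evaluated before
  have hmain : ∀ u, i ≤ roundOf s u → T u ≤ T t →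
      ‖x u - W‖ ≤ q + ∑ v ∈ I with T v < T u, (L * η v) * ‖x v - wstar‖ := by
    intro u hu hTu
    obtain ⟨hxu, hR1, hR2, -⟩ := hTR u
    have hxW : x u - W = ∑ v ∈ Finset.range (roundStart s i) \ R u, η v • g v -
        ∑ v ∈ R u \ Finset.range (roundStart s i), η v • g v := by
      rw [Finset.sum_sdiff_sub_sum_sdiff, hxu, hW, partialIterate]
      abel
    have hsub1 : Finset.range (roundStart s i) \ R u ⊆
        Finset.Ico (roundStart s (i - Q)) (roundStart s i) := by
      intro v hv
      rw [Finset.mem_sdiff, Finset.mem_range] at hv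
      rw [Finset.mem_Ico]
      refine ⟨?_, hv.1⟩
      by_contra hcon
      rw [not_le, ← roundOf_lt_iff hs] at hcon
      exact hv.2 (hR2 v (by omega))
    have hsub2 : R u \ Finset.range (roundStart s i) ⊆ I.filter fun v => T v < T u := by
      intro v hv
      rw [Finset.mem_sdiff, Finset.mem_range, not_lt] at hv
      have hv1 := hR1 v hv.1
      have hv2 := (hTR t).2.2.2 v (hv1.trans_le hTu)
      rw [Finset.mem_filter, hI, Finset.mem_Ico]
      exact ⟨⟨hv.2, (roundOf_lt_iff hs).mp (by omega)⟩, hv1⟩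
    have hsplit : ∑ v ∈ I with T v < T u, η v * (ν v + L * ‖x v - wstar‖) ≤
        ∑ v ∈ I, η v * ν v + ∑ v ∈ I with T v < T u, (L * η v) * ‖x v - wstar‖ := by
      have h1 : ∑ v ∈ I with T v < T u, η v * ν v ≤ ∑ v ∈ I, η v * ν v :=
        Finset.sum_le_sum_of_subset_of_nonneg (Finset.filter_subset _ _)
          fun v _ _ => mul_nonneg (hη0 v) (hν v)
      have h2 : ∑ v ∈ I with T v < T u, η v * (ν v + L * ‖x v - wstar‖) =
          ∑ v ∈ I with T v < T u, η v * ν v +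
            ∑ v ∈ I with T v < T u, (L * η v) * ‖x v - wstar‖ := by
        rw [← Finset.sum_add_distrib]
        exact Finset.sum_congr rfl fun v _ => by ring
      linarith
    rw [hxW]
    calc _ ≤ ‖∑ v ∈ Finset.range (roundStart s i) \ R u, η v • g v‖ +
          ‖∑ v ∈ R u \ Finset.range (roundStart s i), η v • g v‖ := _root_.norm_sub_le _ _
      _ ≤ ∑ v ∈ Finset.range (roundStart s i) \ R u, η v * (ν v + L * ‖x v - wstar‖) +
          ∑ v ∈ R u \ Finset.range (roundStart s i), η v * (ν v + L * ‖x v - wstar‖) :=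
        add_le_add (norm_sum_smul_le hstep hg _) (norm_sum_smul_le hstep hg _)
      _ ≤ ∑ v ∈ Finset.Ico (roundStart s (i - Q)) (roundStart s i),
            η v * (ν v + L * ‖x v - wstar‖) +
          ∑ v ∈ I with T v < T u, η v * (ν v + L * ‖x v - wstar‖) :=
        add_le_add (Finset.sum_le_sum_of_subset_of_nonneg hsub1 fun v _ _ => hnn v)
          (Finset.sum_le_sum_of_subset_of_nonneg hsub2 fun v _ _ => hnn v)
      _ ≤ _ := by rw [hq]; linarith
  -- the Grönwall inequality for the evaluations before `t`
  have hq0 : 0 ≤ q := by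
    rw [hq]
    exact add_nonneg (Finset.sum_nonneg fun u _ => hnn u)
      (Finset.sum_nonneg fun u _ => mul_nonneg (hη0 u) (hν u))
  have hgron := add_sum_le_mul_prod (I.filter fun v => T v < T t) T (fun v => L * η v)
    (fun v => ‖x v - wstar‖) (‖W - wstar‖ + q) (fun u _ => mul_nonneg hL (hη0 u))
    (fun u _ => norm_nonneg _) (by
      intro u hu
      rw [Finset.mem_filter, hI, Finset.mem_Ico] at hu
      have h1 := hmain u ((le_roundOf_iff hs).mpr hu.1.1) hu.2.le
      have h2 : ((I.filter fun v => T v < T t).filter fun v => T v < T u) =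
          I.filter fun v => T v < T u := by
        rw [Finset.filter_filter]
        refine Finset.filter_congr fun v _ => ⟨fun h => h.2, fun h => ⟨h.trans hu.2, h⟩⟩
      rw [h2]
      have h3 : ‖x u - wstar‖ ≤ ‖x u - W‖ + ‖W - wstar‖ := norm_sub_le_norm_sub_add_norm_sub _ _ _
      linarith)
  have hprod : ∏ v ∈ I with T v < T t, (1 + L * η v) ≤ Real.exp (L * ∑ u ∈ I, η u) := by
    refine (prod_one_add_le_exp _ _ fun u _ => mul_nonneg hL (hη0 u)).trans ?_
    rw [Real.exp_le_exp, Finset.mul_sum]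
    exact Finset.sum_le_sum_of_subset_of_nonneg (Finset.filter_subset _ _)
      fun v _ _ => mul_nonneg hL (hη0 v)
  have hmul := mul_le_mul_of_nonneg_left hprod (add_nonneg (norm_nonneg (W - wstar)) hq0)
  have := hmain t (by rw [ht]; exact hik) le_rfl
  linarith

/-- Crude bounds for all models up to round `k`. -/
theorem BoundedStaleness.crude (h : BoundedStaleness s Q step w₀ x g) (hs : ∀ i, 0 < s i)
    (hstep : ∀ i, 0 ≤ step i) (hL : 0 ≤ L) (hν : ∀ u, 0 ≤ ν u)
    (hg : ∀ u, ‖g u‖ ≤ ν u + L * ‖x u - wstar‖) (k : ℕ) {Z β : ℝ}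
    (hβ : β = ∑ u ∈ Finset.range (roundStart s (k + Q + 1)), step (roundOf s u))
    (hZ : Z = (‖w₀ - wstar‖ + ∑ u ∈ Finset.range (roundStart s (k + Q + 1)),
      step (roundOf s u) * ν u) * Real.exp (2 * L * β)) :
    (∀ t, roundOf s t ≤ k → ‖x t - wstar‖ ≤ Z) ∧
      ∀ t ≤ roundStart s (k + 1), ‖partialIterate s step w₀ g t - wstar‖ ≤ Z := by
  set a := ‖w₀ - wstar‖ + ∑ u ∈ Finset.range (roundStart s (k + Q + 1)),
      step (roundOf s u) * ν u with ha
  have hstep' : ∀ u, 0 ≤ step (roundOf s u) := fun u => hstep _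
  have hsum0 : 0 ≤ ∑ u ∈ Finset.range (roundStart s (k + Q + 1)), step (roundOf s u) * ν u :=
    Finset.sum_nonneg fun u _ => mul_nonneg (hstep' u) (hν u)
  have ha0 : 0 ≤ a := by positivity
  have hβ0 : 0 ≤ β := by rw [hβ]; exact Finset.sum_nonneg fun u _ => hstep' u
  have hx : ∀ t, roundOf s t ≤ k → ‖x t - wstar‖ ≤ a * Real.exp (L * β) := by
    intro t ht
    have h1 := h.norm_sub_le hs hstep hL hν hg (i := 0) (Nat.zero_le (roundOf s t)) rfl rfl
    simp only [Nat.zero_sub, Finset.Ico_self, Finset.sum_empty, zero_add, roundStart_zero,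
      partialIterate, Finset.range_zero, sub_zero, Nat.Ico_zero_eq_range] at h1
    have hmono : roundStart s (roundOf s t + Q + 1) ≤ roundStart s (k + Q + 1) :=
      roundStart_mono s (by omega)
    have hsub := Finset.range_subset_range.mpr hmono
    have h2 : ∑ u ∈ Finset.range (roundStart s (roundOf s t + Q + 1)), step (roundOf s u) * ν u ≤
        ∑ u ∈ Finset.range (roundStart s (k + Q + 1)), step (roundOf s u) * ν u :=
      Finset.sum_le_sum_of_subset_of_nonneg hsub fun u _ _ => mul_nonneg (hstep' u) (hν u)
    have h3 : ∑ u ∈ Finset.range (roundStart s (roundOf s t + Q + 1)), step (roundOf s u) ≤ β := by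
      rw [hβ]
      exact Finset.sum_le_sum_of_subset_of_nonneg hsub fun u _ _ => hstep' u
    have h4 : Real.exp (L * ∑ u ∈ Finset.range (roundStart s (roundOf s t + Q + 1)),
        step (roundOf s u)) ≤ Real.exp (L * β) := by gcongr
    have h5 : ‖x t - wstar‖ ≤ ‖x t - w₀‖ + ‖w₀ - wstar‖ := norm_sub_le_norm_sub_add_norm_sub _ _ _
    have h6 := mul_le_mul (add_le_add (le_refl ‖w₀ - wstar‖) h2) h4 (Real.exp_nonneg _) ha0
    linarith
  have hexp1 : 1 ≤ Real.exp (L * β) := Real.one_le_exp (by positivity)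
  have hexp2 : Real.exp (2 * L * β) = Real.exp (L * β) * Real.exp (L * β) := by
    rw [← Real.exp_add]; ring_nf
  have haexp : a ≤ a * Real.exp (L * β) := le_mul_of_one_le_right ha0 hexp1
  refine ⟨fun t ht => (hx t ht).trans ?_, fun t ht => ?_⟩
  · rw [hZ, hexp2, ← mul_assoc]
    exact le_mul_of_one_le_right (by positivity) hexp1
  · have h1 : ‖∑ u ∈ Finset.range t, step (roundOf s u) • g u‖ ≤
        ∑ u ∈ Finset.range t, step (roundOf s u) * (ν u + L * (a * Real.exp (L * β))) := by
      refine (norm_sum_smul_le hstep hg _).trans (Finset.sum_le_sum fun u hu => ?_)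
      have hu' : roundOf s u < k + 1 :=
        (roundOf_lt_iff hs).mpr ((Finset.mem_range.mp hu).trans_le ht)
      have := hx u (by omega)
      have := hstep' u
      gcongr
    have hsub : Finset.range t ⊆ Finset.range (roundStart s (k + Q + 1)) :=
      Finset.range_subset_range.mpr (ht.trans (roundStart_mono s (by omega)))
    have h2 : ∑ u ∈ Finset.range t, step (roundOf s u) * (ν u + L * (a * Real.exp (L * β))) ≤
        ∑ u ∈ Finset.range (roundStart s (k + Q + 1)),
          step (roundOf s u) * (ν u + L * (a * Real.exp (L * β))) :=
      Finset.sum_le_sum_of_subset_of_nonneg hsub fun u _ _ =>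
        mul_nonneg (hstep' u) (add_nonneg (hν u) (by positivity))
    have h3 : ∑ u ∈ Finset.range (roundStart s (k + Q + 1)),
        step (roundOf s u) * (ν u + L * (a * Real.exp (L * β))) =
        (a - ‖w₀ - wstar‖) + β * (L * (a * Real.exp (L * β))) := by
      simp only [mul_add, Finset.sum_add_distrib, ← Finset.sum_mul, ← hβ]
      rw [ha]; ring
    have h4 : ‖partialIterate s step w₀ g t - wstar‖ ≤ ‖w₀ - wstar‖ +
        ‖∑ u ∈ Finset.range t, step (roundOf s u) • g u‖ := by
      rw [partialIterate, sub_right_comm]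
      exact _root_.norm_sub_le _ _
    have h5 : 1 + L * β ≤ Real.exp (L * β) := by linarith [Real.add_one_le_exp (L * β)]
    rw [hZ, hexp2]
    have h6 : a * Real.exp (L * β) * (1 + L * β) ≤ a * Real.exp (L * β) * Real.exp (L * β) := by
      gcongr
    nlinarith

/-- The distance of a local model of round `i` to the iterate at the beginning of the round, when
the step sizes in the window add up to a small number. -/
theorem BoundedStaleness.norm_sub_le_of_small (h : BoundedStaleness s Q step w₀ x g)
    (hs : ∀ i, 0 < s i) (hstep : ∀ i, 0 ≤ step i) (hL : 0 ≤ L) (hν : ∀ u, 0 ≤ ν u)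
    (hg : ∀ u, ‖g u‖ ≤ ν u + L * ‖x u - wstar‖) {i t : ℕ} (ht : roundOf s t = i)
    {β q : ℝ} (hβ : β = ∑ u ∈ Finset.Ico (roundStart s (i - 1 - Q)) (roundStart s (i + Q + 1)),
      step (roundOf s u)) (hLβ : L * β ≤ 1)
    (hq : q = ∑ u ∈ Finset.Ico (roundStart s (i - 1 - Q)) (roundStart s (i + Q + 1)),
        step (roundOf s u) * ν u +
      L * ∑ u ∈ Finset.Ico (roundStart s (i - 1 - Q)) (roundStart s i),
        step (roundOf s u) * ‖x u - wstar‖) :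
    ‖x t - partialIterate s step w₀ g (roundStart s i)‖ ≤ 3 * q +
      2 * L * β * ‖partialIterate s step w₀ g (roundStart s i) - wstar‖ := by
  have hstep' : ∀ u, 0 ≤ step (roundOf s u) := fun u => hstep _
  have h1 := h.norm_sub_le hs hstep hL hν hg le_rfl ht rfl
  set q' := ∑ u ∈ Finset.Ico (roundStart s (i - Q)) (roundStart s i),
        step (roundOf s u) * (ν u + L * ‖x u - wstar‖) +
      ∑ u ∈ Finset.Ico (roundStart s i) (roundStart s (i + Q + 1)), step (roundOf s u) * ν u with hq'
  set β' := ∑ u ∈ Finset.Ico (roundStart s i) (roundStart s (i + Q + 1)), step (roundOf s u)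
    with hβ'
  have hm1 : roundStart s (i - 1 - Q) ≤ roundStart s (i - Q) := roundStart_mono s (by omega)
  have hm2 : roundStart s (i - Q) ≤ roundStart s i := roundStart_mono s (by omega)
  have hm3 : roundStart s i ≤ roundStart s (i + Q + 1) := roundStart_mono s (by omega)
  have hβ'β : β' ≤ β := by
    rw [hβ, hβ']
    exact Finset.sum_le_sum_of_subset_of_nonneg (Finset.Ico_subset_Ico (by omega) le_rfl)
      fun u _ _ => hstep' u
  have hβ'0 : 0 ≤ β' := Finset.sum_nonneg fun u _ => hstep' u
  have hqq : q' ≤ q := by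
    have e1 : ∑ u ∈ Finset.Ico (roundStart s (i - Q)) (roundStart s i),
        step (roundOf s u) * (ν u + L * ‖x u - wstar‖) =
        ∑ u ∈ Finset.Ico (roundStart s (i - Q)) (roundStart s i), step (roundOf s u) * ν u +
        L * ∑ u ∈ Finset.Ico (roundStart s (i - Q)) (roundStart s i),
          step (roundOf s u) * ‖x u - wstar‖ := by
      rw [Finset.mul_sum, ← Finset.sum_add_distrib]
      exact Finset.sum_congr rfl fun v _ => by ring
    have e2 := Finset.sum_Ico_consecutive (fun u => step (roundOf s u) * ν u) hm2 hm3
    have e3 : ∑ u ∈ Finset.Ico (roundStart s (i - Q)) (roundStart s (i + Q + 1)),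
        step (roundOf s u) * ν u ≤
        ∑ u ∈ Finset.Ico (roundStart s (i - 1 - Q)) (roundStart s (i + Q + 1)),
        step (roundOf s u) * ν u :=
      Finset.sum_le_sum_of_subset_of_nonneg (Finset.Ico_subset_Ico hm1 le_rfl)
        fun u _ _ => mul_nonneg (hstep' u) (hν u)
    have e4 : ∑ u ∈ Finset.Ico (roundStart s (i - Q)) (roundStart s i),
        step (roundOf s u) * ‖x u - wstar‖ ≤
        ∑ u ∈ Finset.Ico (roundStart s (i - 1 - Q)) (roundStart s i),
        step (roundOf s u) * ‖x u - wstar‖ :=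
      Finset.sum_le_sum_of_subset_of_nonneg (Finset.Ico_subset_Ico hm1 le_rfl)
        fun u _ _ => mul_nonneg (hstep' u) (norm_nonneg _)
    rw [hq', hq, e1]
    have := mul_le_mul_of_nonneg_left e4 hL
    linarith
  have hq'0 : 0 ≤ q' := by
    refine add_nonneg (Finset.sum_nonneg fun u _ => ?_) (Finset.sum_nonneg fun u _ => ?_)
    · exact mul_nonneg (hstep' u) (add_nonneg (hν u) (by positivity))
    · exact mul_nonneg (hstep' u) (hν u)
  have hLβ0 : 0 ≤ L * β' := by positivity
  have hLβ1 : L * β' ≤ L * β := by gcongr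
  have hexp : Real.exp (L * β') - 1 ≤ 2 * (L * β) := by
    have := Real.abs_exp_sub_one_le (x := L * β') (by rw [abs_of_nonneg hLβ0]; linarith)
    rw [abs_of_nonneg hLβ0] at this
    linarith [le_abs_self (Real.exp (L * β') - 1)]
  set w := ‖partialIterate s step w₀ g (roundStart s i) - wstar‖ with hw
  have hw0 : 0 ≤ w := norm_nonneg _
  have h2 : (w + q') * (Real.exp (L * β') - 1) ≤ (w + q') * (2 * (L * β)) :=
    mul_le_mul_of_nonneg_left hexp (by positivity)
  have h3 : q' * (2 * (L * β)) ≤ q' * 2 := by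
    apply mul_le_mul_of_nonneg_left _ hq'0; linarith
  nlinarith

end Pathwise

section OneRound

variable {E : Type*} [NormedAddCommGroup E] [InnerProductSpace ℝ E]

theorem norm_add_sq_le (u v : E) : ‖u + v‖ ^ 2 ≤ 2 * ‖u‖ ^ 2 + 2 * ‖v‖ ^ 2 := by
  have h := norm_add_le u v
  have h0 := norm_nonneg (u + v)
  nlinarith [sq_nonneg (‖u‖ - ‖v‖)]

theorem norm_sub_sq_le (u v : E) : ‖u - v‖ ^ 2 ≤ 2 * ‖u‖ ^ 2 + 2 * ‖v‖ ^ 2 := by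
  have := norm_add_sq_le u (-v)
  rwa [← sub_eq_add_neg, norm_neg] at this

theorem inner_le_of_pos (u v : E) {c : ℝ} (hc : 0 < c) :
    2 * inner ℝ u v ≤ c * ‖u‖ ^ 2 + ‖v‖ ^ 2 / c := by
  have h := real_inner_le_norm u v
  have h2 : 2 * (‖u‖ * ‖v‖) ≤ c * ‖u‖ ^ 2 + ‖v‖ ^ 2 / c := by
    have : c * ‖u‖ ^ 2 + ‖v‖ ^ 2 / c - 2 * (‖u‖ * ‖v‖) = (c * ‖u‖ - ‖v‖) ^ 2 / c := by
      field_simp; ring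
    have h3 : 0 ≤ (c * ‖u‖ - ‖v‖) ^ 2 / c := by positivity
    linarith
  linarith

/-- The effect of one round on the distance to the minimizer: `D = W - w_*`, `b = B - w_*` for a
reference point `B` at which the gradients are `γ`, and `g = ν + ρ` are the gradients that are
actually used, split into the gradients at the minimizer and the rest. -/
theorem norm_sub_smul_sum_sq_le (J : Finset ℕ) (D b N' R' V : E) (g ν ρ γ : ℕ → E) (e : ℕ → ℝ)
    {η μ L κ : ℝ} (hη : 0 ≤ η) (hμ : 0 < μ) (hκ : 0 < κ)
    (hDb : D - b = -N' - R' + V) (hg : ∀ t ∈ J, g t = ν t + ρ t)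
    (hγ : ∀ t ∈ J, ‖g t - γ t‖ ≤ L * e t) :
    ‖D - η • ∑ t ∈ J, g t‖ ^ 2 ≤ ‖D‖ ^ 2 - 2 * η * ∑ t ∈ J, inner ℝ (γ t) b +
      2 * η * ∑ t ∈ J, (μ / 4 * ‖b‖ ^ 2 + L ^ 2 / μ * e t ^ 2) +
      2 * η * inner ℝ (∑ t ∈ J, ν t) N' +
      (η ^ 2 * ‖∑ t ∈ J, ν t‖ ^ 2 + ‖R' - V‖ ^ 2) +
      (κ * (η ^ 2 * ‖∑ t ∈ J, ρ t‖ ^ 2) + ‖D - b‖ ^ 2 / κ) +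
      2 * η ^ 2 * (‖∑ t ∈ J, ν t‖ ^ 2 + ‖∑ t ∈ J, ρ t‖ ^ 2) := by
  have hΓ : ∑ t ∈ J, g t = ∑ t ∈ J, ν t + ∑ t ∈ J, ρ t := by
    rw [← Finset.sum_add_distrib]; exact Finset.sum_congr rfl hg
  have h1 : -inner ℝ (∑ t ∈ J, g t) b ≤ -∑ t ∈ J, inner ℝ (γ t) b +
      ∑ t ∈ J, (μ / 4 * ‖b‖ ^ 2 + L ^ 2 / μ * e t ^ 2) := by
    rw [sum_inner, ← Finset.sum_neg_distrib, ← Finset.sum_neg_distrib, ← Finset.sum_add_distrib]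
    refine Finset.sum_le_sum fun t ht => ?_
    have h2 : inner ℝ (g t) b = inner ℝ (γ t) b + inner ℝ (g t - γ t) b := by
      rw [inner_sub_left]; ring
    have h3 := (abs_le.mp (abs_real_inner_le_norm (g t - γ t) b)).1
    have h4 : ‖g t - γ t‖ * ‖b‖ ≤ L * e t * ‖b‖ :=
      mul_le_mul_of_nonneg_right (hγ t ht) (norm_nonneg b)
    have h5 : L * e t * ‖b‖ ≤ μ / 4 * ‖b‖ ^ 2 + L ^ 2 / μ * e t ^ 2 := by
      have : μ / 4 * ‖b‖ ^ 2 + L ^ 2 / μ * e t ^ 2 - L * e t * ‖b‖ =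
          (μ / 2 * ‖b‖ - L * e t) ^ 2 / μ := by field_simp; ring
      have h6 : 0 ≤ (μ / 2 * ‖b‖ - L * e t) ^ 2 / μ := by positivity
      linarith
    linarith
  have h2 : inner ℝ (∑ t ∈ J, g t) D = inner ℝ (∑ t ∈ J, g t) b -
      inner ℝ (∑ t ∈ J, ν t) N' - inner ℝ (∑ t ∈ J, ν t) (R' - V) +
      inner ℝ (∑ t ∈ J, ρ t) (D - b) := by
    have : D = b + (D - b) := by abel
    conv_lhs => rw [this, inner_add_right, hΓ, inner_add_left _ _ (D - b)]
    rw [show inner ℝ (∑ t ∈ J, ν t) (D - b) =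
      -inner ℝ (∑ t ∈ J, ν t) N' - inner ℝ (∑ t ∈ J, ν t) (R' - V) by
        rw [hDb, inner_add_right, inner_sub_right, inner_neg_right, inner_sub_right]; ring, hΓ]
    ring
  have h3 : 2 * η * inner ℝ (∑ t ∈ J, ν t) (R' - V) ≤
      η ^ 2 * ‖∑ t ∈ J, ν t‖ ^ 2 + ‖R' - V‖ ^ 2 := by
    have := inner_le_of_pos (η • ∑ t ∈ J, ν t) (R' - V) one_pos
    rw [real_inner_smul_left, norm_smul, Real.norm_of_nonneg hη, mul_pow] at this
    linarith
  have h4 : -(2 * η * inner ℝ (∑ t ∈ J, ρ t) (D - b)) ≤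
      κ * (η ^ 2 * ‖∑ t ∈ J, ρ t‖ ^ 2) + ‖D - b‖ ^ 2 / κ := by
    have := inner_le_of_pos (-(η • ∑ t ∈ J, ρ t)) (D - b) hκ
    rw [inner_neg_left, real_inner_smul_left, norm_neg, norm_smul, Real.norm_of_nonneg hη,
      mul_pow] at this
    linarith
  have h5 : η ^ 2 * ‖∑ t ∈ J, g t‖ ^ 2 ≤
      2 * η ^ 2 * (‖∑ t ∈ J, ν t‖ ^ 2 + ‖∑ t ∈ J, ρ t‖ ^ 2) := by
    rw [hΓ]
    have := mul_le_mul_of_nonneg_left (norm_add_sq_le (∑ t ∈ J, ν t) (∑ t ∈ J, ρ t)) (sq_nonneg η)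
    linarith
  have h6 : ‖D - η • ∑ t ∈ J, g t‖ ^ 2 =
      ‖D‖ ^ 2 - 2 * η * inner ℝ (∑ t ∈ J, g t) D + η ^ 2 * ‖∑ t ∈ J, g t‖ ^ 2 := by
    rw [norm_sub_sq_real, real_inner_smul_right, norm_smul, Real.norm_of_nonneg hη, mul_pow,
      real_inner_comm]
    ring
  have h7 := mul_le_mul_of_nonneg_left h1 (by positivity : (0 : ℝ) ≤ 2 * η)
  rw [h6, h2]
  nlinarith

end OneRound

/-! ### Second moments -/

section Moments

variable {Ω : Type*} [MeasurableSpace Ω] {P : Measure Ω}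

/-- `f` is integrable with integral at most `c`. -/
def IntegralLE (P : Measure Ω) (f : Ω → ℝ) (c : ℝ) : Prop := Integrable f P ∧ ∫ ω, f ω ∂P ≤ c

namespace IntegralLE

variable {f g : Ω → ℝ} {c c' : ℝ}

theorem mono (h : IntegralLE P f c) (hc : c ≤ c') : IntegralLE P f c' := ⟨h.1, h.2.trans hc⟩

theorem add (h : IntegralLE P f c) (h' : IntegralLE P g c') :
    IntegralLE P (fun ω => f ω + g ω) (c + c') :=
  ⟨h.1.add h'.1, by rw [integral_add h.1 h'.1]; exact add_le_add h.2 h'.2⟩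

theorem const_mul (h : IntegralLE P f c) {r : ℝ} (hr : 0 ≤ r) :
    IntegralLE P (fun ω => r * f ω) (r * c) :=
  ⟨h.1.const_mul r, by rw [integral_const_mul]; exact mul_le_mul_of_nonneg_left h.2 hr⟩

theorem sum {ι : Type*} {S : Finset ι} {f : ι → Ω → ℝ} {c : ι → ℝ}
    (h : ∀ u ∈ S, IntegralLE P (f u) (c u)) :
    IntegralLE P (fun ω => ∑ u ∈ S, f u ω) (∑ u ∈ S, c u) :=
  ⟨integrable_finsetSum _ fun u hu => (h u hu).1, by
    rw [integral_finsetSum _ fun u hu => (h u hu).1]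
    exact Finset.sum_le_sum fun u hu => (h u hu).2⟩

theorem of_le (h : IntegralLE P g c) (hf : AEStronglyMeasurable f P) (hf0 : ∀ ω, 0 ≤ f ω)
    (hfg : ∀ᵐ ω ∂P, f ω ≤ g ω) : IntegralLE P f c := by
  have hint : Integrable f P := h.1.mono' hf (by
    filter_upwards [hfg] with ω hω
    rwa [Real.norm_of_nonneg (hf0 ω)])
  exact ⟨hint, (integral_mono_ae hint h.1 hfg).trans h.2⟩

/-- A weighted sum of random variables with second moments at most `M`. -/
theorem sq_sum {S : Finset ℕ} {b : ℕ → ℝ} {y : ℕ → Ω → ℝ} {M : ℝ} (hb : ∀ u ∈ S, 0 ≤ b u)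
    (hym : ∀ u, AEStronglyMeasurable (y u) P) (hy : ∀ u ∈ S, IntegralLE P (fun ω => y u ω ^ 2) M) :
    IntegralLE P (fun ω => (∑ u ∈ S, b u * y u ω) ^ 2) ((∑ u ∈ S, b u) ^ 2 * M) := by
  have h1 : IntegralLE P (fun ω => (∑ u ∈ S, b u) * ∑ u ∈ S, b u * y u ω ^ 2)
      ((∑ u ∈ S, b u) * ∑ u ∈ S, b u * M) :=
    (sum fun u hu => (hy u hu).const_mul (hb u hu)).const_mul (Finset.sum_nonneg hb)
  refine (h1.of_le ?_ (fun ω => sq_nonneg _) (Eventually.of_forall fun ω => ?_)).mono ?_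
  · exact (Finset.aestronglyMeasurable_fun_sum _ fun u _ => (hym u).const_mul _).pow 2
  · exact Finset.sum_sq_le_sum_mul_sum_of_sq_le_mul S hb
      (fun u hu => mul_nonneg (hb u hu) (sq_nonneg _)) fun u _ => le_of_eq (by ring)
  · rw [← Finset.sum_mul, sq, mul_assoc]

end IntegralLE

variable {E : Type*} [NormedAddCommGroup E] [InnerProductSpace ℝ E]

theorem integrable_inner_of_sq {f g : Ω → E} (hf : AEStronglyMeasurable f P)
    (hg : AEStronglyMeasurable g P) (hf2 : Integrable (fun ω => ‖f ω‖ ^ 2) P)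
    (hg2 : Integrable (fun ω => ‖g ω‖ ^ 2) P) : Integrable (fun ω => (inner ℝ (f ω) (g ω) : ℝ)) P := by
  refine (hf2.add hg2).mono' (hf.inner hg) (Eventually.of_forall fun ω => ?_)
  have h1 := norm_inner_le_norm (𝕜 := ℝ) (f ω) (g ω)
  simp only [Pi.add_apply]
  nlinarith [sq_nonneg (‖f ω‖ - ‖g ω‖), sq_nonneg (‖f ω‖), sq_nonneg (‖g ω‖)]

theorem integrable_of_sq [IsFiniteMeasure P] {f : Ω → E} (hf : AEStronglyMeasurable f P)
    (hf2 : Integrable (fun ω => ‖f ω‖ ^ 2) P) : Integrable f P := by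
  refine (hf2.add (integrable_const (1 : ℝ))).mono' hf (Eventually.of_forall fun ω => ?_)
  simp only [Pi.add_apply]
  nlinarith [sq_nonneg (‖f ω‖ - 1)]

/-! ### SGD with stale gradients -/

variable {Ξ : Type*} [MeasurableSpace Ξ] [MeasurableSpace E]

/-- A stochastic gradient `grad` with Lipschitz realizations, whose mean is strongly monotone with
zero `wstar`. -/
structure StochasticGradient (𝒟 : Measure Ξ) (grad : E → Ξ → E) (wstar : E) (L μ : ℝ) : Prop where
  meas : Measurable (Function.uncurry grad)
  L_pos : 0 < L
  mu_pos : 0 < μ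
  lip : ∀ ξ w w', ‖grad w ξ - grad w' ξ‖ ≤ L * ‖w - w'‖
  sq : Integrable (fun ξ => ‖grad wstar ξ‖ ^ 2) 𝒟
  zero : ∫ ξ, grad wstar ξ ∂𝒟 = 0
  mono : ∀ w, μ * ‖w - wstar‖ ^ 2 ≤ inner ℝ (∫ ξ, grad w ξ ∂𝒟) (w - wstar)

/-- Stochastic gradient descent in rounds of size `s i` with samples `ξ t` and stale points of
evaluation `x t`. The last field says that up to an exceptional event `H` of probability at most
`δ i` the iterate at the beginning of round `i - 1 - Q` is independent of the samples of
round `i`; it is replaced by `wstar` on `H`. -/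
structure StaleSGD (P : Measure Ω) (𝒟 : Measure Ξ) (s : ℕ → ℕ) (Q : ℕ) (step : ℕ → ℝ)
    (grad : E → Ξ → E) (w₀ wstar : E) (δ : ℕ → ℝ) (κ : ℝ) (ξ : ℕ → Ω → Ξ) (x : ℕ → Ω → E) :
    Prop where
  meas_sample : ∀ t, Measurable (ξ t)
  meas_model : ∀ t, Measurable (x t)
  law : ∀ t, P.map (ξ t) = 𝒟
  indep : ∀ t u, t ≠ u → IndepFun (ξ t) (ξ u) P
  stale : ∀ᵐ ω ∂P, BoundedStaleness s Q step w₀ (fun t => x t ω) fun t => grad (x t ω) (ξ t ω)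
  ref : ∀ i, Q < i → ∃ (B : Ω → E) (H : Set Ω), Measurable B ∧ MeasurableSet H ∧
    (∀ t, roundOf s t = i → IndepFun B (ξ t) P) ∧
    (∀ᵐ ω ∂P, ω ∉ H → B ω = partialIterate s step w₀ (fun t => grad (x t ω) (ξ t ω))
      (roundStart s (i - 1 - Q))) ∧
    (∀ ω ∈ H, B ω = wstar) ∧ P.real H ≤ δ i ∧
    ∀ u, ∫ ω in H, ‖grad wstar (ξ u ω)‖ ^ 2 ∂P ≤ κ * δ i

/-- A second moment bound for all models when the step sizes add up to `β`, the initial distance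
is `r` and the gradients at the minimizer have second moments at most `M`. -/
noncomputable def crudeBound (L r β M : ℝ) : ℝ := Real.exp (4 * L * β) * (2 * r ^ 2 + 2 * β ^ 2 * M)

variable [BorelSpace E] [SecondCountableTopology E]
  {𝒟 : Measure Ξ} {s : ℕ → ℕ} {Q : ℕ} {step : ℕ → ℝ} {grad : E → Ξ → E}
  {w₀ wstar : E} {δ : ℕ → ℝ} {κ L μ : ℝ} {ξ : ℕ → Ω → Ξ} {x : ℕ → Ω → E}

theorem StochasticGradient.norm_le (ho : StochasticGradient 𝒟 grad wstar L μ) (w : E) (z : Ξ) :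
    ‖grad w z‖ ≤ ‖grad wstar z‖ + L * ‖w - wstar‖ := by
  have h1 := ho.lip z w wstar
  have h2 := norm_le_norm_add_norm_sub' (grad w z) (grad wstar z)
  linarith

namespace StaleSGD

variable (h : StaleSGD P 𝒟 s Q step grad w₀ wstar δ κ ξ x)
  (ho : StochasticGradient 𝒟 grad wstar L μ)

include h ho

theorem measurable_grad (t : ℕ) : Measurable fun ω => grad (x t ω) (ξ t ω) :=
  ho.meas.comp ((h.meas_model t).prodMk (h.meas_sample t))

theorem measurable_noise (t : ℕ) : Measurable fun ω => grad wstar (ξ t ω) :=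
  ho.meas.comp (measurable_const.prodMk (h.meas_sample t))

theorem measurable_partialIterate (t : ℕ) :
    Measurable fun ω => partialIterate s step w₀ (fun t => grad (x t ω) (ξ t ω)) t :=
  measurable_const.sub (Finset.measurable_fun_sum _ fun u _ =>
    (h.measurable_grad ho u).const_smul _)

theorem noise_sq (t : ℕ) :
    IntegralLE P (fun ω => ‖grad wstar (ξ t ω)‖ ^ 2) (∫ z, ‖grad wstar z‖ ^ 2 ∂𝒟) := by
  have hm : Measurable fun z => ‖grad wstar z‖ ^ 2 :=
    ((ho.meas.comp (measurable_const.prodMk measurable_id)).norm).pow_const 2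
  constructor
  · refine (integrable_map_measure (g := fun z => ‖grad wstar z‖ ^ 2) ?_
      (h.meas_sample t).aemeasurable).mp ?_
    · exact hm.aestronglyMeasurable
    · rw [h.law]; exact ho.sq
  · rw [← h.law t, integral_map (h.meas_sample t).aemeasurable hm.aestronglyMeasurable]

theorem integral_noise [IsProbabilityMeasure P] (t : ℕ) : ∫ ω, grad wstar (ξ t ω) ∂P = 0 := by
  have hm : Measurable fun z => grad wstar z := ho.meas.comp (measurable_const.prodMk measurable_id)
  rw [← ho.zero, ← h.law t, integral_map (h.meas_sample t).aemeasurable hm.aestronglyMeasurable]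

/-- The stochastic gradients at the minimizer are centred and independent, hence orthogonal. -/
theorem inner_noise [IsProbabilityMeasure P] [CompleteSpace E] (t u : ℕ) :
    IntegralLE P (fun ω => inner ℝ (grad wstar (ξ t ω)) (grad wstar (ξ u ω)))
      (if t = u then ∫ z, ‖grad wstar z‖ ^ 2 ∂𝒟 else 0) := by
  have hm : Measurable fun z => grad wstar z := ho.meas.comp (measurable_const.prodMk measurable_id)
  have hint : ∀ t, Integrable (fun ω => grad wstar (ξ t ω)) P := fun t =>
    integrable_of_sq (h.measurable_noise ho t).aestronglyMeasurable (h.noise_sq ho t).1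
  refine ⟨integrable_inner_of_sq (h.measurable_noise ho t).aestronglyMeasurable
    (h.measurable_noise ho u).aestronglyMeasurable (h.noise_sq ho t).1 (h.noise_sq ho u).1, ?_⟩
  split_ifs with htu
  · subst htu
    simp only [real_inner_self_eq_norm_sq]
    exact (h.noise_sq ho t).2
  · have hind : IndepFun (fun ω => grad wstar (ξ t ω)) (fun ω => grad wstar (ξ u ω)) P :=
      (h.indep t u htu).comp hm hm
    have h1 : ∫ ω, (inner ℝ (grad wstar (ξ t ω)) (grad wstar (ξ u ω)) : ℝ) ∂P =
        inner ℝ (∫ ω, grad wstar (ξ t ω) ∂P) (∫ ω, grad wstar (ξ u ω) ∂P) :=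
      hind.integral_bilin (hint t) (hint u) (innerSL ℝ)
    rw [h1, h.integral_noise ho, inner_zero_left]

/-- Bounds for all models up to round `k`, on the whole space and on subsets. -/
theorem crude_restrict [IsProbabilityMeasure P] (hs : ∀ i, 0 < s i) (hstep : ∀ i, 0 ≤ step i)
    (k : ℕ) {H : Set Ω} {p M : ℝ} (hp : P.real H ≤ p)
    (hM : ∀ u, ∫ ω in H, ‖grad wstar (ξ u ω)‖ ^ 2 ∂P ≤ M * p) {β : ℝ}
    (hβ : β = ∑ u ∈ Finset.range (roundStart s (k + Q + 1)), step (roundOf s u)) :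
    (∀ t, roundOf s t ≤ k → IntegralLE (P.restrict H) (fun ω => ‖x t ω - wstar‖ ^ 2)
      (crudeBound L ‖w₀ - wstar‖ β M * p)) ∧
    ∀ t ≤ roundStart s (k + 1), IntegralLE (P.restrict H)
      (fun ω => ‖partialIterate s step w₀ (fun t => grad (x t ω) (ξ t ω)) t - wstar‖ ^ 2)
      (crudeBound L ‖w₀ - wstar‖ β M * p) := by
  have hL := ho.L_pos.le
  set Z : Ω → ℝ := fun ω => (‖w₀ - wstar‖ + ∑ u ∈ Finset.range (roundStart s (k + Q + 1)),
      step (roundOf s u) * ‖grad wstar (ξ u ω)‖) * Real.exp (2 * L * β) with hZ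
  have hbound : ∀ᵐ ω ∂(P.restrict H), (∀ t, roundOf s t ≤ k → ‖x t ω - wstar‖ ≤ Z ω) ∧
      ∀ t ≤ roundStart s (k + 1),
        ‖partialIterate s step w₀ (fun t => grad (x t ω) (ξ t ω)) t - wstar‖ ≤ Z ω := by
    filter_upwards [ae_restrict_of_ae h.stale] with ω hω
    exact hω.crude hs hstep hL (fun u => norm_nonneg _) (fun u => ho.norm_le _ _) k hβ rfl
  have hZ2 : IntegralLE (P.restrict H) (fun ω => Real.exp (4 * L * β) * (2 * ‖w₀ - wstar‖ ^ 2 +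
      2 * (∑ u ∈ Finset.range (roundStart s (k + Q + 1)),
        step (roundOf s u) * ‖grad wstar (ξ u ω)‖) ^ 2))
      (crudeBound L ‖w₀ - wstar‖ β M * p) := by
    have h1 : IntegralLE (P.restrict H) (fun _ => 2 * ‖w₀ - wstar‖ ^ 2)
        (2 * ‖w₀ - wstar‖ ^ 2 * p) := by
      refine ⟨integrable_const _, ?_⟩
      rw [integral_const, smul_eq_mul, measureReal_restrict_apply_univ, mul_comm]
      gcongr
    have h2 := IntegralLE.sq_sum (P := P.restrict H) (M := M * p)
      (S := Finset.range (roundStart s (k + Q + 1)))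
      (b := fun u => step (roundOf s u)) (y := fun u ω => ‖grad wstar (ξ u ω)‖)
      (fun u _ => hstep _) (fun u => (h.measurable_noise ho u).norm.aestronglyMeasurable)
      (fun u _ => ⟨(h.noise_sq ho u).1.restrict, hM u⟩)
    refine ((h1.add (h2.const_mul zero_le_two)).const_mul (Real.exp_nonneg _)).mono (le_of_eq ?_)
    rw [crudeBound, ← hβ]
    ring
  have hexp : Real.exp (4 * L * β) = Real.exp (2 * L * β) ^ 2 := by
    rw [sq, ← Real.exp_add]; ring_nf
  have hle : ∀ ω, Z ω ^ 2 ≤ Real.exp (4 * L * β) * (2 * ‖w₀ - wstar‖ ^ 2 +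
      2 * (∑ u ∈ Finset.range (roundStart s (k + Q + 1)),
        step (roundOf s u) * ‖grad wstar (ξ u ω)‖) ^ 2) := fun ω => by
    rw [hZ, hexp, mul_pow, mul_comm]
    gcongr
    nlinarith [sq_nonneg (‖w₀ - wstar‖ - ∑ u ∈ Finset.range (roundStart s (k + Q + 1)),
        step (roundOf s u) * ‖grad wstar (ξ u ω)‖)]
  constructor
  · intro t ht
    refine hZ2.of_le ?_ (fun ω => sq_nonneg _) ?_
    · exact (((h.meas_model t).sub measurable_const).norm.pow_const 2).aestronglyMeasurable
    · filter_upwards [hbound] with ω hω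
      exact (pow_le_pow_left₀ (norm_nonneg _) (hω.1 t ht) 2).trans (hle ω)
  · intro t ht
    refine hZ2.of_le ?_ (fun ω => sq_nonneg _) ?_
    · exact (((h.measurable_partialIterate ho t).sub
        measurable_const).norm.pow_const 2).aestronglyMeasurable
    · filter_upwards [hbound] with ω hω
      exact (pow_le_pow_left₀ (norm_nonneg _) (hω.2 t ht) 2).trans (hle ω)

/-- An a priori bound for the second moments up to round `k`. It grows with the sum of the step sizes
and only serves for early rounds and for exceptional events. -/
theorem crude [IsProbabilityMeasure P] (hs : ∀ i, 0 < s i) (hstep : ∀ i, 0 ≤ step i)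
    (k : ℕ) {β : ℝ}
    (hβ : β = ∑ u ∈ Finset.range (roundStart s (k + Q + 1)), step (roundOf s u)) :
    (∀ t, roundOf s t ≤ k → IntegralLE P (fun ω => ‖x t ω - wstar‖ ^ 2)
      (crudeBound L ‖w₀ - wstar‖ β (∫ z, ‖grad wstar z‖ ^ 2 ∂𝒟))) ∧
    ∀ t ≤ roundStart s (k + 1), IntegralLE P
      (fun ω => ‖partialIterate s step w₀ (fun t => grad (x t ω) (ξ t ω)) t - wstar‖ ^ 2)
      (crudeBound L ‖w₀ - wstar‖ β (∫ z, ‖grad wstar z‖ ^ 2 ∂𝒟)) := by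
  have := h.crude_restrict ho hs hstep k (H := Set.univ) (p := 1)
    (M := ∫ z, ‖grad wstar z‖ ^ 2 ∂𝒟) (by simp)
    (fun u => by rw [Measure.restrict_univ, mul_one]; exact (h.noise_sq ho u).2) hβ
  simpa only [Measure.restrict_univ, mul_one] using this

theorem integrable_model [IsProbabilityMeasure P] (hs : ∀ i, 0 < s i) (hstep : ∀ i, 0 ≤ step i)
    (t : ℕ) : Integrable (fun ω => ‖x t ω - wstar‖ ^ 2) P :=
  ((h.crude ho hs hstep (roundOf s t) rfl).1 t le_rfl).1

theorem integrable_partialIterate [IsProbabilityMeasure P] (hs : ∀ i, 0 < s i)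
    (hstep : ∀ i, 0 ≤ step i) (t : ℕ) : Integrable (fun ω =>
      ‖partialIterate s step w₀ (fun t => grad (x t ω) (ξ t ω)) t - wstar‖ ^ 2) P :=
  ((h.crude ho hs hstep (roundOf s t) rfl).2 t (lt_roundStart_roundOf_succ hs t).le).1

end StaleSGD

end Moments

/-! ### The mean effect of one round -/

section RoundMoments

variable {Ω : Type*} [MeasurableSpace Ω] {P : Measure Ω}
  {E : Type*} [NormedAddCommGroup E] [InnerProductSpace ℝ E]

theorem IntegralLE.norm_sum_smul_sq {S : Finset ℕ} {c : ℕ → ℝ} {z : ℕ → Ω → E} {M : ℝ}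
    (hc : ∀ u ∈ S, 0 ≤ c u) (hzm : ∀ u, AEStronglyMeasurable (z u) P)
    (hz : ∀ u ∈ S, IntegralLE P (fun ω => ‖z u ω‖ ^ 2) M) :
    IntegralLE P (fun ω => ‖∑ u ∈ S, c u • z u ω‖ ^ 2) ((∑ u ∈ S, c u) ^ 2 * M) := by
  refine (sq_sum hc (fun u => (hzm u).norm) hz).of_le ?_ (fun ω => sq_nonneg _)
    (Eventually.of_forall fun ω => ?_)
  · exact ((Finset.aestronglyMeasurable_fun_sum _ fun u _ => (hzm u).const_smul _)).norm.pow 2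
  · refine pow_le_pow_left₀ (norm_nonneg _) ((norm_sum_le _ _).trans_eq ?_) 2
    refine Finset.sum_congr rfl fun u hu => ?_
    rw [norm_smul, Real.norm_of_nonneg (hc u hu)]

variable {Ξ : Type*} [MeasurableSpace Ξ] [MeasurableSpace E]

/-- The sum of the step sizes of all evaluations that may influence or be influenced by round `i`,
including one additional earlier round. -/
noncomputable def windowSum (s : ℕ → ℕ) (Q : ℕ) (step : ℕ → ℝ) (i : ℕ) : ℝ :=
  ∑ u ∈ Finset.Ico (roundStart s (i - 1 - Q)) (roundStart s (i + Q + 1)), step (roundOf s u)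

/-- The mean square distance of an iterate to `wstar`. -/
noncomputable def iterateError (P : Measure Ω) (s : ℕ → ℕ) (step : ℕ → ℝ) (grad : E → Ξ → E)
    (w₀ wstar : E) (ξ : ℕ → Ω → Ξ) (x : ℕ → Ω → E) (t : ℕ) : ℝ :=
  ∫ ω, ‖partialIterate s step w₀ (fun t => grad (x t ω) (ξ t ω)) t - wstar‖ ^ 2 ∂P

variable [BorelSpace E] [SecondCountableTopology E]
  {𝒟 : Measure Ξ} {s : ℕ → ℕ} {Q : ℕ} {step : ℕ → ℝ} {grad : E → Ξ → E}
  {w₀ wstar : E} {δ : ℕ → ℝ} {κ L μ : ℝ} {ξ : ℕ → Ω → Ξ} {x : ℕ → Ω → E}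

theorem windowSum_nonneg (hstep : ∀ i, 0 ≤ step i) (i : ℕ) : 0 ≤ windowSum s Q step i :=
  Finset.sum_nonneg fun _ _ => hstep _

theorem sum_step_le_windowSum (hstep : ∀ i, 0 ≤ step i) (i : ℕ) :
    ∑ u ∈ Finset.Ico (roundStart s (i - 1 - Q)) (roundStart s i), step (roundOf s u) ≤
      windowSum s Q step i :=
  Finset.sum_le_sum_of_subset_of_nonneg (Finset.Ico_subset_Ico le_rfl
    (roundStart_mono s (by omega))) fun _ _ _ => hstep _

theorem StochasticGradient.integrable_sq (ho : StochasticGradient 𝒟 grad wstar L μ)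
    {Ω' : Type*} [MeasurableSpace Ω'] {P' : Measure Ω'} {b : Ω' → E} {z : Ω' → Ξ}
    (hb : Measurable b) (hz : Measurable z) (h1 : Integrable (fun ω => ‖b ω - wstar‖ ^ 2) P')
    (h2 : Integrable (fun ω => ‖grad wstar (z ω)‖ ^ 2) P') :
    Integrable (fun ω => ‖grad (b ω) (z ω)‖ ^ 2) P' := by
  refine ((h2.const_mul 2).add (h1.const_mul (2 * L ^ 2))).mono'
    (((ho.meas.comp (hb.prodMk hz)).norm.pow_const 2).aestronglyMeasurable)
    (Eventually.of_forall fun ω => ?_)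
  rw [Real.norm_of_nonneg (sq_nonneg _)]
  have h3 := pow_le_pow_left₀ (norm_nonneg _) (ho.norm_le (b ω) (z ω)) 2
  simp only [Pi.add_apply]
  nlinarith [sq_nonneg (‖grad wstar (z ω)‖ - L * ‖b ω - wstar‖)]

namespace StaleSGD

variable (h : StaleSGD P 𝒟 s Q step grad w₀ wstar δ κ ξ x)
  (ho : StochasticGradient 𝒟 grad wstar L μ)

include h ho

/-- The mean square distance of a model of round `i` to the iterate at the beginning of round `i`. -/
theorem model_sub_iterate [IsProbabilityMeasure P] (hs : ∀ i, 0 < s i) (hstep : ∀ i, 0 ≤ step i)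
    {i t : ℕ} (ht : roundOf s t = i) {M : ℝ} (hM0 : 0 ≤ M)
    (hM : ∀ u, roundStart s (i - 1 - Q) ≤ u → u < roundStart s i →
      ∫ ω, ‖x u ω - wstar‖ ^ 2 ∂P ≤ M) (hβ : L * windowSum s Q step i ≤ 1) :
    IntegralLE P (fun ω => ‖x t ω -
        partialIterate s step w₀ (fun t => grad (x t ω) (ξ t ω)) (roundStart s i)‖ ^ 2)
      (36 * windowSum s Q step i ^ 2 * (∫ z, ‖grad wstar z‖ ^ 2 ∂𝒟 + L ^ 2 * M) +
        8 * L ^ 2 * windowSum s Q step i ^ 2 *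
          iterateError P s step grad w₀ wstar ξ x (roundStart s i)) := by
  set β := windowSum s Q step i with hβdef
  have hβ0 : 0 ≤ β := windowSum_nonneg hstep i
  have hL := ho.L_pos.le
  have h1 := IntegralLE.sq_sum (P := P)
    (S := Finset.Ico (roundStart s (i - 1 - Q)) (roundStart s (i + Q + 1)))
    (b := fun u => step (roundOf s u)) (y := fun u ω => ‖grad wstar (ξ u ω)‖)
    (fun u _ => hstep _) (fun u => (h.measurable_noise ho u).norm.aestronglyMeasurable)
    (fun u _ => h.noise_sq ho u)
  have h2 := IntegralLE.sq_sum (P := P) (M := M)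
    (S := Finset.Ico (roundStart s (i - 1 - Q)) (roundStart s i))
    (b := fun u => step (roundOf s u)) (y := fun u ω => ‖x u ω - wstar‖)
    (fun u _ => hstep _)
    (fun u => ((h.meas_model u).sub measurable_const).norm.aestronglyMeasurable)
    (fun u hu => ⟨h.integrable_model ho hs hstep u,
      hM u (Finset.mem_Ico.mp hu).1 (Finset.mem_Ico.mp hu).2⟩)
  have h3 : IntegralLE P (fun ω => ‖partialIterate s step w₀ (fun t => grad (x t ω) (ξ t ω))
      (roundStart s i) - wstar‖ ^ 2) (iterateError P s step grad w₀ wstar ξ x (roundStart s i)) :=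
    ⟨h.integrable_partialIterate ho hs hstep _, le_rfl⟩
  have h4 := ((h1.const_mul (by norm_num : (0 : ℝ) ≤ 36)).add
    (h2.const_mul (by positivity : (0 : ℝ) ≤ 36 * L ^ 2))).add
    (h3.const_mul (by positivity : (0 : ℝ) ≤ 8 * L ^ 2 * β ^ 2))
  refine (h4.of_le ?_ (fun ω => sq_nonneg _) ?_).mono ?_
  · exact (((h.meas_model t).sub (h.measurable_partialIterate ho _)).norm.pow_const
      2).aestronglyMeasurable
  · filter_upwards [h.stale] with ω hω
    have h5 := hω.norm_sub_le_of_small hs hstep hL (fun u => norm_nonneg _)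
      (fun u => ho.norm_le (x u ω) (ξ u ω)) ht hβdef hβ rfl
    have h6 := pow_le_pow_left₀ (norm_nonneg _) h5 2
    refine h6.trans ?_
    set p := ∑ u ∈ Finset.Ico (roundStart s (i - 1 - Q)) (roundStart s (i + Q + 1)),
      step (roundOf s u) * ‖grad wstar (ξ u ω)‖
    set r := ∑ u ∈ Finset.Ico (roundStart s (i - 1 - Q)) (roundStart s i),
      step (roundOf s u) * ‖x u ω - wstar‖
    set D := ‖partialIterate s step w₀ (fun t => grad (x t ω) (ξ t ω)) (roundStart s i) - wstar‖
    nlinarith [sq_nonneg (3 * (p + L * r) - 2 * L * β * D), sq_nonneg (p - L * r)]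
  · have h7 : (∑ u ∈ Finset.Ico (roundStart s (i - 1 - Q)) (roundStart s i),
        step (roundOf s u)) ^ 2 * M ≤ β ^ 2 * M := by
      refine mul_le_mul_of_nonneg_right (pow_le_pow_left₀ (Finset.sum_nonneg fun _ _ => hstep _)
        (sum_step_le_windowSum hstep i) 2) hM0
    have h8 := mul_le_mul_of_nonneg_left h7 (by positivity : (0 : ℝ) ≤ 36 * L ^ 2)
    have h9 : (∑ u ∈ Finset.Ico (roundStart s (i - 1 - Q)) (roundStart s (i + Q + 1)),
        step (roundOf s u)) = β := rfl
    rw [h9]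
    linarith

/-- The part of a gradient that is due to the distance of the model to the minimizer. -/
theorem excess_sq [IsProbabilityMeasure P] (hs : ∀ i, 0 < s i) (hstep : ∀ i, 0 ≤ step i)
    {u : ℕ} {M : ℝ} (hM : ∫ ω, ‖x u ω - wstar‖ ^ 2 ∂P ≤ M) :
    IntegralLE P (fun ω => ‖grad (x u ω) (ξ u ω) - grad wstar (ξ u ω)‖ ^ 2) (L ^ 2 * M) := by
  have h1 : IntegralLE P (fun ω => ‖x u ω - wstar‖ ^ 2) M :=
    ⟨h.integrable_model ho hs hstep u, hM⟩
  refine (h1.const_mul (sq_nonneg L)).of_le ?_ (fun ω => sq_nonneg _)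
    (Eventually.of_forall fun ω => ?_)
  · exact (((h.measurable_grad ho u).sub (h.measurable_noise ho u)).norm.pow_const
      2).aestronglyMeasurable
  · rw [← mul_pow]
    exact pow_le_pow_left₀ (norm_nonneg _) (ho.lip _ _ _) 2

/-- The sum of the gradients at the minimizer over a set of evaluations. -/
theorem sum_noise_sq [IsProbabilityMeasure P] [CompleteSpace E] (J : Finset ℕ) :
    IntegralLE P (fun ω => ‖∑ t ∈ J, grad wstar (ξ t ω)‖ ^ 2)
      (J.card * ∫ z, ‖grad wstar z‖ ^ 2 ∂𝒟) := by
  have h1 := IntegralLE.sum (S := J) fun t _ =>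
    IntegralLE.sum (S := J) fun u _ => h.inner_noise ho t u
  have h2 : ∑ t ∈ J, ∑ u ∈ J, (if t = u then ∫ z, ‖grad wstar z‖ ^ 2 ∂𝒟 else 0) =
      J.card * ∫ z, ‖grad wstar z‖ ^ 2 ∂𝒟 := by
    rw [Finset.sum_congr rfl fun t ht => (Finset.sum_ite_eq J t _).trans (if_pos ht),
      Finset.sum_const, nsmul_eq_mul]
  rw [h2] at h1
  convert h1 using 2 with ω
  rw [← real_inner_self_eq_norm_sq, sum_inner]
  exact Finset.sum_congr rfl fun t _ => inner_sum _ _ _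

/-- The noise of the current round is uncorrelated with the noise accumulated since the reference
point. -/
theorem inner_sum_noise [IsProbabilityMeasure P] [CompleteSpace E] {J J' : Finset ℕ}
    (hJ : Disjoint J J') (hstep : ∀ i, 0 ≤ step i) :
    IntegralLE P (fun ω => inner ℝ (∑ t ∈ J, grad wstar (ξ t ω))
      (∑ u ∈ J', step (roundOf s u) • grad wstar (ξ u ω))) 0 := by
  have h1 := IntegralLE.sum (S := J) fun t _ =>
    IntegralLE.sum (S := J') fun u _ => (h.inner_noise ho t u).const_mul (hstep (roundOf s u))
  have h2 : ∑ t ∈ J, ∑ u ∈ J', step (roundOf s u) *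
      (if t = u then ∫ z, ‖grad wstar z‖ ^ 2 ∂𝒟 else 0) = 0 :=
    Finset.sum_eq_zero fun t ht => Finset.sum_eq_zero fun u hu => by
      rw [if_neg (fun htu : t = u => Finset.disjoint_left.mp hJ ht (htu ▸ hu)), mul_zero]
  rw [h2] at h1
  convert h1 using 2 with ω
  rw [sum_inner]
  refine Finset.sum_congr rfl fun t _ => (inner_sum _ _ _).trans ?_
  exact Finset.sum_congr rfl fun u _ => real_inner_smul_right _ _ _

/-- The mean of the stochastic gradient at a point that is independent of the sample points towards
the minimizer. -/
theorem inner_grad_of_indep [IsProbabilityMeasure P] [CompleteSpace E] {B : Ω → E}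
    (hB : Measurable B) {t : ℕ} (hind : IndepFun B (ξ t) P)
    (hB2 : Integrable (fun ω => ‖B ω - wstar‖ ^ 2) P) :
    IntegralLE P (fun ω => -inner ℝ (grad (B ω) (ξ t ω)) (B ω - wstar))
      (-(μ * ∫ ω, ‖B ω - wstar‖ ^ 2 ∂P)) := by
  have : IsProbabilityMeasure 𝒟 := h.law t ▸
    Measure.isProbabilityMeasure_map (h.meas_sample t).aemeasurable
  have hmB : Measurable fun ω => grad (B ω) (ξ t ω) := ho.meas.comp (hB.prodMk (h.meas_sample t))
  have hint : Integrable (fun ω => (inner ℝ (grad (B ω) (ξ t ω)) (B ω - wstar) : ℝ)) P :=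
    integrable_inner_of_sq hmB.aestronglyMeasurable
      (hB.sub measurable_const).aestronglyMeasurable
      (ho.integrable_sq hB (h.meas_sample t) hB2 (h.noise_sq ho t).1) hB2
  refine ⟨hint.neg, ?_⟩
  rw [integral_neg, neg_le_neg_iff]
  have hmφ : Measurable fun y : E × Ξ => (inner ℝ (grad y.1 y.2) (y.1 - wstar) : ℝ) := by
    have h1 : Measurable fun y : E × Ξ => grad y.1 y.2 := ho.meas
    exact h1.inner (measurable_fst.sub measurable_const)
  have hmap : P.map (fun ω => (B ω, ξ t ω)) = (P.map B).prod 𝒟 := by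
    rw [(indepFun_iff_map_prod_eq_prod_map_map hB.aemeasurable
      (h.meas_sample t).aemeasurable).mp hind, h.law t]
  have : IsProbabilityMeasure (P.map B) := Measure.isProbabilityMeasure_map hB.aemeasurable
  have hpair : Measurable fun ω => (B ω, ξ t ω) := hB.prodMk (h.meas_sample t)
  have hintφ : Integrable (fun y : E × Ξ => (inner ℝ (grad y.1 y.2) (y.1 - wstar) : ℝ))
      ((P.map B).prod 𝒟) := by
    rw [← hmap]
    exact (integrable_map_measure hmφ.aestronglyMeasurable hpair.aemeasurable).mpr hint
  have hmsq : Measurable fun w : E => ‖w - wstar‖ ^ 2 :=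
    (measurable_id.sub measurable_const).norm.pow_const 2
  have hintsq : Integrable (fun w : E => ‖w - wstar‖ ^ 2) (P.map B) :=
    (integrable_map_measure hmsq.aestronglyMeasurable hB.aemeasurable).mpr hB2
  have e1 : ∫ ω, (inner ℝ (grad (B ω) (ξ t ω)) (B ω - wstar) : ℝ) ∂P =
      ∫ w, ∫ z, (inner ℝ (grad w z) (w - wstar) : ℝ) ∂𝒟 ∂(P.map B) := by
    rw [← integral_prod _ hintφ, ← hmap,
      integral_map hpair.aemeasurable hmφ.aestronglyMeasurable]
  have e2 : ∫ ω, ‖B ω - wstar‖ ^ 2 ∂P = ∫ w, ‖w - wstar‖ ^ 2 ∂(P.map B) :=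
    (integral_map hB.aemeasurable hmsq.aestronglyMeasurable).symm
  rw [e1, e2, ← integral_const_mul]
  refine integral_mono (hintsq.const_mul μ) hintφ.integral_prod_left fun w => ?_
  have hgw : Integrable (fun z => grad w z) 𝒟 :=
    integrable_of_sq (ho.meas.comp (measurable_const.prodMk measurable_id)).aestronglyMeasurable
      (ho.integrable_sq (b := fun _ => w) (z := id) measurable_const measurable_id (integrable_const _) ho.sq)
  have e3 : ∫ z, (inner ℝ (grad w z) (w - wstar) : ℝ) ∂𝒟 =
      inner ℝ (∫ z, grad w z ∂𝒟) (w - wstar) := by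
    rw [real_inner_comm, ← integral_inner hgw]
    exact integral_congr_ae (Eventually.of_forall fun z => real_inner_comm _ _)
  simp only [e3]
  exact ho.mono w

/-- The recursion for the mean square distances of the iterates at the beginnings of the rounds.
The parameter `lam` balances the two sides of a Young inequality. -/
theorem iterateError_succ_le [IsProbabilityMeasure P] [CompleteSpace E] (hs : ∀ i, 0 < s i)
    (hstep : ∀ i, 0 ≤ step i) {i : ℕ} (hQ : Q < i) {M v lam : ℝ} (hM0 : 0 ≤ M) (hlam : 0 < lam)
    (hM : ∀ u, roundStart s (i - 1 - Q) ≤ u → u < roundStart s (i + 1) →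
      ∫ ω, ‖x u ω - wstar‖ ^ 2 ∂P ≤ M) (hβ : L * windowSum s Q step i ≤ 1)
    (hv : crudeBound L ‖w₀ - wstar‖
      (∑ u ∈ Finset.range (roundStart s (i + Q + 1)), step (roundOf s u)) κ * δ i ≤ v)
    {N₂ β Y Z ε : ℝ} (hN : N₂ = ∫ z, ‖grad wstar z‖ ^ 2 ∂𝒟) (hβd : β = windowSum s Q step i)
    (hε : ε = iterateError P s step grad w₀ wstar ξ x (roundStart s i))
    (hY : Y = 4 * β ^ 2 * (N₂ + L ^ 2 * M) + 2 * v)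
    (hZ : Z = 80 * β ^ 2 * (N₂ + L ^ 2 * M) + 16 * L ^ 2 * β ^ 2 * ε + 4 * v) :
    iterateError P s step grad w₀ wstar ξ x (roundStart s (i + 1)) ≤
      (1 - 9 / 8 * (step i * s i * μ)) * ε + 9 / 2 * (step i * s i * μ) * Y +
      2 * (step i * s i) * (L ^ 2 / μ) * Z + 3 * step i ^ 2 * s i * N₂ +
      (lam + 2) * (step i * s i) ^ 2 * (L ^ 2 * M) + 2 * β ^ 2 * (L ^ 2 * M) + 2 * v + Y / lam := by
  have hL := ho.L_pos.le
  have hμ := ho.mu_pos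
  obtain ⟨B, H, hBm, hHm, hBind, hBeq, hBH, hHδ, hHκ⟩ := h.ref i hQ
  set g : Ω → ℕ → E := fun ω t => grad (x t ω) (ξ t ω) with hg
  set ν : Ω → ℕ → E := fun ω t => grad wstar (ξ t ω) with hν
  set j := i - 1 - Q with hj
  set J := Finset.Ico (roundStart s i) (roundStart s (i + 1)) with hJ
  set J' := Finset.Ico (roundStart s j) (roundStart s i) with hJ'
  have hji : roundStart s j ≤ roundStart s i := roundStart_mono s (by omega)
  have hii : roundStart s i ≤ roundStart s (i + 1) := roundStart_mono s (by omega)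
  have hJcard : (J.card : ℝ) = s i := by
    rw [hJ, Nat.card_Ico, roundStart_succ, Nat.add_sub_cancel_left]
  have hJround : ∀ t ∈ J, roundOf s t = i := fun t ht =>
    (roundOf_eq_iff hs).mpr ⟨(Finset.mem_Ico.mp ht).1, (Finset.mem_Ico.mp ht).2⟩
  have hJJ' : Disjoint J J' := by
    rw [Finset.disjoint_left]
    intro t ht ht'
    have h1 := (Finset.mem_Ico.mp ht).1
    have h2 := (Finset.mem_Ico.mp ht').2
    omega
  have hβ0 : 0 ≤ β := hβd ▸ windowSum_nonneg hstep i
  have hβ' : (∑ u ∈ J', step (roundOf s u)) ≤ β := hβd ▸ sum_step_le_windowSum hstep i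
  have hβ'2 : (∑ u ∈ J', step (roundOf s u)) ^ 2 ≤ β ^ 2 :=
    pow_le_pow_left₀ (Finset.sum_nonneg fun _ _ => hstep _) hβ' 2
  have hN0 : 0 ≤ N₂ := hN ▸ integral_nonneg fun _ => sq_nonneg _
  set W : Ω → ℕ → E := fun ω k => partialIterate s step w₀ (g ω) (roundStart s k) with hW
  set D : Ω → E := fun ω => W ω i - wstar with hD
  set V : Ω → E := fun ω => W ω j - B ω with hV
  set N' : Ω → E := fun ω => ∑ u ∈ J', step (roundOf s u) • ν ω u with hN'
  set R' : Ω → E := fun ω => ∑ u ∈ J', step (roundOf s u) • (g ω u - ν ω u) with hR'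
  -- measurability
  have hgm : ∀ t, Measurable fun ω => g ω t := h.measurable_grad ho
  have hνm : ∀ t, Measurable fun ω => ν ω t := h.measurable_noise ho
  have hWm : ∀ k, Measurable fun ω => W ω k := fun k => h.measurable_partialIterate ho _
  have hDm : Measurable D := (hWm i).sub measurable_const
  have hVm : Measurable V := (hWm j).sub hBm
  have hN'm : Measurable N' := Finset.measurable_fun_sum _ fun u _ => (hνm u).const_smul _
  have hR'm : Measurable R' :=
    Finset.measurable_fun_sum _ fun u _ => ((hgm u).sub (hνm u)).const_smul _
  have hbm : Measurable fun ω => B ω - wstar := hBm.sub measurable_const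
  -- second moments
  have hN'2 : IntegralLE P (fun ω => ‖N' ω‖ ^ 2) (β ^ 2 * N₂) :=
    (IntegralLE.norm_sum_smul_sq (fun u _ => hstep _) (fun u => (hνm u).aestronglyMeasurable)
      fun u _ => h.noise_sq ho u).mono (by
        rw [← hN]; exact mul_le_mul_of_nonneg_right hβ'2 hN0)
  have hρ2 : ∀ u, roundStart s j ≤ u → u < roundStart s (i + 1) →
      IntegralLE P (fun ω => ‖g ω u - ν ω u‖ ^ 2) (L ^ 2 * M) := fun u hu hu' =>
    h.excess_sq ho hs hstep (hM u hu hu')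
  have hR'2 : IntegralLE P (fun ω => ‖R' ω‖ ^ 2) (β ^ 2 * (L ^ 2 * M)) :=
    (IntegralLE.norm_sum_smul_sq (fun u _ => hstep _)
      (fun u => ((hgm u).sub (hνm u)).aestronglyMeasurable)
      fun u hu => hρ2 u (Finset.mem_Ico.mp hu).1 ((Finset.mem_Ico.mp hu).2.trans_le hii)).mono
        (mul_le_mul_of_nonneg_right hβ'2 (by positivity))
  have hV2 : IntegralLE P (fun ω => ‖V ω‖ ^ 2) v := by
    have h1 : IntegralLE (P.restrict H) (fun ω => ‖W ω j - wstar‖ ^ 2) v :=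
      (((h.crude_restrict ho hs hstep i hHδ hHκ rfl).2 (roundStart s j)
        (roundStart_mono s (by omega)))).mono hv
    have h2 : ∀ᵐ ω ∂P, H.indicator (fun ω => ‖W ω j - wstar‖ ^ 2) ω = ‖V ω‖ ^ 2 := by
      filter_upwards [hBeq] with ω hω
      by_cases hωH : ω ∈ H
      · rw [Set.indicator_of_mem hωH, hV]
        simp only [hBH ω hωH]
      · rw [Set.indicator_of_notMem hωH, hV]
        simp only [hω hωH]
        simp [hW, hg, hj]
    refine ⟨(integrable_congr h2).mp ((integrable_indicator_iff hHm).mpr h1.1), ?_⟩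
    rw [← integral_congr_ae h2, integral_indicator hHm]
    exact h1.2
  have hDb : ∀ ω, D ω - (B ω - wstar) = -N' ω - R' ω + V ω := by
    intro ω
    have h1 : W ω i = W ω j - (N' ω + R' ω) := by
      simp only [hW]
      rw [partialIterate_sub hji, hN', hR']
      simp only
      rw [← Finset.sum_add_distrib]
      congr 1
      refine Finset.sum_congr rfl fun u _ => ?_
      rw [← smul_add, add_sub_cancel]
    simp only [hD, hV, h1]
    abel
  have hDb2 : IntegralLE P (fun ω => ‖D ω - (B ω - wstar)‖ ^ 2) Y := by
    refine (((hN'2.const_mul (by norm_num : (0 : ℝ) ≤ 4)).add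
      (hR'2.const_mul (by norm_num : (0 : ℝ) ≤ 4))).add (hV2.const_mul zero_le_two)).of_le
      ((hDm.sub hbm).norm.pow_const 2).aestronglyMeasurable (fun ω => sq_nonneg _)
      (Eventually.of_forall fun ω => ?_) |>.mono (le_of_eq (by rw [hY]; ring))
    change ‖D ω - (B ω - wstar)‖ ^ 2 ≤ _
    rw [hDb ω]
    have h1 := norm_add_sq_le (-N' ω - R' ω) (V ω)
    have h2 := norm_sub_sq_le (-N' ω) (R' ω)
    rw [norm_neg] at h2
    linarith
  have hRV2 : IntegralLE P (fun ω => ‖R' ω - V ω‖ ^ 2) (2 * (β ^ 2 * (L ^ 2 * M)) + 2 * v) :=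
    ((hR'2.const_mul zero_le_two).add (hV2.const_mul zero_le_two)).of_le
      ((hR'm.sub hVm).norm.pow_const 2).aestronglyMeasurable (fun ω => sq_nonneg _)
      (Eventually.of_forall fun ω => norm_sub_sq_le _ _)
  have hD2 : IntegralLE P (fun ω => ‖D ω‖ ^ 2) ε :=
    ⟨h.integrable_partialIterate ho hs hstep _, le_of_eq hε.symm⟩
  have hb2 : Integrable (fun ω => ‖B ω - wstar‖ ^ 2) P := by
    refine ((hD2.const_mul zero_le_two).add (hDb2.const_mul zero_le_two)).of_le
      (hbm.norm.pow_const 2).aestronglyMeasurable (fun ω => sq_nonneg _)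
      (Eventually.of_forall fun ω => ?_) |>.1
    have := norm_sub_sq_le (D ω) (D ω - (B ω - wstar))
    rwa [sub_sub_cancel] at this
  set bb := ∫ ω, ‖B ω - wstar‖ ^ 2 ∂P with hbb
  have hbbL : IntegralLE P (fun ω => ‖B ω - wstar‖ ^ 2) bb := ⟨hb2, le_rfl⟩
  have hx2 : ∀ t ∈ J, IntegralLE P (fun ω => ‖x t ω - B ω‖ ^ 2) Z := by
    intro t ht
    have h1 := h.model_sub_iterate ho hs hstep (hJround t ht) hM0
      (fun u hu hu' => hM u hu (hu'.trans_le hii)) hβ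
    rw [← hN, ← hβd, ← hε] at h1
    refine ((h1.const_mul zero_le_two).add (hDb2.const_mul zero_le_two)).of_le
      (((h.meas_model t).sub hBm).norm.pow_const 2).aestronglyMeasurable (fun ω => sq_nonneg _)
      (Eventually.of_forall fun ω => ?_) |>.mono (le_of_eq (by rw [hY, hZ]; ring))
    have h2 := norm_add_sq_le (x t ω - W ω i) (D ω - (B ω - wstar))
    have h3 : x t ω - W ω i + (D ω - (B ω - wstar)) = x t ω - B ω := by simp only [hD]; abel
    rw [h3] at h2
    exact h2
  have hν2 : IntegralLE P (fun ω => ‖∑ t ∈ J, ν ω t‖ ^ 2) (s i * N₂) := by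
    have := h.sum_noise_sq ho J
    rwa [hJcard, ← hN] at this
  have hρsum2 : IntegralLE P (fun ω => ‖∑ t ∈ J, (g ω t - ν ω t)‖ ^ 2)
      ((s i : ℝ) ^ 2 * (L ^ 2 * M)) := by
    have h1 := IntegralLE.norm_sum_smul_sq (S := J) (c := fun _ => 1)
      (z := fun u ω => g ω u - ν ω u) (fun u _ => zero_le_one) (fun u => ((hgm u).sub (hνm u)).aestronglyMeasurable)
      fun u hu => hρ2 u (hji.trans (Finset.mem_Ico.mp hu).1) (Finset.mem_Ico.mp hu).2
    simpa only [one_smul, Finset.sum_const, nsmul_eq_mul, mul_one, hJcard] using h1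
  have hin : IntegralLE P (fun ω => inner ℝ (∑ t ∈ J, ν ω t) (N' ω)) 0 :=
    h.inner_sum_noise ho hJJ' hstep
  have hdrift : IntegralLE P
      (fun ω => ∑ t ∈ J, -inner ℝ (grad (B ω) (ξ t ω)) (B ω - wstar)) (s i * -(μ * bb)) := by
    have := IntegralLE.sum (S := J) fun t ht =>
      h.inner_grad_of_indep ho hBm (hBind t (hJround t ht)) hb2
    rwa [Finset.sum_const, nsmul_eq_mul, hJcard] at this
  have hyoung : IntegralLE P
      (fun ω => ∑ t ∈ J, (μ / 4 * ‖B ω - wstar‖ ^ 2 + L ^ 2 / μ * ‖x t ω - B ω‖ ^ 2))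
      (s i * (μ / 4 * bb + L ^ 2 / μ * Z)) := by
    have := IntegralLE.sum (S := J) fun t ht =>
      (hbbL.const_mul (by positivity : 0 ≤ μ / 4)).add
        ((hx2 t ht).const_mul (by positivity : 0 ≤ L ^ 2 / μ))
    rwa [Finset.sum_const, nsmul_eq_mul, hJcard] at this
  set η := step i with hη
  have hη0 : 0 ≤ η := hstep i
  have hη2 : 0 ≤ 2 * η := by positivity
  -- combine
  have htotal := ((((((hD2.add (hdrift.const_mul hη2)).add (hyoung.const_mul hη2)).add
    (hin.const_mul hη2)).add ((hν2.const_mul (sq_nonneg η)).add hRV2)).add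
    (((hρsum2.const_mul (sq_nonneg η)).const_mul hlam.le).add
      (hDb2.const_mul (inv_nonneg.mpr hlam.le)))).add
    ((hν2.add hρsum2).const_mul (by positivity : 0 ≤ 2 * η ^ 2)))
  have hfinal := htotal.of_le (f := fun ω => ‖W ω (i + 1) - wstar‖ ^ 2)
    ((((hWm (i + 1)).sub measurable_const).norm.pow_const 2).aestronglyMeasurable)
    (fun ω => sq_nonneg _) (Eventually.of_forall fun ω => by
      have h1 : W ω (i + 1) - wstar = D ω - η • ∑ t ∈ J, g ω t := by
        simp only [hW, hD]
        rw [partialIterate_sub hii, Finset.smul_sum, sub_right_comm]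
        congr 1
        exact Finset.sum_congr rfl fun t ht => by rw [hJround t ht]
      have h2 := norm_sub_smul_sum_sq_le J (D ω) (B ω - wstar) (N' ω) (R' ω) (V ω) (g ω) (ν ω)
        (fun t => g ω t - ν ω t) (fun t => grad (B ω) (ξ t ω)) (fun t => ‖x t ω - B ω‖)
        hη0 hμ hlam (hDb ω) (fun t _ => (add_sub_cancel _ _).symm) (fun t _ => ho.lip _ _ _)
      rw [h1]
      refine h2.trans (le_of_eq ?_)
      rw [Finset.sum_neg_distrib]
      ring)
  -- the lower bound for the second moment of `B - wstar`
  have hbb_ge : 3 / 4 * ε - 3 * Y ≤ bb := by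
    have h1 : IntegralLE P (fun ω => ‖D ω‖ ^ 2) (4 / 3 * bb + 4 * Y) :=
      ((hbbL.const_mul (by norm_num : (0 : ℝ) ≤ 4 / 3)).add
        (hDb2.const_mul (by norm_num : (0 : ℝ) ≤ 4))).of_le
        (hDm.norm.pow_const 2).aestronglyMeasurable (fun ω => sq_nonneg _)
        (Eventually.of_forall fun ω => by
          have h2 := norm_le_norm_add_norm_sub' (D ω) (B ω - wstar)
          have h3 := pow_le_pow_left₀ (norm_nonneg _) h2 2
          refine h3.trans ?_
          nlinarith [sq_nonneg (‖B ω - wstar‖ - 3 * ‖D ω - (B ω - wstar)‖)])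
    have h2 : ε ≤ 4 / 3 * bb + 4 * Y := hε ▸ h1.2
    linarith
  refine hfinal.2.trans ?_
  have hc : 0 ≤ 3 / 2 * (η * s i * μ) := by positivity
  have := mul_le_mul_of_nonneg_left hbb_ge hc
  rw [div_eq_inv_mul Y lam]
  linarith

end StaleSGD

end RoundMoments

/-! ### Convergence rate of SGD with stale gradients -/

section Rate

/-- The remainder terms of the round recursion in terms of `r = 1 / i`, the relative size `q` of
round `i` and a bound `T` for the mean square distance: they are small compared with `q * T`, up
to a multiple of `q * r ^ 2`. -/
theorem exists_remainder_constants {L μ N₂ Cβ Cv Cm Cq : ℝ} (hL : 0 < L) (hμ : 0 < μ)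
    (hN : 0 ≤ N₂) (hCv : 0 ≤ Cv) (hCm : 0 < Cm) (hCq : 0 < Cq) :
    ∃ c₁ c₂ lam : ℝ, 0 < lam ∧ ∀ {r q p T β ε Y Z : ℝ}, 0 < r → r ≤ 1 → r ≤ 2 * q →
      q ≤ Cq * r → 0 ≤ p → p * μ ≤ 12 * q → 0 ≤ T → 0 ≤ β → β ≤ Cβ * r → ε ≤ T →
      Y = 4 * β ^ 2 * (N₂ + L ^ 2 * (Cm * T)) + 2 * (Cv * r ^ 3) →
      Z = 80 * β ^ 2 * (N₂ + L ^ 2 * (Cm * T)) + 16 * L ^ 2 * β ^ 2 * ε + 4 * (Cv * r ^ 3) →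
      9 / 2 * (p * μ) * Y + 2 * p * (L ^ 2 / μ) * Z + (lam / r + 2) * p ^ 2 * (L ^ 2 * (Cm * T)) +
        2 * β ^ 2 * (L ^ 2 * (Cm * T)) + 2 * (Cv * r ^ 3) + Y / (lam / r) ≤
      q * (c₁ * r ^ 2) + q * T * (1 + c₂ * r) := by
  set G : ℝ := 144 * Cq / μ ^ 2 * (L ^ 2 * Cm) with hG
  have hG0 : 0 < G := by positivity
  set y₁ : ℝ := 4 * Cβ ^ 2 * N₂ + 2 * Cv with hy₁
  set y₂ : ℝ := 4 * Cβ ^ 2 * (L ^ 2 * Cm) with hy₂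
  set z₁ : ℝ := 80 * Cβ ^ 2 * N₂ + 4 * Cv with hz₁
  set z₂ : ℝ := 80 * Cβ ^ 2 * (L ^ 2 * Cm) + 16 * L ^ 2 * Cβ ^ 2 with hz₂
  refine ⟨54 * y₁ + 24 * (L ^ 2 / μ ^ 2) * z₁ + 4 * Cv + 2 * G * y₁,
    54 * y₂ + 24 * (L ^ 2 / μ ^ 2) * z₂ + 2 * G * y₂ + 2 * G + 4 * Cβ ^ 2 * (L ^ 2 * Cm), 1 / G,
    by positivity, ?_⟩
  intro r q p T β ε Y Z hr hr1 hrq hqr hp hpq hT hβ hβr hε hY hZ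
  have hq : 0 < q := by linarith
  have hr2 : r ^ 2 ≤ r := by nlinarith
  have hr3 : r ^ 3 ≤ r ^ 2 := by nlinarith [sq_nonneg r]
  have hr3q : r ^ 3 ≤ 2 * q * r ^ 2 := by nlinarith [sq_nonneg r]
  have hr2q : r ^ 2 ≤ 2 * q * r := by nlinarith
  have hβ2 : β ^ 2 ≤ Cβ ^ 2 * r ^ 2 := by rw [← mul_pow]; exact pow_le_pow_left₀ hβ hβr 2
  have hA : 0 ≤ L ^ 2 * (Cm * T) := by positivity
  have hY' : Y ≤ r ^ 2 * (y₁ + y₂ * T) := by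
    have h1 := mul_le_mul_of_nonneg_right hβ2 (add_nonneg hN hA)
    have h2 := mul_le_mul_of_nonneg_left hr3 hCv
    rw [hY, hy₁, hy₂]
    linarith
  have hZ' : Z ≤ r ^ 2 * (z₁ + z₂ * T) := by
    have h1 := mul_le_mul_of_nonneg_right hβ2 (add_nonneg hN hA)
    have h2 := mul_le_mul_of_nonneg_left hr3 hCv
    have h3 : L ^ 2 * β ^ 2 * ε ≤ L ^ 2 * (Cβ ^ 2 * r ^ 2) * T :=
      (mul_le_mul_of_nonneg_left hε (by positivity)).trans (by gcongr)
    rw [hZ, hz₁, hz₂]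
    linarith
  have hyT : 0 ≤ y₁ + y₂ * T := by positivity
  have hzT : 0 ≤ z₁ + z₂ * T := by positivity
  have hpμ : 0 ≤ p * μ := by positivity
  have t1 : 9 / 2 * (p * μ) * Y ≤ 54 * q * (r ^ 2 * (y₁ + y₂ * T)) := by
    have h1 : p * μ * Y ≤ 12 * q * (r ^ 2 * (y₁ + y₂ * T)) := by
      calc p * μ * Y ≤ p * μ * (r ^ 2 * (y₁ + y₂ * T)) := by gcongr
        _ ≤ _ := by gcongr
    linarith
  have hp' : p ≤ 12 * q / μ := by rwa [le_div_iff₀ hμ]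
  have t2 : 2 * p * (L ^ 2 / μ) * Z ≤ 24 * q * (L ^ 2 / μ ^ 2) * (r ^ 2 * (z₁ + z₂ * T)) := by
    calc 2 * p * (L ^ 2 / μ) * Z ≤ 2 * p * (L ^ 2 / μ) * (r ^ 2 * (z₁ + z₂ * T)) := by gcongr
      _ ≤ 2 * (12 * q / μ) * (L ^ 2 / μ) * (r ^ 2 * (z₁ + z₂ * T)) := by gcongr
      _ = _ := by field_simp; ring
  have t3 : (1 / G / r + 2) * p ^ 2 * (L ^ 2 * (Cm * T)) ≤ q * T * (1 + 2 * G * r) := by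
    have h1 : p ^ 2 ≤ (144 * Cq / μ ^ 2) * (q * r) := by
      calc p ^ 2 ≤ (12 * q / μ) ^ 2 := pow_le_pow_left₀ hp hp' 2
        _ = 144 / μ ^ 2 * (q * q) := by ring
        _ ≤ 144 / μ ^ 2 * (q * (Cq * r)) := by gcongr
        _ = _ := by ring
    calc (1 / G / r + 2) * p ^ 2 * (L ^ 2 * (Cm * T))
        ≤ (1 / G / r + 2) * ((144 * Cq / μ ^ 2) * (q * r)) * (L ^ 2 * (Cm * T)) := by gcongr
      _ = (1 / G / r + 2) * (G * (q * r)) * T := by rw [hG]; ring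
      _ = q * T * (1 + 2 * G * r) := by field_simp
  have t4 : 2 * β ^ 2 * (L ^ 2 * (Cm * T)) ≤ q * T * (4 * Cβ ^ 2 * (L ^ 2 * Cm) * r) := by
    calc 2 * β ^ 2 * (L ^ 2 * (Cm * T)) ≤ 2 * (Cβ ^ 2 * (2 * q * r)) * (L ^ 2 * (Cm * T)) := by
          gcongr; exact hβ2.trans (by gcongr)
      _ = _ := by ring
  have t5 : 2 * (Cv * r ^ 3) ≤ 4 * Cv * q * r ^ 2 := by
    have := mul_le_mul_of_nonneg_left hr3q hCv
    linarith
  have t6 : Y / (1 / G / r) ≤ 2 * G * (q * (r ^ 2 * (y₁ + y₂ * T))) := by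
    have h1 : Y / (1 / G / r) = G * r * Y := by field_simp
    rw [h1]
    calc G * r * Y ≤ G * r * (r ^ 2 * (y₁ + y₂ * T)) := by gcongr
      _ ≤ G * (2 * q) * (r ^ 2 * (y₁ + y₂ * T)) := by gcongr
      _ = _ := by ring
  have h7 : q * T * ((54 * y₂ + 24 * (L ^ 2 / μ ^ 2) * z₂ + 2 * G * y₂) * r ^ 2) ≤
      q * T * ((54 * y₂ + 24 * (L ^ 2 / μ ^ 2) * z₂ + 2 * G * y₂) * r) := by gcongr
  linarith

theorem le_div_add_div_sq_succ {a K S z i : ℝ} (ha : 0 ≤ a) (hK : 0 ≤ K) (hS : 0 < S) (hz : 0 ≤ z)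
    (hi : 0 < i) : (1 - z / S) * (a / S) + (1 - 2 * (1 / i)) * (K * (1 / i) ^ 2) ≤
      a / (S + z) + K / (i + 1) ^ 2 := by
  have h1 : (1 - z / S) * (a / S) ≤ a / (S + z) := by
    have e : (1 - z / S) * (a / S) = a * (S - z) / S ^ 2 := by field_simp
    rw [e, div_le_div_iff₀ (by positivity) (by positivity)]
    have : (S - z) * (S + z) ≤ S ^ 2 := by nlinarith [sq_nonneg z]
    nlinarith
  have h2 : (1 - 2 * (1 / i)) * (K * (1 / i) ^ 2) ≤ K / (i + 1) ^ 2 := by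
    have e : (1 - 2 * (1 / i)) * (K * (1 / i) ^ 2) = K * (i - 2) / i ^ 3 := by field_simp
    rw [e, div_le_div_iff₀ (by positivity) (by positivity)]
    have : (i - 2) * (i + 1) ^ 2 ≤ i ^ 3 := by nlinarith
    nlinarith
  exact add_le_add h1 h2

/-- The bookkeeping of one step of the recursion: `u = a / S` and `k = K / i ^ 2` are the two parts
of the bound for round `i`. -/
theorem rate_step {r q c₁ c₂ K u k ε ε' bound p noise rest : ℝ} (hrq : r ≤ 2 * q) (hq : 0 ≤ q)
    (hu : 0 ≤ u) (hk : k = K * r ^ 2) (hK : 0 ≤ K) (hc₁ : c₁ ≤ K) (hc₂ : c₂ * r ≤ 1)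
    (hε : ε ≤ u + k) (hp : 11 * q ≤ p) (hp1 : p ≤ 8 / 9) (hnoise : noise ≤ 54 / 25 * (q * u))
    (hrest : rest ≤ q * (c₁ * r ^ 2) + q * (u + k) * (1 + c₂ * r))
    (hbound : (1 - q) * u + (1 - 2 * r) * k ≤ bound)
    (h : ε' ≤ (1 - 9 / 8 * p) * ε + noise + rest) : ε' ≤ bound := by
  have hk0 : 0 ≤ k := by rw [hk]; positivity
  have h1 : (1 - 9 / 8 * p) * ε ≤ (1 - 99 / 8 * q) * (u + k) :=
    (mul_le_mul_of_nonneg_left hε (by linarith)).trans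
      (mul_le_mul_of_nonneg_right (by linarith) (by linarith))
  have h2 : q * (u + k) * (1 + c₂ * r) ≤ q * (u + k) * 2 := by
    have : 0 ≤ q * (u + k) := by positivity
    gcongr
    linarith
  have h3 : q * (c₁ * r ^ 2) ≤ q * k := by rw [hk]; gcongr
  have h4 : r * k ≤ 2 * q * k := by gcongr
  have h5 : 0 ≤ q * u := by positivity
  have h6 : 0 ≤ q * k := by positivity
  linarith

variable {Ω : Type*} [MeasurableSpace Ω] {P : Measure Ω}
  {E : Type*} [NormedAddCommGroup E] [InnerProductSpace ℝ E]
  {Ξ : Type*} [MeasurableSpace Ξ] [MeasurableSpace E]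
  [BorelSpace E] [SecondCountableTopology E]
  {𝒟 : Measure Ξ} {s : ℕ → ℕ} {Q : ℕ} {step : ℕ → ℝ} {grad : E → Ξ → E}
  {w₀ wstar : E} {δ : ℕ → ℝ} {κ L μ : ℝ} {ξ : ℕ → Ω → Ξ} {x : ℕ → Ω → E}

/-- The mean square distance of an iterate inside of a round. -/
theorem StaleSGD.iterateError_le (h : StaleSGD P 𝒟 s Q step grad w₀ wstar δ κ ξ x)
    (ho : StochasticGradient 𝒟 grad wstar L μ) [IsProbabilityMeasure P]
    (hs : ∀ i, 0 < s i) (hstep : ∀ i, 0 ≤ step i)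
    {i t : ℕ} (ht : roundOf s t = i) {M : ℝ} (hM0 : 0 ≤ M)
    (hM : ∀ u, roundStart s i ≤ u → u < roundStart s (i + 1) →
      ∫ ω, ‖x u ω - wstar‖ ^ 2 ∂P ≤ M) :
    iterateError P s step grad w₀ wstar ξ x t ≤
      2 * iterateError P s step grad w₀ wstar ξ x (roundStart s i) +
        4 * windowSum s Q step i ^ 2 * (∫ z, ‖grad wstar z‖ ^ 2 ∂𝒟 + L ^ 2 * M) := by
  obtain ⟨ht1, ht2⟩ := (roundOf_eq_iff hs).mp ht
  have hβ : ∑ u ∈ Finset.Ico (roundStart s i) t, step (roundOf s u) ≤ windowSum s Q step i := by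
    have h1 : roundStart s (i - 1 - Q) ≤ roundStart s i := roundStart_mono s (by omega)
    have h2 : roundStart s (i + 1) ≤ roundStart s (i + Q + 1) := roundStart_mono s (by omega)
    exact Finset.sum_le_sum_of_subset_of_nonneg (Finset.Ico_subset_Ico h1 (by omega))
      fun _ _ _ => hstep _
  have hβ2 := pow_le_pow_left₀ (Finset.sum_nonneg fun u _ => hstep (roundOf s u)) hβ 2
  have h1 := IntegralLE.norm_sum_smul_sq (P := P) (S := Finset.Ico (roundStart s i) t)
    (c := fun u => step (roundOf s u)) (z := fun u ω => grad wstar (ξ u ω)) (fun u _ => hstep _)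
    (fun u => (h.measurable_noise ho u).aestronglyMeasurable) fun u _ => h.noise_sq ho u
  have h2 := IntegralLE.norm_sum_smul_sq (P := P) (S := Finset.Ico (roundStart s i) t)
    (c := fun u => step (roundOf s u))
    (z := fun u ω => grad (x u ω) (ξ u ω) - grad wstar (ξ u ω)) (fun u _ => hstep _)
    (fun u => ((h.measurable_grad ho u).sub (h.measurable_noise ho u)).aestronglyMeasurable)
    fun u hu => h.excess_sq ho hs hstep
      (hM u (Finset.mem_Ico.mp hu).1 ((Finset.mem_Ico.mp hu).2.trans ht2))
  have h3 : IntegralLE P (fun ω => ‖partialIterate s step w₀ (fun t => grad (x t ω) (ξ t ω))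
      (roundStart s i) - wstar‖ ^ 2) (iterateError P s step grad w₀ wstar ξ x (roundStart s i)) :=
    ⟨h.integrable_partialIterate ho hs hstep _, le_rfl⟩
  have h4 := (((h3.const_mul zero_le_two).add (h1.const_mul (by norm_num : (0 : ℝ) ≤ 4))).add
    (h2.const_mul (by norm_num : (0 : ℝ) ≤ 4))).of_le
    (f := fun ω => ‖partialIterate s step w₀ (fun t => grad (x t ω) (ξ t ω)) t - wstar‖ ^ 2)
    (h.integrable_partialIterate ho hs hstep _).1 (fun ω => sq_nonneg _)
    (Eventually.of_forall fun ω => by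
      have e1 : partialIterate s step w₀ (fun t => grad (x t ω) (ξ t ω)) t - wstar =
          (partialIterate s step w₀ (fun t => grad (x t ω) (ξ t ω)) (roundStart s i) - wstar) -
          (∑ u ∈ Finset.Ico (roundStart s i) t, step (roundOf s u) • grad wstar (ξ u ω) +
          ∑ u ∈ Finset.Ico (roundStart s i) t, step (roundOf s u) •
            (grad (x u ω) (ξ u ω) - grad wstar (ξ u ω))) := by
        rw [partialIterate_sub ht1, ← Finset.sum_add_distrib, sub_right_comm]
        congr 1
        refine Finset.sum_congr rfl fun u _ => ?_
        rw [← smul_add, add_sub_cancel]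
      rw [e1]
      refine (norm_sub_sq_le _ _).trans ?_
      have e2 := norm_add_sq_le
        (∑ u ∈ Finset.Ico (roundStart s i) t, step (roundOf s u) • grad wstar (ξ u ω))
        (∑ u ∈ Finset.Ico (roundStart s i) t, step (roundOf s u) •
            (grad (x u ω) (ξ u ω) - grad wstar (ξ u ω)))
      linarith)
  have hN0 : 0 ≤ ∫ z, ‖grad wstar z‖ ^ 2 ∂𝒟 := integral_nonneg fun _ => sq_nonneg _
  have h5 := mul_le_mul_of_nonneg_right hβ2 (add_nonneg hN0
    (by positivity : 0 ≤ L ^ 2 * M))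
  refine h4.2.trans ?_
  linarith

theorem roundStart_add_le_two_pow {i₁ : ℕ} (h : ∀ i ≥ i₁, (roundStart s (i + 1) : ℝ) ≤
    2 * roundStart s i) {j : ℕ} (hj : i₁ ≤ j) (k : ℕ) :
    (roundStart s (j + k) : ℝ) ≤ 2 ^ k * roundStart s j := by
  induction k with
  | zero => simp
  | succ k ih =>
    have := h (j + k) (by omega)
    rw [← add_assoc, pow_succ]
    linarith

/-- The bounds `a / S_i + K / i ^ 2` vary only by a constant factor over the window of a round. -/
theorem rate_window (hs : ∀ i, 0 < s i) {i₁ : ℕ} (hi₁ : ∀ i ≥ i₁, (roundStart s (i + 1) : ℝ) ≤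
    2 * roundStart s i) {a K : ℝ} (ha : 0 ≤ a) (hK : 0 ≤ K) {i j : ℕ} (hi : i₁ + 2 * (Q + 2) ≤ i)
    (hj : i - 1 - Q ≤ j) (hji : j ≤ i) :
    3 * (a / roundStart s j + K / (j : ℝ) ^ 2) ≤
      3 * 2 ^ (Q + 2) * (a / roundStart s i + K / (i : ℝ) ^ 2) := by
  have h1 := roundStart_add_le_two_pow hi₁ (by omega : i₁ ≤ j) (i - j)
  rw [Nat.add_sub_cancel' hji] at h1
  have h2 : (2 : ℝ) ^ (i - j) ≤ 2 ^ (Q + 2) := pow_le_pow_right₀ one_le_two (by omega)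
  have hS0 : ∀ i : ℕ, 1 ≤ i → (0 : ℝ) < roundStart s i := fun i hi => by
    have := le_roundStart hs i
    exact_mod_cast (by omega : 0 < roundStart s i)
  have hSj := hS0 j (by omega)
  have hSi := hS0 i (by omega)
  have hj0 : (0 : ℝ) < j := by exact_mod_cast (by omega : 0 < j)
  have hi0 : (0 : ℝ) < i := by exact_mod_cast (by omega : 0 < i)
  have h3 : a / roundStart s j ≤ 2 ^ (Q + 2) * (a / roundStart s i) := by
    rw [← mul_div_assoc, div_le_div_iff₀ hSj hSi]
    have : (roundStart s i : ℝ) ≤ 2 ^ (Q + 2) * roundStart s j :=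
      h1.trans (mul_le_mul_of_nonneg_right h2 hSj.le)
    calc a * roundStart s i ≤ a * (2 ^ (Q + 2) * roundStart s j) := by gcongr
      _ = _ := by ring
  have h4 : K / (j : ℝ) ^ 2 ≤ 2 ^ (Q + 2) * (K / (i : ℝ) ^ 2) := by
    rw [← mul_div_assoc, div_le_div_iff₀ (by positivity) (by positivity)]
    have h5 : (i : ℝ) ≤ 2 * j := by exact_mod_cast (by omega : i ≤ 2 * j)
    have h6 : (i : ℝ) ^ 2 ≤ (2 * j) ^ 2 := pow_le_pow_left₀ hi0.le h5 2
    have h7 : (1 : ℝ) ≤ 2 ^ Q := one_le_pow₀ one_le_two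
    calc K * (i : ℝ) ^ 2 ≤ K * (2 * j) ^ 2 := by gcongr
      _ = 1 * (4 * K * (j : ℝ) ^ 2) := by ring
      _ ≤ 2 ^ Q * (4 * K * (j : ℝ) ^ 2) := by gcongr
      _ = _ := by ring
  linarith

/-- From the iterate at the beginning of a round to all models and iterates of the round. -/
theorem StaleSGD.round_le (h : StaleSGD P 𝒟 s Q step grad w₀ wstar δ κ ξ x)
    (ho : StochasticGradient 𝒟 grad wstar L μ) [IsProbabilityMeasure P]
    (hs : ∀ i, 0 < s i) (hstep : ∀ i, 0 ≤ step i) {i : ℕ} {M T : ℝ}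
    (hM : ∀ u, roundStart s (i - 1 - Q) ≤ u → u < roundStart s i →
      ∫ ω, ‖x u ω - wstar‖ ^ 2 ∂P ≤ M) (hβ : L * windowSum s Q step i ≤ 1)
    (hT : iterateError P s step grad w₀ wstar ξ x (roundStart s i) ≤ T) (hTM : 3 * T ≤ M)
    (hsmall : 36 * windowSum s Q step i ^ 2 * (∫ z, ‖grad wstar z‖ ^ 2 ∂𝒟 + L ^ 2 * M) +
      8 * L ^ 2 * windowSum s Q step i ^ 2 * T ≤ T / 2) {t : ℕ} (ht : roundOf s t = i) :
    ∫ ω, ‖x t ω - wstar‖ ^ 2 ∂P ≤ 3 * T ∧ iterateError P s step grad w₀ wstar ξ x t ≤ 3 * T := by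
  have hT0 : 0 ≤ T := le_trans (integral_nonneg fun _ => sq_nonneg _) hT
  have hM0 : 0 ≤ M := by linarith
  have hmod : ∀ t, roundOf s t = i → ∫ ω, ‖x t ω - wstar‖ ^ 2 ∂P ≤ 3 * T := by
    intro t ht
    have h1 := h.model_sub_iterate ho hs hstep ht hM0 hM hβ
    have h3 : IntegralLE P (fun ω => ‖partialIterate s step w₀ (fun t => grad (x t ω) (ξ t ω))
        (roundStart s i) - wstar‖ ^ 2) T :=
      ⟨h.integrable_partialIterate ho hs hstep _, hT⟩
    have h4 := ((h1.const_mul zero_le_two).add (h3.const_mul zero_le_two)).of_le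
      (f := fun ω => ‖x t ω - wstar‖ ^ 2) (h.integrable_model ho hs hstep t).1
      (fun ω => sq_nonneg _) (Eventually.of_forall fun ω => by
        have := norm_add_sq_le
          (x t ω - partialIterate s step w₀ (fun t => grad (x t ω) (ξ t ω)) (roundStart s i))
          (partialIterate s step w₀ (fun t => grad (x t ω) (ξ t ω)) (roundStart s i) - wstar)
        rwa [sub_add_sub_cancel] at this)
    have h5 := mul_le_mul_of_nonneg_left hT
      (by positivity : 0 ≤ 8 * L ^ 2 * windowSum s Q step i ^ 2)
    have h6 := h4.2
    linarith
  refine ⟨hmod t ht, ?_⟩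
  have h1 := h.iterateError_le ho hs hstep ht hM0 fun u hu hu' =>
    (hmod u ((roundOf_eq_iff hs).mpr ⟨hu, hu'⟩)).trans hTM
  have h2 : 0 ≤ windowSum s Q step i ^ 2 * (∫ z, ‖grad wstar z‖ ^ 2 ∂𝒟 + L ^ 2 * M) :=
    mul_nonneg (sq_nonneg _)
      (add_nonneg (integral_nonneg fun _ => sq_nonneg _) (by positivity))
  have h3 : 0 ≤ 8 * L ^ 2 * windowSum s Q step i ^ 2 * T := by positivity
  linarith

set_option maxHeartbeats 600000 in
/-- Rate of convergence per round: the mean square distances in round `i` are bounded by a multiple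
of the inverse number of preceding evaluations, up to a multiple of `1 / i ^ 2` that only depends
on the parameters. -/
theorem StaleSGD.exists_round_bound [IsProbabilityMeasure P] [CompleteSpace E]
    (ho : StochasticGradient 𝒟 grad wstar L μ) (hs : ∀ i, 0 < s i) (hstep : ∀ i, 0 ≤ step i)
    {Cβ Cv Cq : ℝ} (hCv : 0 ≤ Cv) (hCq : 0 < Cq)
    (hβ : ∀ᶠ i : ℕ in atTop, windowSum s Q step i ≤ Cβ / i)
    (hv : ∀ᶠ i : ℕ in atTop, crudeBound L ‖w₀ - wstar‖
      (∑ u ∈ Finset.range (roundStart s (i + Q + 1)), step (roundOf s u)) κ * δ i ≤ Cv / i ^ 3)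
    (h12 : ∀ i, step i * roundStart s i ≤ 12 / μ)
    (h11 : ∀ᶠ i in atTop, 11 / μ ≤ step i * roundStart s i)
    (hS2 : ∀ᶠ i in atTop, (roundStart s (i + 1) : ℝ) ≤ 2 * roundStart s i)
    (hq : ∀ᶠ i : ℕ in atTop, (roundStart s i : ℝ) ≤ 2 * (i * s i))
    (hq' : ∀ᶠ i : ℕ in atTop, (i * s i : ℝ) ≤ Cq * roundStart s i) :
    ∃ (i₀ : ℕ) (K : ℝ), 1 ≤ i₀ ∧ 0 ≤ K ∧ ∀ (ξ : ℕ → Ω → Ξ) (x : ℕ → Ω → E),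
      StaleSGD P 𝒟 s Q step grad w₀ wstar δ κ ξ x → ∀ t, i₀ ≤ roundOf s t →
      ∫ ω, ‖x t ω - wstar‖ ^ 2 ∂P ≤
        3 * (200 * (∫ z, ‖grad wstar z‖ ^ 2 ∂𝒟) / μ ^ 2 / roundStart s (roundOf s t) +
          K / (roundOf s t : ℝ) ^ 2) ∧
      iterateError P s step grad w₀ wstar ξ x t ≤
        3 * (200 * (∫ z, ‖grad wstar z‖ ^ 2 ∂𝒟) / μ ^ 2 / roundStart s (roundOf s t) +
          K / (roundOf s t : ℝ) ^ 2) := by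
  have hL := ho.L_pos
  have hμ := ho.mu_pos
  set N₂ := ∫ z, ‖grad wstar z‖ ^ 2 ∂𝒟 with hN₂
  have hN0 : 0 ≤ N₂ := integral_nonneg fun _ => sq_nonneg _
  set Cm : ℝ := 3 * 2 ^ (Q + 2) with hCm
  have hCm0 : 0 < Cm := by positivity
  obtain ⟨c₁, c₂, lam, hlam, hrem⟩ :=
    exists_remainder_constants (Cβ := Cβ) hL hμ hN0 hCv hCm0 hCq
  obtain ⟨i₁, hi₁⟩ := eventually_atTop.mp hS2
  set C₃ : ℝ := 2 * (72 * Cβ ^ 2 * (L ^ 2 * Cm) + 16 * L ^ 2 * Cβ ^ 2) with hC₃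
  obtain ⟨i₀, hi₀⟩ := eventually_atTop.mp (((((((((hβ.and hv).and h11).and hq).and hq').and
    (eventually_natCast_ge (L * Cβ))).and (eventually_natCast_ge c₂)).and
    (eventually_natCast_ge C₃)).and (eventually_natCast_ge (27 / 2 * Cq))).and
    (eventually_ge_atTop (i₁ + 2 * (Q + 2))))
  have hi₀1 : 1 ≤ i₀ := by have := (hi₀ i₀ le_rfl).2; omega
  set crude := crudeBound L ‖w₀ - wstar‖
    (∑ u ∈ Finset.range (roundStart s (i₀ + Q + 1)), step (roundOf s u)) N₂ with hcrude
  set K : ℝ := max (max c₁ (144 * Cβ ^ 2 * N₂)) (crude * (i₀ : ℝ) ^ 2) with hK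
  have hKc₁ : c₁ ≤ K := (le_max_left _ _).trans (le_max_left _ _)
  have hKN : 144 * Cβ ^ 2 * N₂ ≤ K := (le_max_right _ _).trans (le_max_left _ _)
  have hKcrude : crude * (i₀ : ℝ) ^ 2 ≤ K := le_max_right _ _
  have hK0 : 0 ≤ K := le_trans (by positivity) hKN
  refine ⟨i₀, K, hi₀1, hK0, fun ξ x h => ?_⟩
  set a : ℝ := 200 * N₂ / μ ^ 2 with ha
  have ha0 : 0 ≤ a := by positivity
  set θ : ℕ → ℝ := fun i => a / roundStart s i + K / (i : ℝ) ^ 2 with hθ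
  have hθ0 : ∀ i, 0 ≤ θ i := fun i => by positivity
  have hS0 : ∀ i : ℕ, 1 ≤ i → (0 : ℝ) < roundStart s i := fun i hi => by
    have := le_roundStart hs i
    exact_mod_cast (by omega : 0 < roundStart s i)
  set ε : ℕ → ℝ := fun i => iterateError P s step grad w₀ wstar ξ x (roundStart s i) with hε
  -- the bounds change only by a constant factor over the window
  have hθwin : ∀ i ≥ i₀, ∀ j, i - 1 - Q ≤ j → j ≤ i → 3 * θ j ≤ Cm * θ i := by
    exact fun i hi j hj hji => rate_window hs hi₁ ha0 hK0 (hi₀ i hi).2 hj hji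
  -- the step from the iterate at the beginning of a round to the models of the round
  have hmodel : ∀ i ≥ i₀, ε i ≤ θ i →
      (∀ t, i - 1 - Q ≤ roundOf s t → roundOf s t < i →
        ∫ ω, ‖x t ω - wstar‖ ^ 2 ∂P ≤ 3 * θ (roundOf s t)) →
      ∀ t, roundOf s t = i → ∫ ω, ‖x t ω - wstar‖ ^ 2 ∂P ≤ 3 * θ i ∧
        iterateError P s step grad w₀ wstar ξ x t ≤ 3 * θ i := by
    intro i hi hεi hprev
    obtain ⟨⟨⟨⟨⟨⟨⟨⟨⟨f1, -⟩, -⟩, -⟩, -⟩, f6⟩, -⟩, f8⟩, -⟩, f10⟩ := hi₀ i hi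
    have hi1 : (1 : ℝ) ≤ i := by exact_mod_cast (by omega : 1 ≤ i)
    have hβ0 := windowSum_nonneg (s := s) (Q := Q) hstep i
    have hLβ : L * windowSum s Q step i ≤ 1 := by
      calc L * windowSum s Q step i ≤ L * (Cβ / i) := by gcongr
        _ = L * Cβ / i := by ring
        _ ≤ 1 := by rw [div_le_one (by linarith)]; exact f6
    have hβ2 : windowSum s Q step i ^ 2 ≤ Cβ ^ 2 * (1 / (i : ℝ) ^ 2) := by
      calc windowSum s Q step i ^ 2 ≤ (Cβ / i) ^ 2 := pow_le_pow_left₀ hβ0 f1 2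
        _ = _ := by ring
    have hi2 : C₃ * (1 / (i : ℝ) ^ 2) ≤ 1 := by
      rw [mul_one_div, div_le_one (by positivity)]
      nlinarith
    have hKi : 144 * Cβ ^ 2 * N₂ * (1 / (i : ℝ) ^ 2) ≤ θ i := by
      have h1 : 144 * Cβ ^ 2 * N₂ * (1 / (i : ℝ) ^ 2) ≤ K * (1 / (i : ℝ) ^ 2) := by gcongr
      have h2 : 0 ≤ a / roundStart s i := by positivity
      simp only [hθ]
      rw [mul_one_div] at h1
      rw [mul_one_div] at h1
      rw [mul_one_div]
      linarith
    set r := 1 / (i : ℝ) ^ 2 with hr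
    have hr0 : 0 ≤ r := by positivity
    have hM0 : 0 ≤ Cm * θ i := mul_nonneg hCm0.le (hθ0 i)
    have hT := hθ0 i
    have hsmall : 36 * windowSum s Q step i ^ 2 * (N₂ + L ^ 2 * (Cm * θ i)) +
        8 * L ^ 2 * windowSum s Q step i ^ 2 * θ i ≤ θ i / 2 := by
      have h1 : 36 * windowSum s Q step i ^ 2 * (N₂ + L ^ 2 * (Cm * θ i)) ≤
          36 * (Cβ ^ 2 * r) * (N₂ + L ^ 2 * (Cm * θ i)) := by gcongr
      have h2 : 8 * L ^ 2 * windowSum s Q step i ^ 2 * θ i ≤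
          8 * L ^ 2 * (Cβ ^ 2 * r) * θ i := by gcongr
      have h3 := mul_le_mul_of_nonneg_right hi2 hT
      rw [hC₃] at h3
      linarith
    intro t ht
    exact h.round_le ho hs hstep (fun u hu hu' => by
      have hu1 := (le_roundOf_iff hs).mpr hu
      have hu2 := (roundOf_lt_iff hs).mpr hu'
      exact (hprev u hu1 hu2).trans (hθwin i hi _ hu1 hu2.le)) hLβ hεi
      (hθwin i hi i (by omega) le_rfl) hsmall ht
  -- one round
  have hround : ∀ i ≥ i₀, ε i ≤ θ i →
      (∀ t, i - 1 - Q ≤ roundOf s t → roundOf s t ≤ i →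
        ∫ ω, ‖x t ω - wstar‖ ^ 2 ∂P ≤ 3 * θ (roundOf s t)) → ε (i + 1) ≤ θ (i + 1) := by
    intro i hi hεi hprev
    obtain ⟨⟨⟨⟨⟨⟨⟨⟨⟨f1, f2⟩, f3⟩, f4⟩, f5⟩, f6⟩, f7⟩, -⟩, f9⟩, f10⟩ := hi₀ i hi
    have hi1 : (1 : ℝ) ≤ i := by exact_mod_cast (by omega : 1 ≤ i)
    have hi0 : (0 : ℝ) < i := by linarith
    have hβ0 := windowSum_nonneg (s := s) (Q := Q) hstep i
    have hLβ : L * windowSum s Q step i ≤ 1 := by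
      calc L * windowSum s Q step i ≤ L * (Cβ / i) := by gcongr
        _ = L * Cβ / i := by ring
        _ ≤ 1 := by rw [div_le_one (by linarith)]; exact f6
    set r : ℝ := 1 / i with hr
    have hr0 : 0 < r := by positivity
    have hr1 : r ≤ 1 := by rw [hr, div_le_one hi0]; exact hi1
    have hSi := hS0 i (by omega)
    have hsi : (0 : ℝ) < s i := by exact_mod_cast hs i
    set q : ℝ := s i / roundStart s i with hqd
    have hq0 : 0 < q := by positivity
    have hrq : r ≤ 2 * q := by
      rw [hr, hqd, ← mul_div_assoc, div_le_div_iff₀ hi0 hSi]; linarith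
    have hqr : q ≤ Cq * r := by
      rw [hr, hqd, mul_one_div, div_le_div_iff₀ hSi hi0]; linarith
    have hT := hθ0 i
    have hp0 : 0 ≤ step i * s i := mul_nonneg (hstep i) hsi.le
    have hpq : step i * s i = step i * roundStart s i * q := by
      rw [hqd]; field_simp
    have hp12 : step i * s i * μ ≤ 12 * q := by
      have := h12 i
      rw [le_div_iff₀ hμ] at this
      rw [hpq]; nlinarith
    have hp11 : 11 * q ≤ step i * s i * μ := by
      rw [div_le_iff₀ hμ] at f3
      rw [hpq]; nlinarith
    have hM0 : 0 ≤ Cm * θ i := mul_nonneg hCm0.le hT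
    have hvi : Cv / (i : ℝ) ^ 3 = Cv * r ^ 3 := by rw [hr]; ring
    rw [hvi] at f2
    have h1 := h.iterateError_succ_le ho hs hstep (by omega : Q < i) hM0
      (div_pos hlam hr0) (fun u hu hu' => by
        have hu1 := (le_roundOf_iff hs).mpr hu
        have hu2 := (roundOf_lt_iff hs).mpr hu'
        exact (hprev u hu1 (by omega)).trans (hθwin i hi _ hu1 (by omega)))
      hLβ f2 rfl rfl rfl rfl rfl
    have h2 := hrem hr0 hr1 hrq hqr hp0 hp12 hT hβ0 (by rw [hr, mul_one_div]; exact f1) hεi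
      rfl rfl
    rw [← hN₂] at h1
    change ε (i + 1) ≤ (1 - 9 / 8 * (step i * s i * μ)) * ε i + _ + _ + _ + _ + _ + _ + _ at h1
    have hnoise : 3 * step i ^ 2 * s i * N₂ ≤ 54 / 25 * (q * (a / roundStart s i)) := by
      have h3 : step i ≤ 12 / μ / roundStart s i := by rw [le_div_iff₀ hSi]; exact h12 i
      calc 3 * step i ^ 2 * s i * N₂ ≤ 3 * (12 / μ / roundStart s i) ^ 2 * s i * N₂ := by
            have := hstep i
            gcongr
        _ = _ := by rw [hqd, ha]; field_simp; ring
    have hθi : θ i = a / roundStart s i + K * r ^ 2 := by simp only [hθ, hr]; ring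
    have hθsucc := le_div_add_div_sq_succ ha0 hK0 hSi hsi.le hi0
    have hc₂ : c₂ * r ≤ 1 := by rw [hr, mul_one_div, div_le_one hi0]; exact f7
    have hp1 : step i * s i * μ ≤ 8 / 9 := by
      have h4 : 27 / 2 * Cq * r ≤ 1 := by
        rw [hr, mul_one_div, div_le_one hi0]; exact f9
      linarith
    have hθs : θ (i + 1) = a / (roundStart s i + s i) + K / ((i : ℝ) + 1) ^ 2 := by
      simp only [hθ, roundStart_succ, Nat.cast_add, Nat.cast_one]
    rw [hθs]
    rw [hθi] at hεi h2
    refine rate_step hrq hq0.le (by positivity) rfl hK0 hKc₁ hc₂ hεi hp11 hp1 hnoise h2 hθsucc ?_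
    rw [← hθi]
    linarith
  -- all rounds
  have hall : ∀ i, 1 ≤ i → ε i ≤ θ i ∧
      ∀ t, roundOf s t = i → ∫ ω, ‖x t ω - wstar‖ ^ 2 ∂P ≤ 3 * θ i := by
    intro i
    induction i using Nat.strong_induction_on with
    | _ i ih =>
      intro hi1
      rcases le_or_gt i i₀ with hi | hi
      · have hcr := h.crude ho hs hstep i₀ (β := _) rfl
        have hθcr : crude ≤ θ i := by
          have hi0 : (0 : ℝ) < i := by exact_mod_cast hi1
          have h1 : (i : ℝ) ≤ i₀ := by exact_mod_cast hi
          have hcr0 : 0 ≤ crude := le_trans (integral_nonneg fun _ => sq_nonneg _)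
            ((hcr.2 0 (Nat.zero_le _)).2)
          have h2 : crude ≤ K / (i : ℝ) ^ 2 := by
            rw [le_div_iff₀ (by positivity)]
            refine le_trans ?_ hKcrude
            gcongr
          have h3 : 0 ≤ a / roundStart s i := by positivity
          simp only [hθ]
          linarith
        refine ⟨(hcr.2 _ (roundStart_mono s (by omega))).2.trans hθcr, fun t ht => ?_⟩
        have h4 := (hcr.1 t (by omega)).2
        have := hθ0 i
        exact h4.trans (by linarith)
      · obtain ⟨j, rfl⟩ : ∃ j, i = j + 1 := ⟨i - 1, by omega⟩
        have hj : i₀ ≤ j := by omega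
        have hj2 := (hi₀ j hj).2
        have hε1 : ε (j + 1) ≤ θ (j + 1) :=
          hround j hj (ih j (by omega) (by omega)).1 fun t ht ht' =>
            (ih (roundOf s t) (by omega) (by omega)).2 t rfl
        exact ⟨hε1, fun t ht => (hmodel (j + 1) (by omega) hε1 (fun t ht ht' =>
          (ih (roundOf s t) (by omega) (by omega)).2 t rfl) t ht).1⟩
  intro t ht
  have hprev := (hi₀ (roundOf s t) ht).2
  exact hmodel (roundOf s t) ht (hall _ (by omega)).1
    (fun u hu hu' => (hall _ (by omega)).2 u rfl) t rfl

end Rate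

/-! ### From rounds to evaluations -/

section Evaluations

variable {Ω : Type*} [MeasurableSpace Ω] {P : Measure Ω}
  {E : Type*} [NormedAddCommGroup E] [InnerProductSpace ℝ E]
  {Ξ : Type*} [MeasurableSpace Ξ] [MeasurableSpace E]
  [BorelSpace E] [SecondCountableTopology E]
  {𝒟 : Measure Ξ} {s : ℕ → ℕ} {Q : ℕ} {step : ℕ → ℝ} {grad : E → Ξ → E}
  {w₀ wstar : E} {δ : ℕ → ℝ} {κ L μ : ℝ}

/-- Rate of convergence in terms of the number of evaluations. -/
theorem StaleSGD.exists_rate [IsProbabilityMeasure P] [CompleteSpace E]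
    (ho : StochasticGradient 𝒟 grad wstar L μ) (hs : ∀ i, 0 < s i) (hstep : ∀ i, 0 ≤ step i)
    {Cβ Cv Cq C : ℝ} (hCv : 0 ≤ Cv) (hCq : 0 < Cq)
    (hβ : ∀ᶠ i : ℕ in atTop, windowSum s Q step i ≤ Cβ / i)
    (hv : ∀ᶠ i : ℕ in atTop, crudeBound L ‖w₀ - wstar‖
      (∑ u ∈ Finset.range (roundStart s (i + Q + 1)), step (roundOf s u)) κ * δ i ≤ Cv / i ^ 3)
    (h12 : ∀ i, step i * roundStart s i ≤ 12 / μ)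
    (h11 : ∀ᶠ i in atTop, 11 / μ ≤ step i * roundStart s i)
    (hS2 : ∀ᶠ i in atTop, (roundStart s (i + 1) : ℝ) ≤ 2 * roundStart s i)
    (hq : ∀ᶠ i : ℕ in atTop, (roundStart s i : ℝ) ≤ 2 * (i * s i))
    (hq' : ∀ᶠ i : ℕ in atTop, (i * s i : ℝ) ≤ Cq * roundStart s i)
    (hlog : ∀ᶠ i : ℕ in atTop, (roundStart s (i + 1) : ℝ) * Real.log (roundStart s (i + 1)) ≤
      C * (i : ℝ) ^ 2) :
    ∃ K : ℝ, ∀ (ξ : ℕ → Ω → Ξ) (x : ℕ → Ω → E),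
      StaleSGD P 𝒟 s Q step grad w₀ wstar δ κ ξ x → ∀ t : ℕ, 2 ≤ t →
      ∫ ω, ‖x t ω - wstar‖ ^ 2 ∂P ≤
        1200 * (∫ z, ‖grad wstar z‖ ^ 2 ∂𝒟) / μ ^ 2 * (1 / t) + K * (1 / (t * Real.log t)) ∧
      iterateError P s step grad w₀ wstar ξ x t ≤
        1200 * (∫ z, ‖grad wstar z‖ ^ 2 ∂𝒟) / μ ^ 2 * (1 / t) + K * (1 / (t * Real.log t)) := by
  have hL := ho.L_pos
  have hμ := ho.mu_pos
  obtain ⟨i₀, K, hi₀1, hK0, hKb⟩ := StaleSGD.exists_round_bound (P := P) (w₀ := w₀) ho hs hstep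
    hCv hCq hβ hv h12 h11 hS2 hq hq'
  set N₂ := ∫ z, ‖grad wstar z‖ ^ 2 ∂𝒟 with hN₂
  have hN0 : 0 ≤ N₂ := integral_nonneg fun _ => sq_nonneg _
  obtain ⟨i₁, hi₁⟩ := eventually_atTop.mp (hS2.and hlog)
  set k := max i₀ i₁ with hk
  set crude := crudeBound L ‖w₀ - wstar‖
    (∑ u ∈ Finset.range (roundStart s (k + Q + 1)), step (roundOf s u)) N₂ with hcrude
  set K' : ℝ := max (3 * K * C) (crude * (roundStart s (k + 1) * Real.log (roundStart s (k + 1))))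
    with hK'
  refine ⟨K', fun ξ x h t ht => ?_⟩
  have ht2 : (2 : ℝ) ≤ t := by exact_mod_cast ht
  have ht0 : (0 : ℝ) < t := by linarith
  have hlogt : 0 < Real.log t := Real.log_pos (by linarith)
  have hmono : ∀ y : ℕ, t ≤ y → (t : ℝ) * Real.log t ≤ y * Real.log y := fun y hy => by
    have h1 : (t : ℝ) ≤ y := by exact_mod_cast hy
    have h2 := Real.log_le_log ht0 h1
    gcongr
  obtain ⟨h1, h2⟩ := (roundOf_eq_iff hs).mp (rfl : roundOf s t = roundOf s t)
  rcases le_or_gt k (roundOf s t) with hkt | hkt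
  · set i := roundOf s t with hi
    have hkey := hKb ξ x h t ((le_max_left _ _).trans hkt)
    obtain ⟨f1, f2⟩ := hi₁ i ((le_max_right _ _).trans hkt)
    have hi1 : 1 ≤ i := hi₀1.trans ((le_max_left _ _).trans hkt)
    have hi0 : (0 : ℝ) < i := by exact_mod_cast hi1
    have hS0 : (0 : ℝ) < roundStart s i := by
      have := le_roundStart hs i
      exact_mod_cast (by omega : 0 < roundStart s i)
    have htS : (t : ℝ) ≤ 2 * roundStart s i := by
      have : (t : ℝ) ≤ roundStart s (i + 1) := by exact_mod_cast h2.le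
      linarith
    have e1 : 3 * (200 * N₂ / μ ^ 2 / roundStart s i) ≤ 1200 * N₂ / μ ^ 2 * (1 / t) := by
      have e2 : 1 / (roundStart s i : ℝ) ≤ 2 * (1 / t) := by
        rw [mul_one_div, div_le_div_iff₀ hS0 ht0]; linarith
      calc 3 * (200 * N₂ / μ ^ 2 / roundStart s i)
          = 600 * N₂ / μ ^ 2 * (1 / roundStart s i) := by ring
        _ ≤ 600 * N₂ / μ ^ 2 * (2 * (1 / t)) := by gcongr
        _ = _ := by ring
    have e3 : 3 * (K / (i : ℝ) ^ 2) ≤ K' * (1 / (t * Real.log t)) := by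
      have e4 : (t : ℝ) * Real.log t ≤ C * (i : ℝ) ^ 2 := (hmono _ h2.le).trans f2
      calc 3 * (K / (i : ℝ) ^ 2) ≤ 3 * K * C * (1 / (t * Real.log t)) := by
            rw [mul_one_div, ← mul_div_assoc, div_le_div_iff₀ (by positivity) (by positivity)]
            calc 3 * K * (t * Real.log t) ≤ 3 * K * (C * (i : ℝ) ^ 2) := by gcongr
              _ = _ := by ring
        _ ≤ _ := by gcongr; exact le_max_left _ _
    exact ⟨hkey.1.trans (by linarith), hkey.2.trans (by linarith)⟩
  · have hcr := h.crude ho hs hstep k (β := _) rfl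
    have hcr0 : 0 ≤ crude := le_trans (integral_nonneg fun _ => sq_nonneg _)
      ((hcr.2 0 (Nat.zero_le _)).2)
    have htk : t ≤ roundStart s (k + 1) := h2.le.trans (roundStart_mono s (by omega))
    have e1 : crude ≤ K' * (1 / (t * Real.log t)) := by
      rw [mul_one_div, le_div_iff₀ (by positivity)]
      exact (mul_le_mul_of_nonneg_left (hmono _ htk) hcr0).trans (le_max_right _ _)
    have e2 : 0 ≤ 1200 * N₂ / μ ^ 2 * (1 / (t : ℝ)) := by positivity
    have e3 := (hcr.1 t hkt.le).2
    have e4 := (hcr.2 t htk).2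
    exact ⟨e3.trans (by linarith), e4.trans (by linarith)⟩

end Evaluations

/-! ### Sums of step sizes -/

section StepSums

variable {s : ℕ → ℕ} {step : ℕ → ℝ}

theorem sum_step_roundOf (hs : ∀ i, 0 < s i) {i j : ℕ} (hij : i ≤ j) :
    ∑ u ∈ Finset.Ico (roundStart s i) (roundStart s j), step (roundOf s u) =
      ∑ k ∈ Finset.Ico i j, s k * step k := by
  induction j, hij using Nat.le_induction with
  | base => simp
  | succ j hj ih =>
    rw [← Finset.sum_Ico_consecutive _ (roundStart_mono s hj) (roundStart_mono s j.le_succ), ih,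
      Finset.sum_Ico_succ_top hj]
    congr 1
    rw [Finset.sum_congr rfl fun u hu => by
      rw [(roundOf_eq_iff hs).mpr ⟨(Finset.mem_Ico.mp hu).1, (Finset.mem_Ico.mp hu).2⟩],
      Finset.sum_const, Nat.card_Ico, nsmul_eq_mul]
    congr 2
    simp [roundStart_succ]

variable {b : ℝ} {k₀ : ℕ} (hs : ∀ i, 0 < s i) (hb : ∀ k ≥ k₀, s k * step k ≤ b * (1 / k))
include hs hb

theorem eventually_windowSum_le (hb0 : 0 ≤ b) (Q : ℕ) :
    ∀ᶠ i : ℕ in atTop, windowSum s Q step i ≤ (2 * (Q + 1) * (2 * b)) / i := by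
  filter_upwards [eventually_ge_atTop (k₀ + 2 * (Q + 2))] with i hi
  have hi0 : (0 : ℝ) < i := by exact_mod_cast (by omega : 0 < i)
  rw [windowSum, sum_step_roundOf hs (by omega)]
  have h1 : ∀ k ∈ Finset.Ico (i - 1 - Q) (i + Q + 1), s k * step k ≤ 2 * b / i := by
    intro k hk
    have hk1 := (Finset.mem_Ico.mp hk).1
    have hk0 : (0 : ℝ) < k := by exact_mod_cast (by omega : 0 < k)
    refine (hb k (by omega)).trans ?_
    have : (i : ℝ) ≤ 2 * k := by exact_mod_cast (by omega : i ≤ 2 * k)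
    rw [mul_one_div, div_le_div_iff₀ hk0 hi0]
    nlinarith
  refine (Finset.sum_le_sum h1).trans (le_of_eq ?_)
  rw [Finset.sum_const, Nat.card_Ico, show i + Q + 1 - (i - 1 - Q) = 2 * (Q + 1) by omega,
    nsmul_eq_mul]
  push_cast
  ring

/-- The sum of the step sizes grows at most logarithmically in the number of rounds; accordingly the
a priori bound on the second moments grows at most polynomially. -/
theorem exists_sum_step_le_log (hb0 : 0 ≤ b) :
    ∃ b₀ : ℝ, ∀ n > k₀, ∑ u ∈ Finset.range (roundStart s n), step (roundOf s u) ≤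
      b₀ + 2 * b * Real.log n := by
  refine ⟨∑ k ∈ Finset.Ico 0 (k₀ + 1), s k * step k, fun n hn => ?_⟩
  have h0 := sum_step_roundOf (step := step) hs (Nat.zero_le n)
  rw [roundStart_zero, Nat.Ico_zero_eq_range] at h0
  rw [h0]
  induction n, hn using Nat.le_induction with
  | base =>
    have : 0 ≤ Real.log ((k₀ + 1 : ℕ) : ℝ) := Real.log_natCast_nonneg _
    have : 0 ≤ 2 * b * Real.log ((k₀.succ : ℕ) : ℝ) := by positivity
    simpa using this
  | succ n hn ih =>
    have h0' := sum_step_roundOf (step := step) hs (Nat.zero_le n)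
    rw [roundStart_zero, Nat.Ico_zero_eq_range] at h0'
    have hn' : k₀ < n := hn
    rw [Finset.sum_Ico_succ_top (Nat.zero_le n)]
    have h1 := ih h0'
    have h2 := hb n (by omega)
    have hn0 : (0 : ℝ) < n := by exact_mod_cast (by omega : 0 < n)
    have hn1 : (1 : ℝ) ≤ n := by exact_mod_cast (by omega : 1 ≤ n)
    have h3 : 1 / (n : ℝ) ≤ 2 * (Real.log ((n + 1 : ℕ) : ℝ) - Real.log n) := by
      rw [← Real.log_div (by positivity) (by positivity)]
      have h4 := Real.one_sub_inv_le_log_of_pos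
        (by positivity : 0 < ((n + 1 : ℕ) : ℝ) / n)
      have h5 : 1 / (2 * n : ℝ) ≤ 1 - (((n + 1 : ℕ) : ℝ) / n)⁻¹ := by
        push_cast
        rw [inv_div, one_sub_div (by positivity), div_le_div_iff₀ (by positivity) (by positivity)]
        linarith
      have h6 : 1 / (2 * n : ℝ) = 1 / n / 2 := by field_simp
      linarith
    have h7 := mul_le_mul_of_nonneg_left h3 hb0
    linarith

/-- The crude bound grows only polynomially in the number of the round. -/
theorem eventually_crudeBound_mul_le (hb0 : 0 ≤ b) (hstep : ∀ i, 0 ≤ step i) (Q : ℕ) {L r κ : ℝ}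
    (hL : 0 ≤ L) (hκ : 0 ≤ κ) {δ : ℕ → ℝ} (hδ0 : ∀ i, 0 ≤ δ i)
    (hδ : ∀ c : ℝ, Tendsto (fun i : ℕ => (i : ℝ) ^ c * δ i) atTop (nhds 0)) :
    ∀ᶠ i : ℕ in atTop, crudeBound L r
      (∑ u ∈ Finset.range (roundStart s (i + Q + 1)), step (roundOf s u)) κ * δ i ≤
        1 / (i : ℝ) ^ 3 := by
  obtain ⟨b₀, hb₀⟩ := exists_sum_step_le_log hs hb hb0
  set c := (4 * L + 2) * (2 * b) with hc
  set A := (2 * r ^ 2 + 2 * κ) * Real.exp ((4 * L + 2) * (b₀ + 2 * b * Real.log 2)) with hA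
  have hA0 : 0 ≤ A := by positivity
  have h1 := (hδ (c + 3)).const_mul A
  rw [mul_zero] at h1
  filter_upwards [h1.eventually (gt_mem_nhds one_pos), eventually_ge_atTop (k₀ + Q + 2)]
    with i hi1 hi2
  have hi0 : (0 : ℝ) < i := by exact_mod_cast (by omega : 0 < i)
  set β := ∑ u ∈ Finset.range (roundStart s (i + Q + 1)), step (roundOf s u) with hβ
  have hβ0 : 0 ≤ β := Finset.sum_nonneg fun u _ => hstep _
  have hβle : β ≤ b₀ + 2 * b * Real.log 2 + 2 * b * Real.log i := by
    have h2 := hb₀ (i + Q + 1) (by omega)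
    have h3 : Real.log ((i + Q + 1 : ℕ) : ℝ) ≤ Real.log 2 + Real.log i := by
      rw [← Real.log_mul two_ne_zero hi0.ne']
      refine Real.log_le_log (by positivity) ?_
      exact_mod_cast (by omega : i + Q + 1 ≤ 2 * i)
    have h4 := mul_le_mul_of_nonneg_left h3 (by positivity : 0 ≤ 2 * b)
    linarith
  have hcrude : crudeBound L r β κ ≤ A * (i : ℝ) ^ c := by
    have h2 : β ^ 2 ≤ Real.exp (2 * β) := by
      have : β ≤ Real.exp β := by linarith [Real.add_one_le_exp β]
      calc β ^ 2 ≤ Real.exp β ^ 2 := pow_le_pow_left₀ hβ0 this 2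
        _ = _ := by rw [← Real.exp_nat_mul]; norm_num
    have h3 : 1 ≤ Real.exp (2 * β) := Real.one_le_exp (by positivity)
    have h4 : 2 * r ^ 2 + 2 * β ^ 2 * κ ≤ (2 * r ^ 2 + 2 * κ) * Real.exp (2 * β) := by
      have e1 : 2 * r ^ 2 * 1 ≤ 2 * r ^ 2 * Real.exp (2 * β) := by gcongr
      have e2 : 2 * β ^ 2 * κ ≤ 2 * Real.exp (2 * β) * κ := by gcongr
      linarith
    calc crudeBound L r β κ ≤ Real.exp (4 * L * β) * ((2 * r ^ 2 + 2 * κ) * Real.exp (2 * β)) := by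
          rw [crudeBound]; gcongr
      _ = (2 * r ^ 2 + 2 * κ) * Real.exp ((4 * L + 2) * β) := by
          rw [mul_left_comm, ← Real.exp_add]; ring_nf
      _ ≤ (2 * r ^ 2 + 2 * κ) * Real.exp ((4 * L + 2) *
            (b₀ + 2 * b * Real.log 2 + 2 * b * Real.log i)) := by gcongr
      _ = A * (i : ℝ) ^ c := by
          rw [hA, hc, Real.rpow_def_of_pos hi0, mul_assoc _ (Real.exp _) (Real.exp _), ← Real.exp_add]
          ring_nf
  rw [le_div_iff₀ (by positivity)]
  calc crudeBound L r β κ * δ i * (i : ℝ) ^ 3 ≤ A * (i : ℝ) ^ c * δ i * (i : ℝ) ^ 3 := by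
        have := hδ0 i
        gcongr
    _ = A * ((i : ℝ) ^ (c + 3) * δ i) := by
        rw [Real.rpow_add hi0, show ((i : ℝ) ^ (3 : ℝ)) = (i : ℝ) ^ 3 by norm_cast]; ring
    _ ≤ 1 := hi1.le

end StepSums

/-! ### The stochastic gradient of the loss -/

section Gradient

variable {q : ℕ} {Ξ : Type*} [MeasurableSpace Ξ] {𝒟 : Measure Ξ}
  {f : EuclideanSpace ℝ (Fin q) → Ξ → ℝ} {L μ : ℝ} {wstar : EuclideanSpace ℝ (Fin q)}

/-- The gradient is a limit of difference quotients, hence measurable in the sample. -/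
theorem measurable_gradient (hf_meas : ∀ w, Measurable (f w))
    (hf_diff : ∀ ξ, Differentiable ℝ fun w => f w ξ) (w : EuclideanSpace ℝ (Fin q)) :
    Measurable fun ξ => ∇ (fun v => f v ξ) w := by
  have hcomp : ∀ j : Fin q, Measurable fun ξ => (∇ (fun v => f v ξ) w) j := by
    intro j
    set e : EuclideanSpace ℝ (Fin q) := EuclideanSpace.single j 1 with he
    refine measurable_of_tendsto_metrizable
      (f := fun (k : ℕ) ξ => ((k : ℝ) + 1) • (f (w + ((k : ℝ) + 1)⁻¹ • e) ξ - f w ξ))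
      (fun k => ((hf_meas (w + ((k : ℝ) + 1)⁻¹ • e)).sub (hf_meas w)).const_smul ((k : ℝ) + 1)) ?_
    rw [tendsto_pi_nhds]
    intro ξ
    have h1 := ((hf_diff ξ) w).hasFDerivAt
    have hc : Tendsto (fun k : ℕ => ‖((k : ℝ) + 1)‖) atTop atTop :=
      tendsto_norm_atTop_atTop.comp (tendsto_atTop_add_const_right _ _ tendsto_natCast_atTop_atTop)
    have h2 := h1.lim e hc
    have h3 : (∇ (fun v => f v ξ) w) j = fderiv ℝ (fun v => f v ξ) w e := by
      have h4 : inner ℝ (∇ (fun v => f v ξ) w) e = fderiv ℝ (fun v => f v ξ) w e := by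
        rw [gradient, InnerProductSpace.toDual_symm_apply]
      rw [← h4, he, EuclideanSpace.inner_single_right]
      simp
    rw [h3]
    exact h2
  have h5 : Measurable fun ξ => (fun j => (∇ (fun v => f v ξ) w) j) := measurable_pi_iff.mpr hcomp
  exact (MeasurableEquiv.toLp 2 (Fin q → ℝ)).measurable.comp h5

theorem measurable_uncurry_gradient (hf_meas : ∀ w, Measurable (f w))
    (hf_diff : ∀ ξ, Differentiable ℝ fun w => f w ξ) {L : ℝ}
    (hf_smooth : ∀ ξ w w',
      ‖∇ (fun v => f v ξ) w - ∇ (fun v => f v ξ) w'‖ ≤ L * ‖w - w'‖) :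
    Measurable (Function.uncurry fun w ξ => ∇ (fun v => f v ξ) w) := by
  refine measurable_uncurry_of_continuous_of_measurable (fun ξ => ?_)
    (measurable_gradient hf_meas hf_diff)
  exact (LipschitzWith.of_dist_le_mul (K := L.toNNReal) fun w w' => by
    rw [dist_eq_norm, dist_eq_norm]
    exact (hf_smooth ξ w w').trans (mul_le_mul_of_nonneg_right (Real.le_coe_toNNReal L)
      (norm_nonneg _))).continuous

/-- Differentiation of the objective under the integral sign. -/
theorem gradient_integral [IsProbabilityMeasure 𝒟] (hL : 0 ≤ L)
    (hf_int : ∀ w, Integrable (f w) 𝒟) (hf_meas : ∀ w, Measurable (f w))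
    (hf_diff : ∀ ξ, Differentiable ℝ fun w => f w ξ)
    (hf_smooth : ∀ ξ w w',
      ‖∇ (fun v => f v ξ) w - ∇ (fun v => f v ξ) w'‖ ≤ L * ‖w - w'‖)
    (hN : Integrable (fun ξ => ‖∇ (fun v => f v ξ) wstar‖ ^ 2) 𝒟) (w : EuclideanSpace ℝ (Fin q)) :
    HasGradientAt (fun w => ∫ ξ, f w ξ ∂𝒟) (∫ ξ, ∇ (fun v => f v ξ) w ∂𝒟) w := by
  have hm := measurable_gradient hf_meas hf_diff
  have hint : ∀ v, Integrable (fun ξ => ∇ (fun v => f v ξ) v) 𝒟 := by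
    intro v
    have h0 := integrable_of_sq (hm wstar).aestronglyMeasurable hN
    have h1 : Integrable (fun ξ => ‖∇ (fun v => f v ξ) wstar‖ + L * ‖v - wstar‖) 𝒟 :=
      h0.norm.add (integrable_const _)
    refine h1.mono' (hm v).aestronglyMeasurable (Eventually.of_forall fun ξ => ?_)
    have h2 := hf_smooth ξ v wstar
    have h3 := norm_le_norm_add_norm_sub' (∇ (fun v => f v ξ) v) (∇ (fun v => f v ξ) wstar)
    linarith
  set T := InnerProductSpace.toDual ℝ (EuclideanSpace ℝ (Fin q)) with hT
  have key := hasFDerivAt_integral_of_dominated_of_fderiv_le (μ := 𝒟) (F := f)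
    (F' := fun w ξ => T (∇ (fun v => f v ξ) w)) (x₀ := w)
    (bound := fun ξ => ‖∇ (fun v => f v ξ) w‖ + L) (Metric.ball_mem_nhds w one_pos)
    (Eventually.of_forall fun w => (hf_meas w).aestronglyMeasurable) (hf_int w)
    (T.continuous.comp_aestronglyMeasurable (hm w).aestronglyMeasurable)
    (Eventually.of_forall fun ξ v hv => by
      rw [LinearIsometryEquiv.norm_map]
      have h2 := hf_smooth ξ v w
      have h3 := norm_le_norm_add_norm_sub' (∇ (fun v => f v ξ) v) (∇ (fun v => f v ξ) w)
      have h4 : ‖v - w‖ ≤ 1 := by rw [← dist_eq_norm]; exact (Metric.mem_ball.mp hv).le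
      nlinarith)
    ((hint w).norm.add (integrable_const _))
    (Eventually.of_forall fun ξ v _ => (hf_diff ξ v).hasGradientAt.hasFDerivAt)
  have hcomm : ∫ ξ, T (∇ (fun v => f v ξ) w) ∂𝒟 = T (∫ ξ, ∇ (fun v => f v ξ) w ∂𝒟) :=
    T.toContinuousLinearEquiv.toContinuousLinearMap.integral_comp_comm (hint w)
  rw [hcomm] at key
  exact hasGradientAt_iff_hasFDerivAt.mpr key

/-- Differentiation under the expectation gives `∇F(w) = 𝔼 ∇f(w; ξ)`, so the loss gradients are
stochastic gradients of a strongly monotone field that vanishes at the minimizer. Measurability in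
both arguments holds because a gradient is a limit of difference quotients. -/
theorem stochasticGradient_gradient [IsProbabilityMeasure 𝒟] (hL : 0 < L) (hμ : 0 < μ)
    (hf_int : ∀ w, Integrable (f w) 𝒟) (hf_meas : ∀ w, Measurable (f w))
    (hf_diff : ∀ ξ, Differentiable ℝ fun w => f w ξ)
    (hf_smooth : ∀ ξ w w',
      ‖∇ (fun v => f v ξ) w - ∇ (fun v => f v ξ) w'‖ ≤ L * ‖w - w'‖)
    {F : EuclideanSpace ℝ (Fin q) → ℝ} (hF : ∀ w, F w = ∫ ξ, f w ξ ∂𝒟)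
    (hF_strong : ∀ w w',
      inner ℝ (∇ F w') (w - w') + μ / 2 * ‖w - w'‖ ^ 2 ≤ F w - F w')
    (hwstar : ∀ w, F wstar ≤ F w)
    (hN : Integrable (fun ξ => ‖∇ (fun v => f v ξ) wstar‖ ^ 2) 𝒟) :
    StochasticGradient 𝒟 (fun w ξ => ∇ (fun v => f v ξ) w) wstar L μ := by
  have hgrad : ∀ w, HasGradientAt F (∫ ξ, ∇ (fun v => f v ξ) w ∂𝒟) w := fun w => by
    have := gradient_integral hL.le hf_int hf_meas hf_diff hf_smooth hN w
    rwa [← funext hF] at this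
  have hzero : ∫ ξ, ∇ (fun v => f v ξ) wstar ∂𝒟 = 0 := by
    have h1 : IsLocalMin F wstar := Eventually.of_forall hwstar
    have h2 := h1.hasFDerivAt_eq_zero (hgrad wstar).hasFDerivAt
    exact (LinearIsometryEquiv.map_eq_zero_iff _).mp h2
  refine ⟨measurable_uncurry_gradient hf_meas hf_diff hf_smooth, hL, hμ, hf_smooth, hN, hzero,
    fun w => ?_⟩
  have h1 := hF_strong w wstar
  have h2 := hF_strong wstar w
  rw [(hgrad wstar).gradient, hzero, inner_zero_left] at h1
  rw [(hgrad w).gradient, ← neg_sub w wstar, inner_neg_right, norm_neg] at h2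
  linarith

end Gradient

/-! ### The asynchronous algorithm as SGD with stale gradients -/

section Instance

variable {n : ℕ} {Ξ Ω : Type*} [MeasurableSpace Ξ] [MeasurableSpace Ω]
  {a : ℕ → ℕ → Ω → Fin n} {X : Fin n → ℕ → ℕ → Ω → Ξ} {s : ℕ → ℕ}
  {P : Measure Ω} [IsProbabilityMeasure P] {p : Fin n → ℝ≥0} {D : Fin n → Measure Ξ}

/-- The probability that a round leaves node `c` without work. -/
theorem measure_localSize_eq_zero (ha : ∀ i t, Measurable (a i t))
    (ha_law : ∀ i t c, P {ω | a i t ω = c} = p c)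
    (ha_indep : iIndepFun (fun (z : ℕ × ℕ) ω => a z.1 z.2 ω) P) (i : ℕ) (c : Fin n) :
    P.real {ω | localSize s (fun i t => a i t ω) i c = 0} = (1 - (p c : ℝ)) ^ s i := by
  classical
  have h1 : {ω | localSize s (fun i t => a i t ω) i c = 0} =
      ⋂ z ∈ (Finset.range (s i)).image (fun t => (i, t)), a z.1 z.2 ⁻¹' {c}ᶜ := by
    ext ω
    simp [localSize, Finset.filter_eq_empty_iff]
  have h2 : ∀ t, P.real (a i t ⁻¹' {c}ᶜ) = 1 - (p c : ℝ) := fun t => by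
    have h3 : a i t ⁻¹' {c}ᶜ = {ω | a i t ω = c}ᶜ := rfl
    have hm : MeasurableSet {ω | a i t ω = c} := ha i t (measurableSet_singleton c)
    rw [h3, probReal_compl_eq_one_sub hm, Measure.real, ha_law]
    simp
  have h4 := ha_indep.measure_inter_preimage_eq_mul
    ((Finset.range (s i)).image fun t => (i, t)) (sets := fun _ => {c}ᶜ)
    (fun _ _ => (measurableSet_singleton c).compl)
  rw [h1, Measure.real]
  have h5 : (⋂ z ∈ (Finset.range (s i)).image (fun t => (i, t)), a z.1 z.2 ⁻¹' {c}ᶜ) =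
    ⋂ z ∈ (Finset.range (s i)).image (fun t => (i, t)),
      (fun ω => a z.1 z.2 ω) ⁻¹' {c}ᶜ := rfl
  rw [h5, h4, ENNReal.toReal_prod, Finset.prod_image (fun _ _ _ _ h => (Prod.mk.inj h).2)]
  exact (Finset.prod_congr rfl fun t _ => h2 t).trans (by simp)

/-- A common upper bound, smaller than `1`, for the probabilities of not choosing a node that has
positive weight. -/
theorem exists_miss_bound (p : Fin n → ℝ≥0) (hp : ∑ c, p c = 1) :
    ∃ ρ : ℝ, 0 ≤ ρ ∧ ρ < 1 ∧ ∀ c, 0 < p c → 0 ≤ 1 - (p c : ℝ) ∧ 1 - (p c : ℝ) ≤ ρ := by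
  have hle : ∀ c, (p c : ℝ) ≤ 1 := fun c => by
    have h1 : p c ≤ ∑ c, p c := Finset.single_le_sum (fun _ _ => zero_le) (Finset.mem_univ c)
    rw [hp] at h1
    exact_mod_cast h1
  have hne : (Finset.univ.filter fun c => 0 < p c).Nonempty := by
    by_contra hcon
    rw [Finset.not_nonempty_iff_eq_empty, Finset.filter_eq_empty_iff] at hcon
    have : ∑ c, p c = 0 := Finset.sum_eq_zero fun c hc => by simpa using hcon hc
    rw [hp] at this
    exact one_ne_zero this
  obtain ⟨c₀, hc₀, hmin⟩ := Finset.exists_min_image _ p hne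
  rw [Finset.mem_filter] at hc₀
  have h0 : (0 : ℝ) < p c₀ := by exact_mod_cast hc₀.2
  refine ⟨1 - p c₀, by linarith [hle c₀], by linarith, fun c hc => ⟨by linarith [hle c], ?_⟩⟩
  have : (p c₀ : ℝ) ≤ p c := by exact_mod_cast hmin c (by simpa using hc)
  linarith

/-- That some node of positive weight has nothing to do in round `i` is exponentially unlikely in
the number of slots of this round. -/
theorem measure_exists_localSize_eq_zero_le (ha : ∀ i t, Measurable (a i t))
    (ha_law : ∀ i t c, P {ω | a i t ω = c} = p c)
    (ha_indep : iIndepFun (fun (z : ℕ × ℕ) ω => a z.1 z.2 ω) P) {ρ : ℝ} (hρ0 : 0 ≤ ρ)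
    (hρ : ∀ c, 0 < p c → 0 ≤ 1 - (p c : ℝ) ∧ 1 - (p c : ℝ) ≤ ρ) (i : ℕ) :
    P.real {ω | ∃ c, 0 < p c ∧ localSize s (fun i t => a i t ω) i c = 0} ≤ n * ρ ^ s i := by
  have h1 : {ω | ∃ c, 0 < p c ∧ localSize s (fun i t => a i t ω) i c = 0} ⊆
      ⋃ c, {ω | 0 < p c ∧ localSize s (fun i t => a i t ω) i c = 0} := fun ω ⟨c, hc⟩ =>
    Set.mem_iUnion.mpr ⟨c, hc⟩
  refine (measureReal_mono h1).trans ((measureReal_iUnion_fintype_le _).trans ?_)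
  refine (Finset.sum_le_sum fun c _ => (?_ : _ ≤ ρ ^ s i)).trans (by simp)
  by_cases hc : 0 < p c
  · simp only [hc, true_and]
    rw [measure_localSize_eq_zero ha ha_law ha_indep]
    exact pow_le_pow_left₀ (hρ c hc).1 (hρ c hc).2 _
  · simp only [hc, false_and, Set.ofPred_false, measureReal_empty]
    positivity

/-- Given the coin flips, the sample of a slot has the local distribution of the node `c` assigned to
it, and the density of this distribution with respect to the mixture is at most `1 / p_c`. -/
theorem setIntegral_slotSample_le (ha : ∀ i t, Measurable (a i t))
    (hX : ∀ c i h, Measurable (X c i h)) (hind : iIndep (tableSigma a X) P)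
    (ha_law : ∀ i t c, P {ω | a i t ω = c} = p c)
    (hX_law : ∀ c i h, P.map (X c i h) = D c) (t : ℕ) {H : Set Ω}
    (hH : MeasurableSet[sigmaOf a X (Set.range Sum.inl)] H) {φ : Ξ → ℝ} (hφ : Measurable φ)
    (hφ0 : ∀ z, 0 ≤ φ z) (hint : Integrable φ (mixture p D)) :
    ∫ ω in H, φ (slotSample s a X t ω) ∂P ≤
      ((∑ c, (p c)⁻¹ : ℝ≥0) : ℝ) * (∫ z, φ z ∂(mixture p D)) * P.real H := by
  have hm := measurable_slotSample ha hX s t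
  rw [integral_eq_lintegral_of_nonneg_ae (Eventually.of_forall fun ω => hφ0 _)
    (hφ.comp hm).aestronglyMeasurable]
  have h1 := setLIntegral_slotSample_le (s := s) ha hX hind ha_law hX_law t hH
    (φ := fun z => ENNReal.ofReal (φ z)) hφ.ennreal_ofReal
  have hfin : ∫⁻ z, ENNReal.ofReal (φ z) ∂(mixture p D) ≠ ⊤ := hint.lintegral_lt_top.ne
  refine (ENNReal.toReal_mono (ENNReal.mul_ne_top (ENNReal.mul_ne_top ENNReal.coe_ne_top
    (measure_ne_top P H)) hfin) h1).trans (le_of_eq ?_)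
  rw [ENNReal.toReal_mul, ENNReal.toReal_mul, ENNReal.coe_toReal, Measure.real,
    integral_eq_lintegral_of_nonneg_ae (Eventually.of_forall hφ0) hφ.aestronglyMeasurable]
  ring

variable {E : Type*} [NormedAddCommGroup E] [InnerProductSpace ℝ E] [MeasurableSpace E]
  [BorelSpace E] [SecondCountableTopology E] {A : Algorithm E Ξ} {σ : Scheduler n E Ξ} {Q : ℕ}

theorem partialIterate_eq_iterate (a : ℕ → ℕ → Fin n) (X : Fin n → ℕ → ℕ → Ξ) (t : ℕ) :
    partialIterate A.size A.step A.init
      (fun t => A.grad (localModel A σ a X t) (sampleAt A a X t)) t = iterate A σ a X t := by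
  induction t with
  | zero => simp [partialIterate, iterate]
  | succ t ih =>
    rw [iterate, ← ih, partialIterate, partialIterate, Finset.sum_range_succ, sub_add_eq_sub_sub]

/-- The indices of the coin flips and samples of the rounds before `i`. -/
def indicesBefore (n i : ℕ) : Set ((ℕ × ℕ) ⊕ (Fin n × ℕ × ℕ)) :=
  {j | Sum.elim (fun z => z.1 < i) (fun z => z.2.1 < i) j}

/-- An iterate of the execution on truncated tables is a function of the table entries before the
truncation. -/
theorem measurable_iterate_trunc (hA : Measurable (Function.uncurry A.grad))
    (hσ : ∀ r, Measurable (σ r)) (i : ℕ) (c₀ : Fin n) (ξ₀ : Ξ) (t : ℕ) :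
    Measurable[sigmaOf a X (indicesBefore n i)] fun ω =>
      iterate A σ (truncFlips i c₀ fun i t => a i t ω) (truncSamples i ξ₀ fun c i h => X c i h ω)
        t := by
  let _ : MeasurableSpace Ω := sigmaOf a X (indicesBefore n i)
  refine measurable_iterate (Θ := Ω) (a := fun ω => truncFlips i c₀ fun i t => a i t ω)
    (X := fun ω => truncSamples i ξ₀ fun c i h => X c i h ω) hA hσ ?_ ?_ t
  · refine measurable_pi_iff.mpr fun j => measurable_pi_iff.mpr fun t => ?_
    by_cases hj : j < i
    · simp only [truncFlips, if_pos hj]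
      exact measurable_flip_sigmaOf hj
    · simp only [truncFlips, if_neg hj]
      exact measurable_const
  · refine measurable_pi_iff.mpr fun c => measurable_pi_iff.mpr fun j =>
      measurable_pi_iff.mpr fun h => ?_
    by_cases hj : j < i
    · simp only [truncSamples, if_pos hj]
      exact measurable_sample_sigmaOf hj
    · simp only [truncSamples, if_neg hj]
      exact measurable_const

theorem measurableSet_localSize_eq_zero {T : Set ((ℕ × ℕ) ⊕ (Fin n × ℕ × ℕ))} {i : ℕ}
    (hT : ∀ t, Sum.inl (i, t) ∈ T) :
    MeasurableSet[sigmaOf a X T]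
      {ω | ∃ c, 0 < p c ∧ localSize s (fun i t => a i t ω) i c = 0} := by
  let _ : MeasurableSpace Ω := sigmaOf a X T
  have h1 : {ω | ∃ c, 0 < p c ∧ localSize s (fun i t => a i t ω) i c = 0} =
      ⋃ c, ⋃ _ : 0 < p c, ⋂ t ∈ Finset.range (s i), {ω | a i t ω = c}ᶜ := by
    ext ω
    simp [localSize, Finset.filter_eq_empty_iff]
  rw [h1]
  refine MeasurableSet.iUnion fun c => MeasurableSet.iUnion fun _ =>
    Finset.measurableSet_biInter _ fun t _ => MeasurableSet.compl ?_
  exact measurable_flip_sigmaOf (a := a) (X := X) (hT t) (measurableSet_singleton c)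

/-- An execution of the asynchronous algorithm in which every gradient is eventually evaluated is
an instance of SGD with stale gradients. -/
theorem staleSGD_of_complete (hs : ∀ i, 0 < A.size i) (hA : RoundGate A Q)
    (hgrad : Measurable (Function.uncurry A.grad)) (hσ : ∀ r, Measurable (σ r))
    (hp : ∑ c, p c = 1) [∀ c, IsProbabilityMeasure (D c)]
    (ha : ∀ i t, Measurable (a i t)) (ha_law : ∀ i t c, P {ω | a i t ω = c} = p c)
    (ha_indep : iIndepFun (fun (z : ℕ × ℕ) ω => a z.1 z.2 ω) P)
    (hX : ∀ c i h, Measurable (X c i h)) (hX_law : ∀ c i h, P.map (X c i h) = D c)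
    (hind : iIndep (tableSigma a X) P) {wstar : E}
    (hN : Integrable (fun ξ => ‖A.grad wstar ξ‖ ^ 2) (mixture p D)) {ρ : ℝ} (hρ0 : 0 ≤ ρ)
    (hρ : ∀ c, 0 < p c → 0 ≤ 1 - (p c : ℝ) ∧ 1 - (p c : ℝ) ≤ ρ)
    (hcomplete : ∀ᵐ ω ∂P, Complete A σ (fun i t => a i t ω) (fun c i h => X c i h ω)) :
    StaleSGD P (mixture p D) A.size Q A.step A.grad A.init wstar (fun i => n * ρ ^ A.size (i - 1))
      (((∑ c, (p c)⁻¹ : ℝ≥0) : ℝ) * ∫ ξ, ‖A.grad wstar ξ‖ ^ 2 ∂(mixture p D))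
      (slotSample A.size a X)
      (fun t ω => localModel A σ (fun i t => a i t ω) (fun c i h => X c i h ω) t) := by
  classical
  have ham : Measurable fun ω i t => a i t ω :=
    measurable_pi_iff.mpr fun i => measurable_pi_iff.mpr fun t => ha i t
  have hXm : Measurable fun ω c i h => X c i h ω := measurable_pi_iff.mpr fun c =>
    measurable_pi_iff.mpr fun i => measurable_pi_iff.mpr fun h => hX c i h
  have hsupp : ∀ᵐ ω ∂P, ∀ i t, 0 < p (a i t ω) := by
    rw [ae_all_iff]; intro i
    rw [ae_all_iff]; intro t
    have h1 : ∀ c, ∀ᵐ ω ∂P, a i t ω = c → 0 < p c := by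
      intro c
      by_cases hc : 0 < p c
      · exact Eventually.of_forall fun _ _ => hc
      · have h2 : P {ω | a i t ω = c} = 0 := by
          rw [ha_law]; simpa using hc
        filter_upwards [measure_eq_zero_iff_ae_notMem.mp h2] with ω hω h3
        exact absurd h3 hω
    filter_upwards [ae_all_iff.mpr h1] with ω hω
    exact hω _ rfl
  obtain ⟨c₀, hc₀⟩ : ∃ c, 0 < p c := by
    by_contra hcon
    push Not at hcon
    have : ∑ c, p c = 0 := Finset.sum_eq_zero fun c _ => le_antisymm (hcon c) zero_le
    rw [hp] at this
    exact one_ne_zero this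
  obtain ⟨ξ₀⟩ : Nonempty Ξ := (D c₀).nonempty_of_neZero
  refine ⟨measurable_slotSample ha hX _, fun t => measurable_localModel hgrad hσ ham hXm t,
    map_slotSample ha hX hind ha_law hX_law,
    fun t u htu => indepFun_slotSample ha hX hind ha_law hX_law htu.symm, ?_, ?_⟩
  · filter_upwards [hcomplete] with ω hω
    exact boundedStaleness_of_complete hs hA hω
  · intro i hi
    set H : Set Ω := {ω | ∃ c, 0 < p c ∧ localSize A.size (fun i t => a i t ω) (i - 1) c = 0}
      with hH
    have hHT : MeasurableSet[sigmaOf a X (indicesBefore n i)] H :=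
      measurableSet_localSize_eq_zero fun t => (by
        change i - 1 < i
        omega)
    have hHinl : MeasurableSet[sigmaOf a X (Set.range Sum.inl)] H :=
      measurableSet_localSize_eq_zero fun t => ⟨_, rfl⟩
    set B : Ω → E := fun ω => if ω ∈ H then wstar else
      iterate A σ (truncFlips i c₀ fun i t => a i t ω) (truncSamples i ξ₀ fun c i h => X c i h ω)
        (roundStart A.size (i - 1 - Q)) with hB
    have hBT : Measurable[sigmaOf a X (indicesBefore n i)] B := by
      have h1 := measurable_iterate_trunc (a := a) (X := X) hgrad hσ i c₀ ξ₀
        (roundStart A.size (i - 1 - Q))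
      let _ : MeasurableSpace Ω := sigmaOf a X (indicesBefore n i)
      exact Measurable.ite (p := fun ω => ω ∈ H) hHT measurable_const h1
    have hHδ := measure_exists_localSize_eq_zero_le (s := A.size) ha ha_law ha_indep hρ0 hρ (i - 1)
    refine ⟨B, H, hBT.mono (sigmaOf_le ha hX _) le_rfl, sigmaOf_le ha hX _ _ hHT, ?_, ?_, ?_, hHδ,
      ?_⟩
    · intro t ht
      refine indepFun_slotSample_of_measurable ha hX hind ha_law hX_law (T := indicesBefore n i)
        ?_ ?_ hBT
      · intro t'
        rw [ht]
        exact lt_irrefl i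
      · intro c h
        rw [ht]
        exact lt_irrefl i
    · filter_upwards [hcomplete, hsupp] with ω hω hω' hωH
      have h1 := iterate_truncate (σ := σ) (p := fun c => 0 < p c) (i := i - 1) (c₀ := c₀)
        (ξ₀ := ξ₀) hs hA hω hω' hc₀ (fun c hc => by
          rw [Nat.pos_iff_ne_zero]
          intro h2
          exact hωH ⟨c, hc, h2⟩) (le_refl (roundStart A.size (i - 1 - Q)))
      rw [show i - 1 + 1 = i by omega] at h1
      simp only [hB, if_neg hωH]
      rw [h1]
      exact (partialIterate_eq_iterate _ _ _).symm
    · intro ω hω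
      simp only [hB, if_pos hω]
    · intro u
      have hm : Measurable fun ξ => ‖A.grad wstar ξ‖ ^ 2 :=
        (hgrad.comp (measurable_const.prodMk measurable_id)).norm.pow_const 2
      refine (setIntegral_slotSample_le ha hX hind ha_law hX_law u hHinl hm
        (fun _ => sq_nonneg _) hN).trans ?_
      have h0 : 0 ≤ ∫ ξ, ‖A.grad wstar ξ‖ ^ 2 ∂(mixture p D) :=
        integral_nonneg fun _ => sq_nonneg _
      gcongr

/-- The rate of convergence of an asynchronous algorithm whose sample sizes and step sizes have
suitable orders of magnitude. -/
theorem exists_rate_of_complete [CompleteSpace E] (hA : RoundGate A Q) {wstar : E} {L μ : ℝ}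
    (ho : StochasticGradient (mixture p D) A.grad wstar L μ) (hs : ∀ i, 0 < A.size i)
    (hstep : ∀ i, 0 ≤ A.step i) (hp : ∑ c, p c = 1) [∀ c, IsProbabilityMeasure (D c)]
    (ha : ∀ i t, Measurable (a i t)) (ha_law : ∀ i t c, P {ω | a i t ω = c} = p c)
    (ha_indep : iIndepFun (fun (z : ℕ × ℕ) ω => a z.1 z.2 ω) P)
    (hX : ∀ c i h, Measurable (X c i h)) (hX_law : ∀ c i h, P.map (X c i h) = D c)
    (hind : iIndep (tableSigma a X) P) {ρ : ℝ} (hρ0 : 0 ≤ ρ)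
    (hρ : ∀ c, 0 < p c → 0 ≤ 1 - (p c : ℝ) ∧ 1 - (p c : ℝ) ≤ ρ)
    (hδ : ∀ c : ℝ, Tendsto (fun i : ℕ => (i : ℝ) ^ c * (n * ρ ^ A.size (i - 1))) atTop (nhds 0))
    {b Cq C : ℝ} {k₀ : ℕ} (hb0 : 0 ≤ b) (hb : ∀ k ≥ k₀, A.size k * A.step k ≤ b * (1 / k))
    (h12 : ∀ i, A.step i * roundStart A.size i ≤ 12 / μ)
    (h11 : ∀ᶠ i in atTop, 11 / μ ≤ A.step i * roundStart A.size i)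
    (hS2 : ∀ᶠ i in atTop, (roundStart A.size (i + 1) : ℝ) ≤ 2 * roundStart A.size i)
    (hq : ∀ᶠ i : ℕ in atTop, roundStart A.size i ≤ 2 * (i * A.size i)) (hCq : 0 < Cq)
    (hq' : ∀ᶠ i : ℕ in atTop, (i * A.size i : ℝ) ≤ Cq * roundStart A.size i)
    (hlog : ∀ᶠ i : ℕ in atTop, (roundStart A.size (i + 1) : ℝ) *
      Real.log (roundStart A.size (i + 1)) ≤ C * (i : ℝ) ^ 2) :
    ∃ K : ℝ, ∀ σ : Scheduler n E Ξ, (∀ r, Measurable (σ r)) →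
      (∀ᵐ ω ∂P, Complete A σ (fun i t => a i t ω) (fun c i h => X c i h ω)) → ∀ t : ℕ, 2 ≤ t →
        (Integrable (fun ω => ‖iterate A σ (fun i t => a i t ω) (fun c i h => X c i h ω) t -
            wstar‖ ^ 2) P ∧
          ∫ ω, ‖iterate A σ (fun i t => a i t ω) (fun c i h => X c i h ω) t - wstar‖ ^ 2 ∂P ≤
            1200 * (∫ z, ‖A.grad wstar z‖ ^ 2 ∂(mixture p D)) / μ ^ 2 * (1 / t) +
              K * (1 / (t * Real.log t))) ∧
        (Integrable (fun ω => ‖localModel A σ (fun i t => a i t ω) (fun c i h => X c i h ω) t -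
            wstar‖ ^ 2) P ∧
          ∫ ω, ‖localModel A σ (fun i t => a i t ω) (fun c i h => X c i h ω) t - wstar‖ ^ 2 ∂P ≤
            1200 * (∫ z, ‖A.grad wstar z‖ ^ 2 ∂(mixture p D)) / μ ^ 2 * (1 / t) +
              K * (1 / (t * Real.log t))) := by
  have hN0 : 0 ≤ ∫ z, ‖A.grad wstar z‖ ^ 2 ∂(mixture p D) := integral_nonneg fun _ => sq_nonneg _
  have hv := eventually_crudeBound_mul_le (step := A.step) hs hb hb0 hstep Q (L := L)
    (r := ‖A.init - wstar‖)
    (κ := ((∑ c, (p c)⁻¹ : ℝ≥0) : ℝ) * ∫ z, ‖A.grad wstar z‖ ^ 2 ∂(mixture p D)) ho.L_pos.le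
    (by positivity) (fun i => by positivity) hδ
  obtain ⟨K, hK⟩ := StaleSGD.exists_rate (P := P) (w₀ := A.init) ho hs hstep zero_le_one hCq
    (eventually_windowSum_le hs hb hb0 Q) hv h12 h11 hS2
    (hq.mono fun i hi => by exact_mod_cast hi) hq' hlog
  refine ⟨K, fun σ hσ hcomplete t ht => ?_⟩
  have hstale := staleSGD_of_complete hs hA ho.meas hσ hp ha ha_law ha_indep hX hX_law hind ho.sq
    hρ0 hρ hcomplete
  obtain ⟨hmodel, hiter⟩ := hK _ _ hstale t ht
  have hint := hstale.integrable_partialIterate ho hs hstep t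
  have heq : ∀ ω, partialIterate A.size A.step A.init
      (fun t => A.grad (localModel A σ (fun i t => a i t ω) (fun c i h => X c i h ω) t)
        (slotSample A.size a X t ω)) t =
      iterate A σ (fun i t => a i t ω) (fun c i h => X c i h ω) t := fun ω =>
    partialIterate_eq_iterate _ _ t
  simp only [iterateError, heq] at hint hiter
  exact ⟨⟨hint, hiter⟩, hstale.integrable_model ho hs hstep t, hmodel⟩

end Instance

/-! ### Estimates for the concrete sample sizes and step sizes -/

section Parameters

variable {d m : ℕ} {L μ : ℝ}

/-- The sum of the step sizes of a round decreases like the inverse number of the round. -/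
theorem exists_sampleSize_mul_roundStep_le (hm : 2 * (d + 1) < m + 1) (hμ : 0 < μ) :
    ∃ (b : ℝ) (k₀ : ℕ), 0 ≤ b ∧ ∀ k ≥ k₀,
      sampleSize d m k * roundStep d m L μ k ≤ b * (1 / k) := by
  obtain ⟨C, hC, hev⟩ := (growsLikeDivLog_sampleSize hm).mul_le_roundStart (by positivity)
  obtain ⟨k₀, hk₀⟩ := eventually_atTop.mp (hev.and (eventually_ge_atTop 1))
  refine ⟨12 / μ * C, k₀, by positivity, fun k hk => ?_⟩
  obtain ⟨h1, h2⟩ := hk₀ k hk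
  have hk0 : (0 : ℝ) < k := by exact_mod_cast h2
  rw [mul_one_div, le_div_iff₀ hk0]
  calc (sampleSize d m k : ℝ) * roundStep d m L μ k * k
      = roundStep d m L μ k * (k * sampleSize d m k) := by ring
    _ ≤ roundStep d m L μ k * (C * roundStart (sampleSize d m) k) :=
      mul_le_mul_of_nonneg_left h1 (roundStep_pos hμ k).le
    _ = roundStep d m L μ k * roundStart (sampleSize d m) k * C := by ring
    _ ≤ 12 / μ * C := mul_le_mul_of_nonneg_right (roundStep_mul_le hμ k) hC.le

theorem GrowsLikeDivLog.tendsto_rpow_mul_pow_pred {s : ℕ → ℕ} {c₁ c₂ ρ : ℝ}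
    (h : GrowsLikeDivLog s c₁ c₂) (hc₁ : 0 < c₁) (hρ0 : 0 ≤ ρ) (hρ : ρ < 1) (n : ℕ) (c : ℝ) :
    Tendsto (fun i : ℕ => (i : ℝ) ^ c * ((n : ℝ) * ρ ^ s (i - 1))) atTop (nhds 0) := by
  have h1 := ((h.tendsto_rpow_mul_pow hc₁ hρ0 hρ (max c 0)).const_mul
    ((2 : ℝ) ^ (max c 0) * n)).comp (tendsto_sub_atTop_nat 1)
  rw [mul_zero] at h1
  refine squeeze_zero' (Eventually.of_forall fun i => by positivity) ?_ h1
  filter_upwards [eventually_ge_atTop 2] with i hi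
  have hi1 : (1 : ℝ) ≤ i := by exact_mod_cast (by omega : 1 ≤ i)
  have hi2 : (i : ℝ) ≤ 2 * ((i - 1 : ℕ) : ℝ) := by exact_mod_cast (by omega : i ≤ 2 * (i - 1))
  have h2 : (i : ℝ) ^ c ≤ (2 : ℝ) ^ (max c 0) * ((i - 1 : ℕ) : ℝ) ^ (max c 0) := by
    rw [← Real.mul_rpow zero_le_two (Nat.cast_nonneg _)]
    exact (Real.rpow_le_rpow_of_exponent_le hi1 (le_max_left _ _)).trans
      (Real.rpow_le_rpow (by positivity) hi2 (le_max_right _ _))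
  simp only [Function.comp_apply]
  calc (i : ℝ) ^ c * ((n : ℝ) * ρ ^ s (i - 1))
      ≤ ((2 : ℝ) ^ (max c 0) * ((i - 1 : ℕ) : ℝ) ^ (max c 0)) * ((n : ℝ) * ρ ^ s (i - 1)) := by
        gcongr
    _ = _ := by ring

end Parameters

end AsyncSGD

theorem theorem2
    -- parameters of the sample size, delay and step size sequences
    (d m : ℕ) (hm : 2 * (d + 1) < m + 1) (L μ : ℝ) (hL : 0 < L) (hμ : 0 < μ)
    -- compute nodes, their weights and their local distributions
    {n : ℕ} (p : Fin n → ℝ≥0) (hp : ∑ c, p c = 1)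
    {Ξ : Type*} [MeasurableSpace Ξ] (D : Fin n → Measure Ξ) [∀ c, IsProbabilityMeasure (D c)]
    -- the loss, the objective `F` and its minimizer
    {q : ℕ} (f : EuclideanSpace ℝ (Fin q) → Ξ → ℝ)
    (hf_int : ∀ w, Integrable (f w) (AsyncSGD.mixture p D))
    (hf_meas : ∀ w, Measurable (f w))
    (hf_diff : ∀ ξ, Differentiable ℝ fun w => f w ξ)
    (hf_smooth : ∀ ξ w w',
      ‖∇ (fun v => f v ξ) w - ∇ (fun v => f v ξ) w'‖ ≤ L * ‖w - w'‖)
    (hf_convex : ∀ ξ w w', inner ℝ (∇ (fun v => f v ξ) w') (w - w') ≤ f w ξ - f w' ξ)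
    (F : EuclideanSpace ℝ (Fin q) → ℝ)
    (hF : ∀ w, F w = ∫ ξ, f w ξ ∂(AsyncSGD.mixture p D))
    (hF_strong : ∀ w w',
      inner ℝ (∇ F w') (w - w') + μ / 2 * ‖w - w'‖ ^ 2 ≤ F w - F w')
    (wstar : EuclideanSpace ℝ (Fin q)) (hwstar : ∀ w, F wstar ≤ F w)
    (N : ℝ)
    (hN_fin : Integrable (fun ξ => ‖∇ (fun v => f v ξ) wstar‖ ^ 2) (AsyncSGD.mixture p D))
    (hN : N = 2 * ∫ ξ, ‖∇ (fun v => f v ξ) wstar‖ ^ 2 ∂(AsyncSGD.mixture p D))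
    (w₀ : EuclideanSpace ℝ (Fin q))
    -- the coin flips of the setup phase and the samples drawn by the compute nodes
    {Ω : Type*} [MeasurableSpace Ω] (P : Measure Ω) [IsProbabilityMeasure P]
    (a : ℕ → ℕ → Ω → Fin n) (ha_meas : ∀ i t, Measurable (a i t))
    (ha_law : ∀ i t c, P {ω | a i t ω = c} = p c)
    (ha_indep : iIndepFun (fun (z : ℕ × ℕ) ω => a z.1 z.2 ω) P)
    (X : Fin n → ℕ → ℕ → Ω → Ξ) (hX_meas : ∀ c i h, Measurable (X c i h))
    (hX_law : ∀ c i h, P.map (X c i h) = D c)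
    (hX_indep : iIndepFun (fun (z : Fin n × ℕ × ℕ) ω => X z.1 z.2.1 z.2.2 ω) P)
    (haX_indep : IndepFun (fun ω (z : ℕ × ℕ) => a z.1 z.2 ω)
      (fun ω (z : Fin n × ℕ × ℕ) => X z.1 z.2.1 z.2.2 ω) P) :
    -- sample sizes and round step sizes have the announced orders of magnitude
    (fun i : ℕ => (AsyncSGD.sampleSize d m i : ℝ)) =Θ[atTop] (fun i : ℕ => (i : ℝ) / Real.log i) ∧
    (AsyncSGD.roundStep d m L μ) =O[atTop] (fun i : ℕ => Real.log i / (i : ℝ) ^ 2) ∧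
    -- convergence rate
    ∃ K : ℝ, ∀ σ : AsyncSGD.Scheduler n (EuclideanSpace ℝ (Fin q)) Ξ,
      (∀ r, Measurable (σ r)) →
      (∀ᵐ ω ∂P, AsyncSGD.Complete (AsyncSGD.algorithm d m L μ f w₀) σ
        (fun i t => a i t ω) (fun c i h => X c i h ω)) →
      ∀ t : ℕ, 2 ≤ t →
        (Integrable (fun ω => ‖AsyncSGD.iterate (AsyncSGD.algorithm d m L μ f w₀) σ
            (fun i t => a i t ω) (fun c i h => X c i h ω) t - wstar‖ ^ 2) P ∧
          ∫ ω, ‖AsyncSGD.iterate (AsyncSGD.algorithm d m L μ f w₀) σ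
            (fun i t => a i t ω) (fun c i h => X c i h ω) t - wstar‖ ^ 2 ∂P ≤
            4 * 36 ^ 2 * N / μ ^ 2 * (1 / t) + K * (1 / (t * Real.log t))) ∧
        (Integrable (fun ω => ‖AsyncSGD.localModel (AsyncSGD.algorithm d m L μ f w₀) σ
            (fun i t => a i t ω) (fun c i h => X c i h ω) t - wstar‖ ^ 2) P ∧
          ∫ ω, ‖AsyncSGD.localModel (AsyncSGD.algorithm d m L μ f w₀) σ
            (fun i t => a i t ω) (fun c i h => X c i h ω) t - wstar‖ ^ 2 ∂P ≤
            4 * 36 ^ 2 * N / μ ^ 2 * (1 / t) + K * (1 / (t * Real.log t))) := by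
  have hs := AsyncSGD.sampleSize_pos hm
  have hgrowth := AsyncSGD.growsLikeDivLog_sampleSize hm
  have hmono := AsyncSGD.sampleSize_mono_of_ge hm
  have hc₁ : (0 : ℝ) < 1 / (32 * ((d : ℝ) + 1) ^ 2) := by positivity
  refine ⟨hgrowth.isTheta hc₁, AsyncSGD.isBigO_roundStep hm hμ, ?_⟩
  have hind := AsyncSGD.iIndep_tableSigma ha_indep hX_indep haX_indep
  have hmix : IsProbabilityMeasure (AsyncSGD.mixture p D) := by
    rw [← AsyncSGD.map_slotSample (s := AsyncSGD.sampleSize d m) ha_meas hX_meas hind ha_law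
      hX_law 0]
    exact Measure.isProbabilityMeasure_map
      (AsyncSGD.measurable_slotSample ha_meas hX_meas _ _).aemeasurable
  have ho := AsyncSGD.stochasticGradient_gradient hL hμ hf_int hf_meas hf_diff hf_smooth hF
    hF_strong hwstar hN_fin
  obtain ⟨Q, hQ⟩ := AsyncSGD.roundGate_algorithm hm L μ
  obtain ⟨ρ, hρ0, hρ1, hρ⟩ := AsyncSGD.exists_miss_bound p hp
  obtain ⟨b, k₀, hb0, hb⟩ := AsyncSGD.exists_sampleSize_mul_roundStep_le hm hμ (L := L)
  obtain ⟨Cq, hCq, hq'⟩ := hgrowth.mul_le_roundStart hc₁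
  obtain ⟨C, hC⟩ := hgrowth.roundStart_mul_log_le hc₁ hs hmono
  obtain ⟨K, hK⟩ := AsyncSGD.exists_rate_of_complete (A := AsyncSGD.algorithm d m L μ f w₀)
    (hQ f w₀) ho hs (fun i => (AsyncSGD.roundStep_pos hμ i).le) hp ha_meas ha_law ha_indep hX_meas
    hX_law hind hρ0 hρ (hgrowth.tendsto_rpow_mul_pow_pred hc₁ hρ0 hρ1 n) hb0 hb
    (AsyncSGD.roundStep_mul_le hμ) (AsyncSGD.eventually_le_roundStep_mul hm hμ)
    (hgrowth.roundStart_succ_le hc₁) (AsyncSGD.roundStart_le_two_mul hs hmono) hCq hq' hC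
  have hN0 : 0 ≤ ∫ ξ, ‖∇ (fun v => f v ξ) wstar‖ ^ 2 ∂(AsyncSGD.mixture p D) :=
    integral_nonneg fun _ => sq_nonneg _
  refine ⟨K, fun σ hσ hcomplete t ht => ?_⟩
  have hbound : 1200 * (∫ ξ, ‖∇ (fun v => f v ξ) wstar‖ ^ 2 ∂(AsyncSGD.mixture p D)) / μ ^ 2 *
      (1 / (t : ℝ)) + K * (1 / (t * Real.log t)) ≤
      4 * 36 ^ 2 * N / μ ^ 2 * (1 / t) + K * (1 / (t * Real.log t)) := by
    rw [hN]
    gcongr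
    · norm_num
    · linarith
  obtain ⟨⟨h1, h2⟩, h3, h4⟩ := hK σ hσ hcomplete t ht
  exact ⟨⟨h1, h2.trans hbound⟩, h3, h4.trans hbound⟩
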